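/- **Setting.** Let $\Sigma$ be a compact smooth manifold with boundary, with a smooth positive volume $d^nx$ and a finite measure on $\partial\Sigma$ (e.g. the surface measure). A gauge field theory on $\Sigma$ has canonical fields $z^A$ ($\sigma^{AB}$ a constant antisymmetric invertible matrix with inverse $\sigma_{AB}$), multipliers $\lambda^a$, and the action $$S=\int dt\Big\{\int_\Sigma \tfrac12 z^A\sigma_{AB}\dot z^B-H\Big\},\qquad H=\int_\Sigma (h(z)+\lambda^a\phi_a(z))+\oint_{\partial\Sigma} b_H(z,\lambda),$$ with $h,\phi_a,b_H$ local. At a fixed time the derivatives $\lambda^{(l)}=d_t^l\lambda$ are independent variables; $\delta F/\delta z^A$, $\delta F/\delta\lambda^{(l)a}$ are functional derivatives with respect to variations supported in the interior, and $\{F,G\}=\int_\Sigma \frac{\delta F}{\delta z^A}\sigma^{AB}\frac{\delta G}{\delta z^B}$. *Internal boundary conditions:* $\chi^\alpha_I(z,\lambda)|_{\partial\Sigma}=\zeta^\alpha$, with $\chi_I^\alpha$ local and independent of time and $\zeta^\alpha$ arbitrary time-dependent boundary fields. *External boundary conditions:* $\phi_a$ and $\dot z^A-\sigma^{AB}\frac{\delta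 H}{\delta z^B}$ vanish on $\partial\Sigma$ with all their derivatives. A functional is local if it is $\int_\Sigma f+\oint_{\partial\Sigma}k$ with $f,k$ smooth functions of $t$, $x$ and finitely many derivatives of the fields $z,\lambda,\dot\lambda,\dots$. Write $\delta_t=\frac{D}{Dt}+\delta_H$ for the time derivative along $\dot z^A=\sigma^{AB}\frac{\delta H}{\delta z^B}$, $d_t\lambda^{(l)}=\lambda^{(l+1)}$. A variation $\delta$ (a smooth vector field on the space of configurations at fixed time) *preserves the internal boundary conditions* if, at all configurations satisfying the external boundary conditions, $\delta\phi_a$ vanishes on $\partial\Sigma$ with all its derivatives and $\delta(\delta_t^k\chi^\alpha_I)|_{\partial\Sigma}=0$ for all $k\ge0$ (on $\partial\Sigma$, $\delta_t^k\chi_I^\alpha$ is the $k$-th time derivative of $\zeta^\alpha$). *Standing assumptions.* (i) The constraints and $h$ are first class: the brackets of $\phi_b$ with $\int_\Sigma h$ and with $\int_\Sigma\lambda^a\phi_a$ are combinations, with local coefficients, of the constraints and their derivatives. (ii) The constraints are regular: at every point of the constraint surface $\{\phi_a=0 \text{ on } \Sigma\}$, and likewise of the set of fields for which all $\phi_a$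 vanish on $\partial\Sigma$ with all derivatives, every solution of the linearised conditions is tangent to a smooth curve in that set. (iii) $\delta H=\int_\Sigma(\frac{\delta H}{\delta z^A}\delta z^A+\phi_a\delta\lambda^a)$ for all $\delta$ preserving the internal boundary conditions, at configurations satisfying the external ones. A couple $(G,\delta^\lambda_G)$ consists of a local functional $G[t,z,\lambda,\dot\lambda,\dots]$ and local functions $\delta_G\lambda^a=\Lambda_G^a(t,z,\lambda,\dot\lambda,\dots)$. It generates the transformation $\tilde\delta_G z^A=Z_G^A=\sigma^{AB}\frac{\delta G}{\delta z^B}$, $\tilde\delta_G\lambda^{(l)a}=\delta_t^l\Lambda_G^a$. It *generates an external symmetry* if, at all configurations satisfying the external boundary conditions and for all $\delta$ preserving the internal ones, $$[\tilde\delta_G,\delta]\chi_I^\alpha|_{\partial\Sigma}=0,\qquad \delta G=\int_\Sigma\Big(\frac{\delta G}{\delta z^A}\delta z^A+\sum_l\frac{\delta G}{\delta\lambda^{(l)a}}\delta\lambda^{(l)a}\Big),$$ and there are a local functional $U$ and a local boundary term $\oint V_G$ with $G=\frac12\int_\Sigma z^A\sigma_{AB}Z_G^B-U$ such that the transformation varies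 the integrand $\int_\Sigma\frac12 z^A\sigma_{AB}\dot z^B-H$ of the action by $\frac{d}{dt}U+\oint_{\partial\Sigma} V_G$, for all values of the fields and of $\dot z$ satisfying the external boundary conditions, and $\delta\oint_{\partial\Sigma} V_G=0$. It *generates a proper gauge transformation* if moreover $\tilde\delta_G\chi_I^\alpha|_{\partial\Sigma}=0$ at all configurations satisfying the external boundary conditions, and $G\approx0$, i.e. $G$ vanishes on the constraint surface. The bracket of couples is $$[(G_1,\delta^\lambda_1),(G_2,\delta^\lambda_2)]=\big(\tilde\delta_1G_2-\tilde\delta_2G_1-\{G_2,G_1\},\ \delta^\lambda_{[1,2]}\big),\qquad \delta^\lambda_{[1,2]}\lambda^a=\tilde\delta_1\Lambda_2^a-\tilde\delta_2\Lambda_1^a,$$ where $\tilde\delta_1G_2$ is the full variation, boundary terms included. **Theorem.** If $(G,\delta^\lambda_G)$ generates an external symmetry, then $G$ is a first-class functional: for all $(\Gamma,\delta^\lambda_\Gamma)$ generating proper gauge transformations, $[(G,\delta^\lambda_G),(\Gamma,\delta^\lambda_\Gamma)]$ generates a proper gauge transformation. Thus the proper gauge transformations form an ideal: the couples generating external symmetries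 form a real vector space closed under the bracket, and those generating proper gauge transformations form a linear subspace of it that contains the brackets, in either order, of its elements with all couples generating external symmetries. -/

import Mathlib

open scoped Manifold ContDiff
open MeasureTheory

noncomputable section

namespace GaugeBC

section Space

variable (n : ℕ) [NeZero n] (M : Type*) [TopologicalSpace M]
  [ChartedSpace (EuclideanHalfSpace n) M] [IsManifold (𝓡∂ n) ∞ M]

/-- Smooth real functions on the space `M`, an `n`-manifold with boundary (smooth up to the
boundary). -/
abbrev Fn := C^∞⟮𝓡∂ n, M; ℝ⟯

variable {n M}

/-- `X` is the derivative along a smooth vector field of `M`. -/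
def IsVectorField (X : Module.End ℝ (Fn n M)) : Prop :=
  ∃ V : (x : M) → TangentSpace (𝓡∂ n) x,
    ContMDiff (𝓡∂ n) (𝓡∂ n).tangent ∞ (fun x => (⟨x, V x⟩ : TangentBundle (𝓡∂ n) M)) ∧
    ∀ (f : Fn n M) (x : M), X f x = mfderiv (𝓡∂ n) 𝓘(ℝ, ℝ) f x (V x)

variable (n M)

/-- The algebra of linear differential operators on `M`, generated by the multiplications by
smooth functions and the derivatives along smooth vector fields. In coordinates its elements are
the finite sums of `a(x) ∂_I`. -/
def diffOps : Subalgebra ℝ (Module.End ℝ (Fn n M)) :=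
  Algebra.adjoin ℝ
    (Set.range (fun f : Fn n M => LinearMap.mulLeft ℝ f) ∪ {X | IsVectorField X})

variable {n M}

/-- `f` vanishes at the points of `K` together with all its derivatives. -/
def FlatOn (K : Set M) (f : Fn n M) : Prop :=
  ∀ D ∈ diffOps n M, ∀ x ∈ K, D f x = 0

open Classical in
/-- A function on `M` as an element of `Fn n M`. It is only applied to smooth functions. -/
def toFn (f : M → ℝ) : Fn n M :=
  if hf : ContMDiff (𝓡∂ n) 𝓘(ℝ, ℝ) ∞ f then ⟨f, hf⟩ else 0

/-- `μ` is the measure of a smooth positive volume form: it is finite, charges every nonempty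
open set, and every vector field `X` has a smooth divergence `d`, that is,
`∫ (X u + d u) dμ = 0` for all `u` that vanish on the boundary. -/
structure IsVolume [MeasurableSpace M] (μ : Measure M) : Prop where
  finite : IsFiniteMeasure μ
  openPos : μ.IsOpenPosMeasure
  divergence : ∀ X : Module.End ℝ (Fn n M), IsVectorField X → ∃ d : Fn n M,
    ∀ u : Fn n M, (∀ x ∈ (𝓡∂ n).boundary M, u x = 0) → ∫ x, (X u x + d x * u x) ∂μ = 0

end Space

section Fields

variable (n : ℕ) [NeZero n] (M : Type*) [TopologicalSpace M]
  [ChartedSpace (EuclideanHalfSpace n) M] [IsManifold (𝓡∂ n) ∞ M] (N m : ℕ)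

/-- A field configuration at a fixed time: the canonical variables `z^A` and the Lagrange
multipliers `λ^a` together with their time derivatives of all orders, which at a fixed time are
independent variables. For `c : Config n M N m`, `c.1 A` is `z^A` and `c.2 l a` is the `l`-th time
derivative of `λ^a`. -/
abbrev Config := (Fin N → Fn n M) × (ℕ → Fin m → Fn n M)

/-- A couple `(G, δ^λ_G)`: a functional `G[t, z, λ, λ', …]` and the variation
`Λ^a = δ_G λ^a` of the multipliers. -/
abbrev Couple := (ℝ → Config n M N m → ℝ) × (ℝ → Config n M N m → Fin m → Fn n M)

variable {n M N m}

/-- The components of a configuration. -/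
def comp (c : Config n M N m) : Fin N ⊕ (ℕ × Fin m) → Fn n M
  | Sum.inl A => c.1 A
  | Sum.inr (l, a) => c.2 l a

/-- `f` is a local function: `f(t, z, λ, λ', …)(x)` is a smooth function of `t`, `x` and of
finitely many derivatives at `x` of finitely many of the fields `z^A`, `λ^a`, `d_t λ^a`, …. -/
def IsLocal (f : ℝ → Config n M N m → Fn n M) : Prop :=
  ∃ (p : ℕ) (i : Fin p → Fin N ⊕ (ℕ × Fin m)) (D : Fin p → Module.End ℝ (Fn n M))
    (F : ℝ × M × (Fin p → ℝ) → ℝ),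
    (∀ j, D j ∈ diffOps n M) ∧
    ContMDiff (𝓘(ℝ, ℝ).prod ((𝓡∂ n).prod 𝓘(ℝ, Fin p → ℝ))) 𝓘(ℝ, ℝ) ∞ F ∧
    ∀ t c x, f t c x = F (t, x, fun j => D j (comp c (i j)) x)

/-- A family of configurations that depends smoothly on `p` real parameters. -/
def IsSmoothFamily {p : ℕ} (c : (Fin p → ℝ) → Config n M N m) : Prop :=
  ∀ i, ContMDiff (𝓘(ℝ, Fin p → ℝ).prod (𝓡∂ n)) 𝓘(ℝ, ℝ) ∞
    (fun y : (Fin p → ℝ) × M => comp (c y.1) i y.2)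

/-- A field variation `δ`: a vector field on the space of configurations, possibly depending on
time, that is smooth in the sense that it sends smooth families to smooth families. -/
def IsVariation (δ : ℝ → Config n M N m → Config n M N m) : Prop :=
  ∀ (p : ℕ) (τ : (Fin p → ℝ) → ℝ) (c : (Fin p → ℝ) → Config n M N m),
    ContDiff ℝ ∞ τ → IsSmoothFamily c → IsSmoothFamily (fun s => δ (τ s) (c s))

/-- The variation of the function `f` of the fields in the direction `v`. -/
def vary (f : ℝ → Config n M N m → Fn n M) (t : ℝ) (c v : Config n M N m) : Fn n M :=
  toFn fun x => deriv (fun s : ℝ => f t (c + s • v) x) 0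

/-- The variation of the functional `F` in the direction `v`, including boundary terms. -/
def varyF (F : ℝ → Config n M N m → ℝ) (t : ℝ) (c v : Config n M N m) : ℝ :=
  deriv (fun s : ℝ => F t (c + s • v)) 0

/-- The tangent vector `(w, λ', λ'', …)` of an evolution through the configuration `c` with
`dz/dt = w`. -/
def evolution (c : Config n M N m) (w : Fin N → Fn n M) : Config n M N m :=
  (w, fun l => c.2 (l + 1))

/-- The total time derivative of `f` along an evolution with `dz/dt = w`. -/
def timeDeriv (f : ℝ → Config n M N m → Fn n M) (t : ℝ) (c : Config n M N m)
    (w : Fin N → Fn n M) : Fn n M :=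
  toFn fun x => deriv (fun s : ℝ => f (t + s) (c + s • evolution c w) x) 0

/-- The total time derivative of the functional `F` along an evolution with `dz/dt = w`. -/
def timeDerivF (F : ℝ → Config n M N m → ℝ) (t : ℝ) (c : Config n M N m)
    (w : Fin N → Fn n M) : ℝ :=
  deriv (fun s : ℝ => F (t + s) (c + s • evolution c w)) 0

/-- The variation of the single field `z^A` by `u`. -/
def zDir (A : Fin N) (u : Fn n M) : Config n M N m := (Pi.single A u, 0)

/-- The variation of the single field `(d_t)^l λ^a` by `u`. -/
def lDir (l : ℕ) (a : Fin m) (u : Fn n M) : Config n M N m := (0, Pi.single l (Pi.single a u))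

open Classical in
/-- The functional derivative of `F` with respect to the field that is varied by `ι`: the smooth
function `e` with `δF = ∫ e u dμ` for all variations `u` supported in the interior of `M`. -/
def funcDeriv [MeasurableSpace M] (μ : Measure M) (F : ℝ → Config n M N m → ℝ)
    (ι : Fn n M → Config n M N m) (t : ℝ) (c : Config n M N m) : Fn n M :=
  if hF : ∃ e : Fn n M, ∀ u : Fn n M, tsupport u ⊆ (𝓡∂ n).interior M →
      HasDerivAt (fun s : ℝ => F t (c + s • ι u)) (∫ x, e x * u x ∂μ) 0
  then hF.choose else 0

end Fields

/-- The data of a gauge field theory on the space `M`: the volume `μ` of `M` and the measure `ν`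
of its boundary, the matrix `σ^{AB}`, the Hamiltonian density `h(z)`, the constraints `φ_a(z)`,
the boundary term `b_H(z, λ)` of the Hamiltonian, and the operators `χ_I^α(z, λ)` of the internal
boundary conditions `χ_I^α(z, λ) = ζ^α`. -/
structure Theory (n : ℕ) [NeZero n] (M : Type*) [TopologicalSpace M]
    [ChartedSpace (EuclideanHalfSpace n) M] [IsManifold (𝓡∂ n) ∞ M] [MeasurableSpace M] (N m r : ℕ) where
  μ : Measure M
  ν : Measure M
  σ : Matrix (Fin N) (Fin N) ℝ
  h : (Fin N → Fn n M) → Fn n M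
  φ : Fin m → (Fin N → Fn n M) → Fn n M
  bH : (Fin N → Fn n M) → (Fin m → Fn n M) → Fn n M
  χ : Fin r → (Fin N → Fn n M) → (Fin m → Fn n M) → Fn n M

namespace Theory

variable {n : ℕ} [NeZero n] {M : Type*} [TopologicalSpace M]
  [ChartedSpace (EuclideanHalfSpace n) M] [IsManifold (𝓡∂ n) ∞ M] [MeasurableSpace M] {N m r : ℕ}
  (T : Theory n M N m r)

/-- The constraint `φ_a` as a function of the configuration. -/
def phi (a : Fin m) : ℝ → Config n M N m → Fn n M := fun _ c => T.φ a c.1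

/-- The operator `χ_I^α` as a function of the configuration. -/
def chi (α : Fin r) : ℝ → Config n M N m → Fn n M := fun _ c => T.χ α c.1 (c.2 0)

/-- `F` is a local functional `∫ f + ∮ k`. -/
def IsLocalFunctional (F : ℝ → Config n M N m → ℝ) : Prop :=
  ∃ f k : ℝ → Config n M N m → Fn n M, IsLocal f ∧ IsLocal k ∧
    ∀ t c, F t c = ∫ x, f t c x ∂T.μ + ∫ x, k t c x ∂T.ν

/-- The Hamiltonian `H[z, λ] = ∫ (h + λ^a φ_a) + ∮ b_H`. -/
def H : ℝ → Config n M N m → ℝ := fun _ c =>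
  ∫ x, (T.h c.1 x + ∑ a, c.2 0 a x * T.φ a c.1 x) ∂T.μ + ∫ x, T.bH c.1 (c.2 0) x ∂T.ν

/-- `δF/δz^A` -/
def dz (F : ℝ → Config n M N m → ℝ) (A : Fin N) : ℝ → Config n M N m → Fn n M :=
  funcDeriv T.μ F (zDir A)

/-- `δF/δ(d_t)^l λ^a` -/
def dl (F : ℝ → Config n M N m → ℝ) (l : ℕ) (a : Fin m) : ℝ → Config n M N m → Fn n M :=
  funcDeriv T.μ F (lDir l a)

/-- The Hamiltonian vector field `Z^A = σ^{AB} δF/δz^B`. -/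
def Z (F : ℝ → Config n M N m → ℝ) (t : ℝ) (c : Config n M N m) : Fin N → Fn n M :=
  fun A => ∑ B, T.σ A B • T.dz F B t c

/-- The Poisson bracket `{F, G} = ∫ δF/δz^A σ^{AB} δG/δz^B`. -/
def poisson (F G : ℝ → Config n M N m → ℝ) (t : ℝ) (c : Config n M N m) : ℝ :=
  ∫ x, ∑ A, ∑ B, T.dz F A t c x * T.σ A B * T.dz G B t c x ∂T.μ

/-- `δ_t = D/Dt + δ_H`: the time derivative along the evolution generated by `H`. -/
def deltaT (f : ℝ → Config n M N m → Fn n M) : ℝ → Config n M N m → Fn n M :=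
  fun t c => timeDeriv f t c (T.Z T.H t c)

/-- The transformation generated by a couple: `z^A` varies by `σ^{AB} δG/δz^B` and
`(d_t)^l λ^a` by `(δ_t)^l Λ^a`. -/
def tilde (G : Couple n M N m) (t : ℝ) (c : Config n M N m) : Config n M N m :=
  (T.Z G.1 t c, fun l a => (T.deltaT^[l] fun t c => G.2 t c a) t c)

/-- The bracket `[(G₁, δ^λ₁), (G₂, δ^λ₂)] = ({G₂, G₁}_g, δ^λ_{[1,2]})` with
`{G₂, G₁}_g = δ₁ G₂ - δ₂ G₁ - {G₂, G₁}` and `δ_{[1,2]} λ^a = δ₁ Λ₂^a - δ₂ Λ₁^a`. -/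
def bracket (G₁ G₂ : Couple n M N m) : Couple n M N m :=
  (fun t c => varyF G₂.1 t c (T.tilde G₁ t c) - varyF G₁.1 t c (T.tilde G₂ t c)
      - T.poisson G₂.1 G₁.1 t c,
    fun t c a => vary (fun t c => G₂.2 t c a) t c (T.tilde G₁ t c)
      - vary (fun t c => G₁.2 t c a) t c (T.tilde G₂ t c))

/-- The external boundary conditions on a configuration at a fixed time: the constraints and all
their derivatives vanish on the boundary. The other external boundary condition, that the
equations `dz/dt = σ δH/δz` hold on the boundary with all their derivatives, restricts `dz/dt`
only. -/
def ExternalBC (c : Config n M N m) : Prop :=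
  ∀ a, FlatOn ((𝓡∂ n).boundary M) (T.φ a c.1)

/-- `δ` preserves the internal boundary conditions: at every configuration that obeys the external
boundary conditions, it preserves the latter and leaves the boundary fields `ζ^α` fixed. These
depend on time, and since the equations of motion hold on the boundary the value there of the
`k`-th time derivative of `ζ^α` is `(δ_t)^k χ_I^α`. -/
def PreservesInternal (δ : ℝ → Config n M N m → Config n M N m) : Prop :=
  ∀ t c, T.ExternalBC c →
    (∀ a, FlatOn ((𝓡∂ n).boundary M) (vary (T.phi a) t c (δ t c))) ∧
    ∀ k α, ∀ x ∈ (𝓡∂ n).boundary M, vary (T.deltaT^[k] (T.chi α)) t c (δ t c) x = 0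

/-- `δF = ∫ (δF/δz^A δz^A + ∑_l δF/δλ^{(l)a} δλ^{(l)a})`, without boundary term, for the variations
that preserve the internal boundary conditions. -/
def IsDifferentiable (F : ℝ → Config n M N m → ℝ) : Prop :=
  ∀ δ, IsVariation δ → T.PreservesInternal δ → ∀ t c, T.ExternalBC c →
    varyF F t c (δ t c) =
      ∫ x, (∑ A, T.dz F A t c x * (δ t c).1 A x
        + ∑ᶠ l, ∑ a, T.dl F l a t c x * (δ t c).2 l a x) ∂T.μ

/-- `∫ z^A σ_{AB} w^B`, where `σ_{AB}` is the inverse of `σ^{AB}`. -/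
def symp (z w : Fin N → Fn n M) : ℝ :=
  ∫ x, ∑ A, ∑ B, z A x * T.σ⁻¹ A B * w B x ∂T.μ

/-- The Lagrangian `∫ ½ z^A σ_{AB} dz^B/dt - H`, the integrand of the action, with `dz/dt = w`. -/
def lagrangian (t : ℝ) (c : Config n M N m) (w : Fin N → Fn n M) : ℝ :=
  (1 / 2) * T.symp c.1 w - T.H t c

/-- The variation of the Lagrangian under the transformation generated by a couple, which varies
`w = dz/dt` by the total time derivative of `Z`. -/
def varyLagrangian (G : Couple n M N m) (t : ℝ) (c : Config n M N m) (w : Fin N → Fn n M) : ℝ :=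
  deriv (fun s : ℝ => T.lagrangian t (c + s • T.tilde G t c)
    (w + s • fun A => timeDeriv (fun t c => T.Z G.1 t c A) t c w)) 0

/-- The couple `(G, δ^λ_G)` generates an external symmetry of the action: `G` is a local functional
and `Λ` a local function; the variation of the boundary fields `ζ^α` depends on the boundary fields
only; `G` is differentiable; and, for all values of the fields and of `w = dz/dt` that obey the
external boundary conditions, the Lagrangian varies by a total time derivative `dU/dt` and a
boundary term that depends on the boundary fields only. Here `U` and `G` are related as in Noether's
theorem by `G = ½ ∫ z^A σ_{AB} Z^B - U`. -/
structure IsExternalSymmetry (G : Couple n M N m) : Prop where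
  local_functional : T.IsLocalFunctional G.1
  local_multiplier : ∀ a, IsLocal fun t c => G.2 t c a
  sources : ∀ δ, IsVariation δ → T.PreservesInternal δ → ∀ t c, T.ExternalBC c →
    ∀ α, ∀ x ∈ (𝓡∂ n).boundary M,
      vary (fun t c => vary (T.chi α) t c (δ t c)) t c (T.tilde G t c) x
        - vary (fun t c => vary (T.chi α) t c (T.tilde G t c)) t c (δ t c) x = 0
  differentiable : T.IsDifferentiable G.1
  invariance : ∃ U : ℝ → Config n M N m → ℝ, ∃ V : ℝ → Config n M N m → Fn n M,
    T.IsLocalFunctional U ∧ IsLocal V ∧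
    (∀ t c, G.1 t c = (1 / 2) * T.symp c.1 (T.Z G.1 t c) - U t c) ∧
    (∀ t c w, T.ExternalBC c →
      (∀ A, FlatOn ((𝓡∂ n).boundary M) (w A - T.Z T.H t c A)) →
      T.varyLagrangian G t c w = timeDerivF U t c w + ∫ x, V t c x ∂T.ν) ∧
    ∀ δ, IsVariation δ → T.PreservesInternal δ → ∀ t c, T.ExternalBC c →
      varyF (fun t c => ∫ x, V t c x ∂T.ν) t c (δ t c) = 0

/-- `F ≈ 0`: the functional `F` vanishes on the constraint surface. -/
def WeaklyZero (F : ℝ → Config n M N m → ℝ) : Prop :=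
  ∀ t c, (∀ a, T.φ a c.1 = 0) → F t c = 0

/-- The couple `(Γ, δ^λ_Γ)` generates a proper gauge transformation. -/
structure IsProperGauge (Γ : Couple n M N m) : Prop where
  external : T.IsExternalSymmetry Γ
  internal : ∀ t c, T.ExternalBC c → ∀ α, ∀ x ∈ (𝓡∂ n).boundary M,
    vary (T.chi α) t c (T.tilde Γ t c) x = 0
  weaklyZero : T.WeaklyZero Γ.1

/-- `f` is a combination, with local coefficients, of the constraints and their derivatives. -/
def IsCombination (f : ℝ → Config n M N m → Fn n M) : Prop :=
  ∃ (q : ℕ) (a : Fin q → Fin m) (D : Fin q → Module.End ℝ (Fn n M))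
    (C : Fin q → ℝ → Config n M N m → Fn n M),
    (∀ j, D j ∈ diffOps n M ∧ IsLocal (C j)) ∧
    ∀ t c, f t c = ∑ j, C j t c * D j (T.φ (a j) c.1)

/-- First-class constraints and Hamiltonian: the brackets of `φ_b` with `∫ h` and with the
constraints `∫ λ^a φ_a`, smeared with arbitrary functions `λ^a`, are combinations of the
constraints and their derivatives. -/
def FirstClass : Prop :=
  ∀ b,
    T.IsCombination (fun t c =>
      vary (T.phi b) t c (T.Z (fun _ c => ∫ x, T.h c.1 x ∂T.μ) t c, 0)) ∧
    T.IsCombination (fun t c =>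
      vary (T.phi b) t c
        (T.Z (fun _ c => ∫ x, ∑ a, c.2 0 a x * T.φ a c.1 x ∂T.μ) t c, 0))

/-- The set of the fields whose constraints vanish on `K` with all their derivatives is regular:
every solution `v` of the linearised conditions is tangent to a smooth curve in this set. -/
def RegularOn (K : Set M) : Prop :=
  ∀ z v : Fin N → Fn n M, (∀ a, FlatOn K (T.φ a z)) →
    (∀ a, FlatOn K (vary (T.phi a) 0 (z, 0) (v, 0))) →
    ∃ γ : ℝ → Fin N → Fn n M,
      (∀ A, ContMDiff (𝓘(ℝ, ℝ).prod (𝓡∂ n)) 𝓘(ℝ, ℝ) ∞ (fun y : ℝ × M => γ y.1 A y.2)) ∧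
      γ 0 = z ∧ (∀ A x, HasDerivAt (fun s => γ s A x) (v A x) 0) ∧
      ∀ s a, FlatOn K (T.φ a (γ s))

/-- The standing assumptions on a gauge field theory: `σ` is antisymmetric and invertible, `μ` is
a volume of `M` and `ν` a finite measure on its boundary, all operators are local, the constraints
and the Hamiltonian are first class, the constraint surface and the set of the configurations that
obey the external boundary conditions are regular, and the Hamiltonian has a well-defined
variation. -/
structure Admissible : Prop where
  antisymm : T.σ.transpose = -T.σ
  invertible : IsUnit T.σ.det
  volume : IsVolume (n := n) T.μ
  boundary_finite : IsFiniteMeasure T.ν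
  boundary_carried : T.ν ((𝓡∂ n).interior M) = 0
  local_h : IsLocal (fun _ (c : Config n M N m) => T.h c.1)
  local_phi : ∀ a, IsLocal (T.phi a)
  local_bH : IsLocal (fun _ (c : Config n M N m) => T.bH c.1 (c.2 0))
  local_chi : ∀ α, IsLocal (T.chi α)
  first_class : T.FirstClass
  regular_surface : T.RegularOn Set.univ
  regular_boundary : T.RegularOn ((𝓡∂ n).boundary M)
  hamiltonian : T.IsDifferentiable T.H

end Theory

end GaugeBC

end

/-!
The proof separates the boundary from the bulk: on a boundary where the external boundary
conditions hold, everything that matters is a function which is flat there, that is, vanishes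
together with all its derivatives, and flat functions can be integrated by parts without boundary
terms.

Let `S` be the set of the configurations that obey the external boundary conditions. In Hamiltonian
form (`invariance_iff`), the invariance of the action says that on `S`
`δ_t G - {G, H} - δ_G H = ∮ V`, where `δ_t` differentiates along the evolution generated by `H`.
The functional derivatives of this condition are the Noether identities (`IsNoether.el_identity`).
A downward induction on the number of time derivatives shows that `δG/δλ^{(l)a}` vanishes on the
constraint surface, and is flat on the boundary at the points of `S`
(`IsNoether.flatOn_el_inr`); here the evolution is tangent to both sets because the constraints are
first class, and regularity of the constraints allows conditions which hold on these sets to be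
differentiated along tangent vectors (`RegularOn.flatOn_lie`). It follows that symmetry
transformations `δ_G` are tangent to both sets (`IsNoether.tangentOn`) and commute with the time
evolution up to flat terms (`IsNoether.flatOn_brk_evol`, `IsNoether.flatOn_lie_deltaT_sub`).
Therefore the commutators of `δ_G`, and of `δ_t`, with the variations that preserve the internal
boundary conditions preserve them again (`IsNoether.preserving_brk`).

For two symmetries, the functional derivatives of the bracket functional `G₃` are
`δ₁ (δG₂/δφ) - δ₂ (δG₁/δφ)`, with `φ` any of the fields, plus adjoint operators applied to
derivatives with respect to the multipliers (`exists_el_bracket`). Hence `δ₃` is the commutator of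
`δ₁` and `δ₂` up to flat terms (`IsNoether.flatOn_tilde_bracket`). The invariance of the action, the
differentiability of `G₃`, and the conditions on the boundary fields then follow by taking
commutators of the corresponding conditions for `G₁` and `G₂` (`IsSymmetry.bracket`).

If `Γ` generates a proper gauge transformation, `δ_Γ` itself is a variation that preserves the
internal boundary conditions (`IsProper.preserving`). So the condition on the sources of `G`,
applied to `δ_Γ`, shows that the bracket of `G` and `Γ` does not act on the boundary fields; and on
the constraint surface `δ_G Γ` vanishes by tangency, while `δ_Γ G` is cancelled by the Poisson
bracket since `G` is differentiable (`IsSymmetry.isProper_bracket`).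

Configuration-space calculus is done with maps that send smooth families to smooth families. The
derivative `lie f t c α v` is along the tangent vector `(α, v)` of the space of times and
configurations, so that it covers variations (`α = 0`) as well as time derivatives (`α = 1`).
-/

noncomputable section

namespace GaugeBC

set_option linter.unusedSectionVars false

/-! ### Parametric integrals of smooth functions -/

section ParametricIntegral

variable {E F : Type} [NormedAddCommGroup E] [NormedSpace ℝ E] [NormedAddCommGroup F]
  [NormedSpace ℝ F]

/-- Differentiation under the integral sign, relative to a convex set of parameters; this form
applies in the charts at boundary points. -/
theorem hasFDerivWithinAt_integral_param [CompleteSpace F] {s : Set E} (hs : Convex ℝ s)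
    {q : ℝ → E → F} {q' : ℝ → E → E →L[ℝ] F}
    (hq : ContinuousOn (Function.uncurry q) (Set.univ ×ˢ s))
    (hq' : ContinuousOn (Function.uncurry q') (Set.univ ×ˢ s))
    (h : ∀ u, ∀ y ∈ s, HasFDerivWithinAt (q u) (q' u y) s y) {y : E} (hy : y ∈ s) :
    HasFDerivWithinAt (fun y => ∫ u in (0 : ℝ)..1, q u y) (∫ u in (0 : ℝ)..1, q' u y) s y := by
  have hcq : ∀ y ∈ s, Continuous fun u => q u y := fun y hy =>
    hq.comp_continuous (f := fun u : ℝ => (u, y)) (by fun_prop) fun u => ⟨trivial, hy⟩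
  have hcq' : Continuous fun u => q' u y :=
    hq'.comp_continuous (f := fun u : ℝ => (u, y)) (by fun_prop) fun u => ⟨trivial, hy⟩
  refine HasFDerivAtFilter.of_isLittleO ?_
  rw [Asymptotics.isLittleO_iff]
  intro ε hε
  have hsw : ContinuousOn (Function.uncurry fun (p : E) (u : ℝ) => q' u p)
      (s ×ˢ Set.Icc (0 : ℝ) 1) :=
    hq'.comp (f := fun z : E × ℝ => (z.2, z.1)) (by fun_prop) fun z hz => ⟨trivial, hz.1⟩
  obtain ⟨v, hv, hvu⟩ := isCompact_Icc.mem_uniformity_of_prod hsw hy (Metric.dist_mem_uniformity hε)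
  obtain ⟨r, hr, hrv⟩ := Metric.mem_nhdsWithin_iff.1 hv
  have hcs : Convex ℝ (Metric.ball y r ∩ s) := (convex_ball y r).inter hs
  rw [Filter.eventually_iff_exists_mem]
  refine ⟨(Metric.ball y r ∩ s) ×ˢ {y}, ?_, ?_⟩
  · refine Filter.prod_mem_prod ?_ (by simp)
    exact Filter.inter_mem (mem_nhdsWithin_of_mem_nhds (Metric.ball_mem_nhds y hr))
      self_mem_nhdsWithin
  rintro ⟨y', y''⟩ ⟨hy', rfl : y'' = y⟩
  have key : ∀ u ∈ Set.Icc (0 : ℝ) 1, ‖q u y' - q u y'' - q' u y'' (y' - y'')‖ ≤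
      ε * ‖y' - y''‖ := by
    intro u hu
    refine hcs.norm_image_sub_le_of_norm_hasFDerivWithin_le' (f' := fun z => q' u z)
      (fun z hz => (h u z hz.2).mono Set.inter_subset_right) ?_
      ⟨Metric.mem_ball_self hr, hy⟩ hy'
    intro z hz
    have := hvu z (hrv hz) u hu
    rw [← dist_eq_norm]
    exact le_of_lt this
  have hi : ∀ z ∈ s, IntervalIntegrable (fun u => q u z) volume 0 1 := fun z hz =>
    (hcq z hz).intervalIntegrable _ _
  have hi' : IntervalIntegrable (fun u => q' u y'') volume 0 1 := hcq'.intervalIntegrable _ _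
  have h1 : (∫ u in (0 : ℝ)..1, q' u y'') (y' - y'') = ∫ u in (0 : ℝ)..1, q' u y'' (y' - y'') :=
    ContinuousLinearMap.intervalIntegral_apply hi' _
  have h2 : Continuous fun u => q' u y'' (y' - y'') := hcq'.clm_apply continuous_const
  simp only
  rw [h1, ← intervalIntegral.integral_sub (hi _ hy'.2) (hi _ hy),
    ← intervalIntegral.integral_sub ((hi _ hy'.2).sub (hi _ hy)) (h2.intervalIntegrable _ _)]
  refine (intervalIntegral.norm_integral_le_of_norm_le_const (C := ε * ‖y' - y''‖)
    fun u hu => ?_).trans (by simp)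
  refine key u ?_
  rw [Set.uIoc_of_le zero_le_one] at hu
  exact ⟨hu.1.le, hu.2⟩

theorem contDiffOn_integral_param_nat {s : Set E} (hs : Convex ℝ s) (hu : UniqueDiffOn ℝ s)
    (k : ℕ) {F : Type} [NormedAddCommGroup F] [NormedSpace ℝ F] [CompleteSpace F]
    {q : ℝ → E → F} (hq : ContDiffOn ℝ k (Function.uncurry q) (Set.univ ×ˢ s)) :
    ContDiffOn ℝ k (fun y => ∫ u in (0 : ℝ)..1, q u y) s := by
  induction k generalizing F with
  | zero =>
    simp only [CharP.cast_eq_zero, contDiffOn_zero] at hq ⊢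
    intro y hy
    have hsw : ContinuousOn (Function.uncurry fun (p : E) (u : ℝ) => q u p)
        (s ×ˢ Set.Icc (0 : ℝ) 1) :=
      hq.comp (f := fun z : E × ℝ => (z.2, z.1)) (by fun_prop) fun z hz => ⟨trivial, hz.1⟩
    have hcq : ∀ y ∈ s, Continuous fun u => q u y := fun y hy =>
      hq.comp_continuous (f := fun u : ℝ => (u, y)) (by fun_prop) fun u => ⟨trivial, hy⟩
    rw [Metric.continuousWithinAt_iff']
    intro ε hε
    obtain ⟨v, hv, hvu⟩ := isCompact_Icc.mem_uniformity_of_prod hsw hy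
      (Metric.dist_mem_uniformity (half_pos hε))
    filter_upwards [hv, self_mem_nhdsWithin] with z hz hzs
    rw [dist_eq_norm, ← intervalIntegral.integral_sub ((hcq z hzs).intervalIntegrable _ _)
      ((hcq y hy).intervalIntegrable _ _)]
    refine (intervalIntegral.norm_integral_le_of_norm_le_const (C := ε / 2)
      fun u hu => ?_).trans_lt (by simpa using hε)
    rw [Set.uIoc_of_le zero_le_one] at hu
    rw [← dist_eq_norm]
    exact le_of_lt (hvu z hz u ⟨hu.1.le, hu.2⟩)
  | succ k ih =>
    have hU : UniqueDiffOn ℝ ((Set.univ : Set ℝ) ×ˢ s) := uniqueDiffOn_univ.prod hu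
    push_cast at hq ⊢
    rw [contDiffOn_succ_iff_fderivWithin hU] at hq
    obtain ⟨hd, -, hq'⟩ := hq
    set q' : ℝ → E → E →L[ℝ] F := fun u y =>
      (fderivWithin ℝ (Function.uncurry q) (Set.univ ×ˢ s) (u, y)).comp
        (ContinuousLinearMap.inr ℝ ℝ E) with hq'def
    have hq'c : ContDiffOn ℝ k (Function.uncurry q') (Set.univ ×ˢ s) := by
      have := hq'.clm_comp (contDiffOn_const (c := ContinuousLinearMap.inr ℝ ℝ E))
      exact this
    have hder : ∀ u, ∀ y ∈ s, HasFDerivWithinAt (q u) (q' u y) s y := by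
      intro u y hy
      have h1 := (hd (u, y) ⟨trivial, hy⟩).hasFDerivWithinAt
      have h2 : HasFDerivWithinAt (fun z : E => (u, z)) (ContinuousLinearMap.inr ℝ ℝ E) s y :=
        (hasFDerivAt_prodMk_right u y).hasFDerivWithinAt
      exact h1.comp y h2 fun z hz => ⟨trivial, hz⟩
    have hmain := fun y (hy : y ∈ s) =>
      hasFDerivWithinAt_integral_param hs hd.continuousOn hq'c.continuousOn hder hy
    rw [contDiffOn_succ_iff_fderivWithin hu]
    refine ⟨fun y hy => (hmain y hy).differentiableWithinAt, by simp, ?_⟩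
    exact (ih hq'c).congr fun y hy => (hmain y hy).fderivWithin (hu y hy)

theorem contDiffOn_integral_param [CompleteSpace F] {s : Set E} (hs : Convex ℝ s)
    (hu : UniqueDiffOn ℝ s) {q : ℝ → E → F}
    (hq : ContDiffOn ℝ ∞ (Function.uncurry q) (Set.univ ×ˢ s)) :
    ContDiffOn ℝ ∞ (fun y => ∫ u in (0 : ℝ)..1, q u y) s :=
  contDiffOn_infty.2 fun k => contDiffOn_integral_param_nat hs hu k (contDiffOn_infty.1 hq k)

end ParametricIntegral

section Manifold

variable {E H : Type} [NormedAddCommGroup E] [NormedSpace ℝ E] [TopologicalSpace H]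
  {I : ModelWithCorners ℝ E H} {N : Type*} [TopologicalSpace N] [ChartedSpace H N]

/-- In a chart, a ball intersected with the range of the model with corners is a convex set, which
reduces the claim to `contDiffOn_integral_param`. -/
theorem contMDiff_integral_param [IsManifold I ∞ N] {q : ℝ × N → ℝ}
    (hq : ContMDiff (𝓘(ℝ, ℝ).prod I) 𝓘(ℝ, ℝ) ∞ q) :
    ContMDiff I 𝓘(ℝ, ℝ) ∞ fun y => ∫ u in (0 : ℝ)..1, q (u, y) := by
  intro x
  rw [contMDiffAt_iff_source]
  obtain ⟨r, hr, hsub⟩ := Metric.mem_nhdsWithin_iff.1 (extChartAt_target_mem_nhdsWithin (I := I) x)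
  set s := Metric.ball (extChartAt I x x) r ∩ Set.range I with hs
  have hcs : Convex ℝ s := (convex_ball _ _).inter I.convex_range
  have hus : UniqueDiffOn ℝ s := by
    rw [hs, Set.inter_comm]
    exact I.uniqueDiffOn.inter Metric.isOpen_ball
  have hQ : ContDiffOn ℝ ∞ (Function.uncurry fun (u : ℝ) (y : E) =>
      q (u, (extChartAt I x).symm y)) (Set.univ ×ˢ s) := by
    rw [← contMDiffOn_iff_contDiffOn]
    have h1 : ContMDiffOn 𝓘(ℝ, ℝ × E) (𝓘(ℝ, ℝ).prod I) ∞
        (fun z : ℝ × E => (z.1, (extChartAt I x).symm z.2)) (Set.univ ×ˢ s) := by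
      refine ContMDiffOn.prodMk contDiff_fst.contMDiff.contMDiffOn ?_
      exact (contMDiffOn_extChartAt_symm x).comp contDiff_snd.contMDiff.contMDiffOn
        fun z hz => hsub hz.2
    exact hq.comp_contMDiffOn h1
  have := contDiffOn_integral_param hcs hus hQ
  have h0 : extChartAt I x x ∈ s := ⟨Metric.mem_ball_self hr, by simp⟩
  have h2 := (this _ h0).contMDiffWithinAt
  refine h2.mono_of_mem_nhdsWithin ?_
  exact Filter.inter_mem (mem_nhdsWithin_of_mem_nhds (Metric.ball_mem_nhds _ hr))
      self_mem_nhdsWithin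

/-- The derivative of a smooth function along a smooth vector field is smooth. -/
theorem contMDiff_mfderiv_vectorField [IsManifold I ∞ N] {g : N → ℝ}
    (hg : ContMDiff I 𝓘(ℝ, ℝ) ∞ g) {W : (x : N) → TangentSpace I x}
    (hW : ContMDiff I I.tangent ∞ (fun x => (⟨x, W x⟩ : TangentBundle I N))) :
    ContMDiff I 𝓘(ℝ, ℝ) ∞ fun x => (mfderiv I 𝓘(ℝ, ℝ) g x (W x) : ℝ) := by
  have h1 := hg.contMDiff_tangentMap (m := ∞) (by simp)
  exact (contMDiff_snd_tangentBundle_modelSpace ℝ 𝓘(ℝ, ℝ)).comp (h1.comp hW)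

variable {P : Type} [NormedAddCommGroup P] [NormedSpace ℝ P]

theorem contMDiff_mfderiv_param [IsManifold I ∞ N] {g : P × N → ℝ}
    (hg : ContMDiff (𝓘(ℝ, P).prod I) 𝓘(ℝ, ℝ) ∞ g) {W : (x : N) → TangentSpace I x}
    (hW : ContMDiff I I.tangent ∞ (fun x => (⟨x, W x⟩ : TangentBundle I N))) :
    ContMDiff (𝓘(ℝ, P).prod I) 𝓘(ℝ, ℝ) ∞ fun y : P × N =>
      (mfderiv I 𝓘(ℝ, ℝ) (fun x => g (y.1, x)) y.2 (W y.2) : ℝ) := by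
  have : IsManifold I 1 N := IsManifold.of_le (n := ∞) (by simp)
  -- The derivative along `W` at fixed parameters is the one along the lift of `W` to `P × N`.
  let W' : (y : P × N) → TangentSpace (𝓘(ℝ, P).prod I) y := fun y => ((0 : P), W y.2)
  have hW' : ContMDiff (𝓘(ℝ, P).prod I) (𝓘(ℝ, P).prod I).tangent ∞
      (fun y => (⟨y, W' y⟩ : TangentBundle (𝓘(ℝ, P).prod I) (P × N))) := by
    have h0 : ContMDiff 𝓘(ℝ, P) 𝓘(ℝ, P).tangent ∞
        (fun y => (⟨y, 0⟩ : TangentBundle 𝓘(ℝ, P) P)) :=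
      Bundle.contMDiff_zeroSection ℝ (TangentSpace 𝓘(ℝ, P) : P → Type _)
    exact (contMDiff_equivTangentBundleProd_symm (I := 𝓘(ℝ, P)) (M := P) (I' := I)
      (M' := N)).comp ((h0.comp contMDiff_fst).prodMk (hW.comp contMDiff_snd))
  refine (contMDiff_mfderiv_vectorField hg hW').congr fun y => ?_
  have hd : MDifferentiableAt (𝓘(ℝ, P).prod I) 𝓘(ℝ, ℝ) g y := hg.mdifferentiableAt (by simp)
  rw [mfderiv_prod_eq_add_apply hd]
  exact ((congrArg (· + _) (map_zero _)).trans (zero_add _)).symm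

theorem contMDiff_fderiv_param [IsManifold I ∞ N] {g : P × N → ℝ}
    (hg : ContMDiff (𝓘(ℝ, P).prod I) 𝓘(ℝ, ℝ) ∞ g) (v : P) :
    ContMDiff (𝓘(ℝ, P).prod I) 𝓘(ℝ, ℝ) ∞
      fun y : P × N => fderiv ℝ (fun p => g (p, y.2)) y.1 v := by
  have : IsManifold I 1 N := IsManifold.of_le (n := ∞) (by simp)
  let W' : (y : P × N) → TangentSpace (𝓘(ℝ, P).prod I) y := fun y => (v, (0 : E))
  have hW' : ContMDiff (𝓘(ℝ, P).prod I) (𝓘(ℝ, P).prod I).tangent ∞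
      (fun y => (⟨y, W' y⟩ : TangentBundle (𝓘(ℝ, P).prod I) (P × N))) := by
    have h0 : ContMDiff I I.tangent ∞ (fun y => (⟨y, 0⟩ : TangentBundle I N)) :=
      Bundle.contMDiff_zeroSection ℝ (TangentSpace I : N → Type _)
    have h1 : ContMDiff 𝓘(ℝ, P) 𝓘(ℝ, P).tangent ∞
        (fun y => (⟨y, v⟩ : TangentBundle 𝓘(ℝ, P) P)) :=
      contMDiff_vectorSpace_iff_contDiff.2 contDiff_const
    exact (contMDiff_equivTangentBundleProd_symm (I := 𝓘(ℝ, P)) (M := P) (I' := I)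
      (M' := N)).comp ((h1.comp contMDiff_fst).prodMk (h0.comp contMDiff_snd))
  refine (contMDiff_mfderiv_vectorField hg hW').congr fun y => ?_
  have hd : MDifferentiableAt (𝓘(ℝ, P).prod I) 𝓘(ℝ, ℝ) g y := hg.mdifferentiableAt (by simp)
  rw [mfderiv_prod_eq_add_apply hd]
  simp only [W', mfderiv_eq_fderiv]
  exact ((congrArg (_ + ·) (map_zero _)).trans (add_zero _)).symm

theorem contDiff_slice {g : P × N → ℝ} (hg : ContMDiff (𝓘(ℝ, P).prod I) 𝓘(ℝ, ℝ) ∞ g) (x : N) :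
    ContDiff ℝ ∞ fun p => g (p, x) :=
  (hg.comp (contMDiff_id.prodMk contMDiff_const)).contDiff

/-- Hadamard's lemma with parameters in a manifold. -/
theorem exists_smooth_quotient [IsManifold I ∞ N] {g : ℝ × N → ℝ}
    (hg : ContMDiff (𝓘(ℝ, ℝ).prod I) 𝓘(ℝ, ℝ) ∞ g) :
    ∃ ρ : ℝ × N → ℝ, ContMDiff (𝓘(ℝ, ℝ).prod I) 𝓘(ℝ, ℝ) ∞ ρ ∧
      ∀ s x, g (s, x) = g (0, x) + s * ρ (s, x) := by
  have hd := contMDiff_fderiv_param hg (1 : ℝ)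
  -- The quotient is `ρ(s, x) = ∫₀¹ (∂g/∂s)(u s, x) du`.
  have hq : ContMDiff (𝓘(ℝ, ℝ).prod (𝓘(ℝ, ℝ).prod I)) 𝓘(ℝ, ℝ) ∞
      fun y : ℝ × (ℝ × N) => fderiv ℝ (fun p => g (p, y.2.2)) (y.1 * y.2.1) 1 := by
    refine hd.comp (g := fun y : ℝ × N => fderiv ℝ (fun p => g (p, y.2)) y.1 1)
      (f := fun y : ℝ × (ℝ × N) => (y.1 * y.2.1, y.2.2)) ?_
    refine ContMDiff.prodMk ?_ (contMDiff_snd.comp contMDiff_snd)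
    exact contMDiff_fst.mul (contMDiff_fst.comp contMDiff_snd)
  refine ⟨_, contMDiff_integral_param hq, fun s x => ?_⟩
  have hgx := contDiff_slice hg x
  have hder : ∀ u ∈ Set.uIcc (0 : ℝ) 1, HasDerivAt (fun u : ℝ => g (u * s, x))
      (s * fderiv ℝ (fun p => g (p, x)) (u * s) 1) u := by
    intro u _
    have h1 := ((hgx.differentiable (by simp)).differentiableAt (x := u * s)).hasDerivAt
    have h2 := h1.comp u ((hasDerivAt_id u).mul_const s)
    refine h2.congr_deriv ?_
    simp [mul_comm]
  have hc : Continuous fun u : ℝ => s * fderiv ℝ (fun p => g (p, x)) (u * s) 1 := by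
    have := (contDiff_slice hd x).continuous
    exact continuous_const.mul (this.comp (by fun_prop : Continuous fun u : ℝ => u * s))
  have := intervalIntegral.integral_eq_sub_of_hasDerivAt hder (hc.intervalIntegrable _ _)
  rw [intervalIntegral.integral_const_mul] at this
  simp only [one_mul, zero_mul] at this
  simp only []
  linarith

end Manifold

/-! ### Differential operators -/

section DiffOps

variable {n : ℕ} [NeZero n] {M : Type*} [TopologicalSpace M]
  [ChartedSpace (EuclideanHalfSpace n) M] [IsManifold (𝓡∂ n) ∞ M]

/-- A family of functions on `M` that depends smoothly on parameters in `P`. -/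
def SmoothFam (P : Type) [NormedAddCommGroup P] [NormedSpace ℝ P] (u : P → Fn n M) : Prop :=
  ContMDiff (𝓘(ℝ, P).prod (𝓡∂ n)) 𝓘(ℝ, ℝ) ∞ fun y : P × M => u y.1 y.2

variable {P Q : Type} [NormedAddCommGroup P] [NormedSpace ℝ P] [NormedAddCommGroup Q]
  [NormedSpace ℝ Q]

theorem SmoothFam.const (u : Fn n M) : SmoothFam P fun _ => u :=
  u.contMDiff.comp contMDiff_snd

theorem SmoothFam.add {u v : P → Fn n M} (hu : SmoothFam P u) (hv : SmoothFam P v) :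
    SmoothFam P fun p => u p + v p :=
  ContMDiff.add hu hv

theorem SmoothFam.mul {u v : P → Fn n M} (hu : SmoothFam P u) (hv : SmoothFam P v) :
    SmoothFam P fun p => u p * v p :=
  ContMDiff.mul hu hv

theorem SmoothFam.smul {a : P → ℝ} {u : P → Fn n M} (ha : ContDiff ℝ ∞ a) (hu : SmoothFam P u) :
    SmoothFam P fun p => a p • u p :=
  ContMDiff.mul (ha.contMDiff.comp contMDiff_fst) hu

theorem SmoothFam.comp {u : P → Fn n M} (hu : SmoothFam P u) {a : Q → P} (ha : ContDiff ℝ ∞ a) :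
    SmoothFam Q fun q => u (a q) :=
  ContMDiff.comp (g := fun y : P × M => u y.1 y.2) (f := fun y : Q × M => (a y.1, y.2)) hu
    ((ha.contMDiff.comp contMDiff_fst).prodMk contMDiff_snd)

theorem SmoothFam.contDiff {u : P → Fn n M} (hu : SmoothFam P u) (x : M) :
    ContDiff ℝ ∞ fun p => u p x :=
  contDiff_slice hu x

theorem SmoothFam.diffOp {D : Module.End ℝ (Fn n M)} (hD : D ∈ diffOps n M) {u : P → Fn n M}
    (hu : SmoothFam P u) : SmoothFam P fun p => D (u p) := by
  induction hD using Algebra.adjoin_induction generalizing u with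
  | mem D hD =>
    rcases hD with ⟨f, rfl⟩ | ⟨V, hV, hX⟩
    · exact (SmoothFam.const f).mul hu
    · refine (contMDiff_mfderiv_param hu hV).congr fun y => ?_
      exact hX _ _
  | algebraMap r => exact SmoothFam.smul (a := fun _ => r) contDiff_const hu
  | add D₁ D₂ _ _ h₁ h₂ => exact (h₁ hu).add (h₂ hu)
  | mul D₁ D₂ _ _ h₁ h₂ => exact h₁ (h₂ hu)

theorem sum_fn_apply {κ : Type*} (s : Finset κ) (u : κ → Fn n M) (x : M) :
    (∑ k ∈ s, u k) x = ∑ k ∈ s, u k x :=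
  map_sum (ContMDiffMap.evalRingHom (I := 𝓡∂ n) x) u s

theorem toFn_apply {f : M → ℝ} (hf : ContMDiff (𝓡∂ n) 𝓘(ℝ, ℝ) ∞ f) (x : M) :
    (toFn f : Fn n M) x = f x := by
  have h : (toFn f : Fn n M) = ⟨f, hf⟩ := dif_pos hf
  rw [h]; rfl

theorem SmoothFam.contMDiff_deriv {u : ℝ → Fn n M} (hu : SmoothFam ℝ u) :
    ContMDiff (𝓡∂ n) 𝓘(ℝ, ℝ) ∞ fun x => deriv (fun s => u s x) 0 := by
  have := contMDiff_fderiv_param hu (1 : ℝ)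
  exact this.comp (contMDiff_const (c := (0 : ℝ)).prodMk contMDiff_id)

end DiffOps

/-! ### Derivatives of smooth families of functions -/

section Ddt

variable {n : ℕ} [NeZero n] {M : Type*} [TopologicalSpace M]
  [ChartedSpace (EuclideanHalfSpace n) M] [IsManifold (𝓡∂ n) ∞ M]
  {P Q : Type} [NormedAddCommGroup P] [NormedSpace ℝ P] [NormedAddCommGroup Q]
  [NormedSpace ℝ Q]

/-- The derivative at `0` of a curve of functions, pointwise on `M`. -/
def ddt (u : ℝ → Fn n M) : Fn n M :=
  toFn fun x => deriv (fun s => u s x) 0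

theorem SmoothFam.hasDerivAt {u : ℝ → Fn n M} (hu : SmoothFam ℝ u) (x : M) :
    HasDerivAt (fun s => u s x) (ddt u x) 0 := by
  rw [ddt, toFn_apply hu.contMDiff_deriv]
  exact ((hu.contDiff x).differentiable (by simp)).differentiableAt.hasDerivAt

theorem ddt_eq_of_hasDerivAt {u : ℝ → Fn n M} (hu : SmoothFam ℝ u) {v : Fn n M}
    (h : ∀ x, HasDerivAt (fun s => u s x) (v x) 0) : ddt u = v := by
  ext x
  exact (hu.hasDerivAt x).unique (h x)

theorem SmoothFam.comp_contMDiff {u : P → Fn n M} (hu : SmoothFam P u) {E H : Type}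
    [NormedAddCommGroup E] [NormedSpace ℝ E] [TopologicalSpace H] {I : ModelWithCorners ℝ E H}
    {N : Type*} [TopologicalSpace N] [ChartedSpace H N] {a : N → P} {b : N → M}
    (ha : ContMDiff I 𝓘(ℝ, P) ∞ a) (hb : ContMDiff I (𝓡∂ n) ∞ b) :
    ContMDiff I 𝓘(ℝ, ℝ) ∞ fun y => u (a y) (b y) :=
  ContMDiff.comp (g := fun y : P × M => u y.1 y.2) (f := fun y => (a y, b y)) hu (ha.prodMk hb)

/-- Hadamard's lemma for families of functions on `M`. -/
theorem SmoothFam.exists_quotient {u : ℝ × P → Fn n M} (hu : SmoothFam (ℝ × P) u) :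
    ∃ ρ : ℝ × P → Fn n M, SmoothFam (ℝ × P) ρ ∧ ∀ s p, u (s, p) = u (0, p) + s • ρ (s, p) := by
  have h1 : ContMDiff (𝓘(ℝ, ℝ).prod (𝓘(ℝ, P).prod (𝓡∂ n))) 𝓘(ℝ, ℝ) ∞
      fun y : ℝ × (P × M) => u (y.1, y.2.1) y.2.2 := by
    refine hu.comp_contMDiff (a := fun y : ℝ × (P × M) => (y.1, y.2.1)) ?_
      (contMDiff_snd.comp contMDiff_snd)
    exact contMDiff_fst.prodMk_space (contMDiff_fst.comp contMDiff_snd)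
  obtain ⟨ρ, hρ, h⟩ := exists_smooth_quotient h1
  have h2 : ContMDiff (𝓘(ℝ, ℝ × P).prod (𝓡∂ n)) 𝓘(ℝ, ℝ) ∞
      fun y : (ℝ × P) × M => ρ (y.1.1, (y.1.2, y.2)) := by
    refine hρ.comp ((contDiff_fst.contMDiff.comp contMDiff_fst).prodMk
      ((contDiff_snd.contMDiff.comp contMDiff_fst).prodMk contMDiff_snd))
  refine ⟨fun y => ⟨fun x => ρ (y.1, (y.2, x)), ?_⟩, h2, fun s p => ?_⟩
  · exact h2.comp ((contMDiff_const (c := y)).prodMk contMDiff_id)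
  · ext x
    exact h s (p, x)

theorem SmoothFam.exists_quotient_curve {u : ℝ → Fn n M} (hu : SmoothFam ℝ u) :
    ∃ ρ : ℝ → Fn n M, SmoothFam ℝ ρ ∧ (∀ s, u s = u 0 + s • ρ s) ∧ ρ 0 = ddt u := by
  obtain ⟨ρ, hρ, h⟩ := (hu.comp (Q := ℝ × ℝ) contDiff_fst).exists_quotient
  have hρ' : SmoothFam ℝ fun s => ρ (s, 0) := hρ.comp (by fun_prop)
  refine ⟨fun s => ρ (s, 0), hρ', fun s => h s 0, ?_⟩
  refine (ddt_eq_of_hasDerivAt hu fun x => ?_).symm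
  have h1 : HasDerivAt (fun s => u 0 x + s * ρ (s, 0) x) (1 * ρ (0, 0) x + 0 * _) 0 :=
    ((hasDerivAt_id (0 : ℝ)).mul
      ((hρ'.contDiff x).differentiable (by simp)).differentiableAt.hasDerivAt).const_add _
  refine (h1.congr_deriv (by simp)).congr_of_eventuallyEq (Filter.Eventually.of_forall fun s => ?_)
  exact congrArg (fun f : Fn n M => f x) (h s 0)

/-- The derivative with respect to one parameter depends smoothly on the others: it is the value
at `0` of the Hadamard quotient. -/
theorem SmoothFam.ddt_param {u : ℝ × P → Fn n M} (hu : SmoothFam (ℝ × P) u) :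
    SmoothFam P fun p => ddt fun s => u (s, p) := by
  obtain ⟨ρ, hρ, h⟩ := hu.exists_quotient
  have : (fun p => ddt fun s => u (s, p)) = fun p => ρ (0, p) := by
    funext p
    have hup : SmoothFam ℝ fun s => u (s, p) := hu.comp (by fun_prop)
    have hρp : SmoothFam ℝ fun s => ρ (s, p) := hρ.comp (by fun_prop)
    refine ddt_eq_of_hasDerivAt hup fun x => ?_
    have h1 : HasDerivAt (fun s => u (0, p) x + s * ρ (s, p) x) (1 * ρ (0, p) x + 0 * _) 0 :=
      ((hasDerivAt_id (0 : ℝ)).mul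
        ((hρp.contDiff x).differentiable (by simp)).differentiableAt.hasDerivAt).const_add _
    refine (h1.congr_deriv (by simp)).congr_of_eventuallyEq
      (Filter.Eventually.of_forall fun s => ?_)
    exact congrArg (fun f : Fn n M => f x) (h s p)
  rw [this]
  exact hρ.comp (by fun_prop)

theorem ddt_const (u : Fn n M) : ddt (fun _ => u) = 0 :=
  ddt_eq_of_hasDerivAt (SmoothFam.const u) fun _ => hasDerivAt_const _ _

theorem ddt_add {u v : ℝ → Fn n M} (hu : SmoothFam ℝ u) (hv : SmoothFam ℝ v) :
    ddt (fun s => u s + v s) = ddt u + ddt v :=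
  ddt_eq_of_hasDerivAt (hu.add hv) fun x => (hu.hasDerivAt x).add (hv.hasDerivAt x)

theorem SmoothFam.const_smul {u : P → Fn n M} (a : ℝ) (hu : SmoothFam P u) :
    SmoothFam P fun p => a • u p :=
  SmoothFam.smul (a := fun _ => a) contDiff_const hu

theorem ddt_const_smul {u : ℝ → Fn n M} (a : ℝ) (hu : SmoothFam ℝ u) :
    ddt (fun s => a • u s) = a • ddt u :=
  ddt_eq_of_hasDerivAt (hu.const_smul a) fun x => (hu.hasDerivAt x).const_mul a

theorem SmoothFam.neg {u : P → Fn n M} (hu : SmoothFam P u) : SmoothFam P fun p => -u p := by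
  simpa using hu.const_smul (-1)

theorem SmoothFam.sub {u v : P → Fn n M} (hu : SmoothFam P u) (hv : SmoothFam P v) :
    SmoothFam P fun p => u p - v p := by
  simpa [sub_eq_add_neg] using hu.add hv.neg

theorem ddt_neg {u : ℝ → Fn n M} (hu : SmoothFam ℝ u) : ddt (fun s => -u s) = -ddt u := by
  simpa using ddt_const_smul (-1) hu

theorem ddt_sub {u v : ℝ → Fn n M} (hu : SmoothFam ℝ u) (hv : SmoothFam ℝ v) :
    ddt (fun s => u s - v s) = ddt u - ddt v := by
  simpa [sub_eq_add_neg, ddt_neg hv] using ddt_add hu hv.neg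

theorem ddt_mul {u v : ℝ → Fn n M} (hu : SmoothFam ℝ u) (hv : SmoothFam ℝ v) :
    ddt (fun s => u s * v s) = ddt u * v 0 + u 0 * ddt v :=
  ddt_eq_of_hasDerivAt (hu.mul hv) fun x => (hu.hasDerivAt x).mul (hv.hasDerivAt x)

theorem SmoothFam.sum {κ : Type*} {u : κ → P → Fn n M} (s : Finset κ)
    (hu : ∀ k, SmoothFam P (u k)) : SmoothFam P fun p => ∑ k ∈ s, u k p := by
  classical
  induction s using Finset.induction_on with
  | empty => simpa using SmoothFam.const (0 : Fn n M)
  | insert a s ha ih => simpa [Finset.sum_insert ha] using (hu a).add ih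

theorem ddt_sum {κ : Type*} {u : κ → ℝ → Fn n M} (s : Finset κ)
    (hu : ∀ k, SmoothFam ℝ (u k)) : ddt (fun r => ∑ k ∈ s, u k r) = ∑ k ∈ s, ddt (u k) := by
  classical
  induction s using Finset.induction_on with
  | empty => simpa using ddt_const (0 : Fn n M)
  | insert a s ha ih =>
    simp only [Finset.sum_insert ha]
    rw [ddt_add (hu a) (SmoothFam.sum s hu), ih]

/-- Differential operators commute with the derivative with respect to a parameter. -/
theorem ddt_diffOp {D : Module.End ℝ (Fn n M)} (hD : D ∈ diffOps n M) {u : ℝ → Fn n M}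
    (hu : SmoothFam ℝ u) : ddt (fun s => D (u s)) = D (ddt u) := by
  obtain ⟨ρ, hρ, h, h0⟩ := hu.exists_quotient_curve
  rw [← h0]
  refine ddt_eq_of_hasDerivAt (hu.diffOp hD) fun x => ?_
  have hDρ := hρ.diffOp hD
  have h1 : HasDerivAt (fun s => D (u 0) x + s * D (ρ s) x) (1 * D (ρ 0) x + 0 * _) 0 :=
    ((hasDerivAt_id (0 : ℝ)).mul
      ((hDρ.contDiff x).differentiable (by simp)).differentiableAt.hasDerivAt).const_add _
  refine (h1.congr_deriv (by simp)).congr_of_eventuallyEq (Filter.Eventually.of_forall fun s => ?_)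
  have : D (u s) = D (u 0) + s • D (ρ s) := by rw [h s, map_add, map_smul]
  exact congrArg (fun f : Fn n M => f x) this

/-- The derivative of a family along the diagonal of two parameters. -/
theorem ddt_diag {u : ℝ × ℝ → Fn n M} (hu : SmoothFam (ℝ × ℝ) u) :
    ddt (fun s => u (s, s)) = ddt (fun s => u (s, 0)) + ddt (fun s => u (0, s)) := by
  have h1 : SmoothFam ℝ fun s => u (s, 0) := hu.comp (by fun_prop)
  have h2 : SmoothFam ℝ fun s => u (0, s) := hu.comp (by fun_prop)
  refine ddt_eq_of_hasDerivAt (hu.comp (by fun_prop)) fun x => ?_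
  have hd := ((hu.contDiff x).differentiable (by simp) (0, 0)).hasFDerivAt
  have hx : HasDerivAt (fun s : ℝ => (s, (0 : ℝ))) (1, 0) 0 :=
    (hasDerivAt_id _).prodMk (hasDerivAt_const _ _)
  have hy : HasDerivAt (fun s : ℝ => ((0 : ℝ), s)) (0, 1) 0 :=
    (hasDerivAt_const _ _).prodMk (hasDerivAt_id _)
  have hxy : HasDerivAt (fun s : ℝ => (s, s)) (1, 1) 0 := (hasDerivAt_id _).prodMk (hasDerivAt_id _)
  have e1 := (h1.hasDerivAt x).unique
    (HasFDerivAt.comp_hasDerivAt (f := fun s : ℝ => (s, (0 : ℝ))) (0 : ℝ) hd hx)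
  have e2 := (h2.hasDerivAt x).unique
    (HasFDerivAt.comp_hasDerivAt (f := fun s : ℝ => ((0 : ℝ), s)) (0 : ℝ) hd hy)
  refine (HasFDerivAt.comp_hasDerivAt (f := fun s : ℝ => (s, s)) (0 : ℝ) hd hxy).congr_deriv ?_
  change _ = ddt _ x + ddt _ x
  rw [e1, e2, ← map_add]
  simp

theorem ddt_comp_mul {u : ℝ → Fn n M} (hu : SmoothFam ℝ u) (a : ℝ) :
    ddt (fun s => u (s * a)) = a • ddt u := by
  refine ddt_eq_of_hasDerivAt (hu.comp (by fun_prop)) fun x => ?_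
  have h := hu.hasDerivAt x
  have h0 : HasDerivAt (fun s : ℝ => s * a) (1 * a) 0 := (hasDerivAt_id _).mul_const a
  rw [show (0 : ℝ) = 0 * a by simp] at h
  refine (HasDerivAt.comp (0 : ℝ) h h0).congr_deriv ?_
  simp [mul_comm]

/-- Derivatives with respect to two parameters commute. -/
theorem ddt_comm {u : ℝ × ℝ → Fn n M} (hu : SmoothFam (ℝ × ℝ) u) :
    ddt (fun a => ddt fun b => u (a, b)) = ddt (fun b => ddt fun a => u (a, b)) := by
  have hu' : SmoothFam (ℝ × ℝ) fun p : ℝ × ℝ => u (p.2, p.1) := hu.comp (by fun_prop)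
  have h1 : SmoothFam ℝ fun a => ddt fun b => u (a, b) := hu'.ddt_param
  have h2 : SmoothFam ℝ fun b => ddt fun a => u (a, b) := hu.ddt_param
  ext x
  have hc := hu.contDiff x
  have hd := hc.differentiable (by simp)
  have hf : ContDiff ℝ ∞ (fderiv ℝ fun p => u p x) := hc.fderiv_right (by simp)
  have hdf := (hf.differentiable (by simp) (0, 0)).hasFDerivAt
  have hx : ∀ a b : ℝ, HasDerivAt (fun s : ℝ => (s, b)) (1, 0) a := fun a b =>
    (hasDerivAt_id _).prodMk (hasDerivAt_const _ _)
  have hy : ∀ a b : ℝ, HasDerivAt (fun s : ℝ => (a, s)) (0, 1) b := fun a b =>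
    (hasDerivAt_const _ _).prodMk (hasDerivAt_id _)
  have e1 : ∀ a : ℝ, ddt (fun b => u (a, b)) x = fderiv ℝ (fun p => u p x) (a, 0) (0, 1) :=
    fun a => ((hu.comp (a := fun b => (a, b)) (by fun_prop)).hasDerivAt x).unique
      ((hd (a, 0)).hasFDerivAt.comp_hasDerivAt (f := fun s : ℝ => (a, s)) (0 : ℝ) (hy a 0))
  have e2 : ∀ b : ℝ, ddt (fun a => u (a, b)) x = fderiv ℝ (fun p => u p x) (0, b) (1, 0) :=
    fun b => ((hu.comp (a := fun a => (a, b)) (by fun_prop)).hasDerivAt x).unique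
      ((hd (0, b)).hasFDerivAt.comp_hasDerivAt (f := fun s : ℝ => (s, b)) (0 : ℝ) (hx 0 b))
  have k1 := h1.hasDerivAt x
  have k2 := h2.hasDerivAt x
  simp only [e1] at k1
  simp only [e2] at k2
  have m1 := k1.unique ((hdf.comp_hasDerivAt (f := fun s : ℝ => (s, (0 : ℝ))) (0 : ℝ)
    (hx 0 0)).clm_apply (hasDerivAt_const _ _))
  have m2 := k2.unique ((hdf.comp_hasDerivAt (f := fun s : ℝ => ((0 : ℝ), s)) (0 : ℝ)
    (hy 0 0)).clm_apply (hasDerivAt_const _ _))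
  have hs : IsSymmSndFDerivAt ℝ (fun p => u p x) ((0 : ℝ), (0 : ℝ)) :=
    (hc.of_le (WithTop.coe_le_coe.2 (le_top : (2 : ℕ∞) ≤ ⊤))).contDiffAt
      |>.isSymmSndFDerivAt (n := 2) (by simp)
  have := hs (1, 0) (0, 1)
  rw [map_zero, add_zero] at m1 m2
  rw [m1, m2]
  exact this

variable [CompactSpace M] [MeasurableSpace M] [BorelSpace M]

theorem Fn.integrable (μ : Measure M) [IsFiniteMeasure μ] (u : Fn n M) :
    Integrable (fun x => u x) μ :=
  u.contMDiff.continuous.integrable_of_hasCompactSupport (HasCompactSupport.of_compactSpace _)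

theorem SmoothFam.hasDerivAt_integral (μ : Measure M) [IsFiniteMeasure μ] {u : ℝ → Fn n M}
    (hu : SmoothFam ℝ u) : HasDerivAt (fun s => ∫ x, u s x ∂μ) (∫ x, ddt u x ∂μ) 0 := by
  have hc : Continuous fun y : ℝ × M => fderiv ℝ (fun p => u p y.2) y.1 1 :=
    (contMDiff_fderiv_param hu (1 : ℝ)).continuous
  have hK : IsCompact (Metric.closedBall (0 : ℝ) 1 ×ˢ (Set.univ : Set M)) :=
    (isCompact_closedBall _ _).prod isCompact_univ
  obtain ⟨C, hC⟩ := hK.exists_bound_of_continuousOn hc.continuousOn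
  have hd : ∀ x s, HasDerivAt (fun p => u p x) (fderiv ℝ (fun p => u p x) s 1) s := fun x s =>
    ((hu.contDiff x).differentiable (by simp) s).hasDerivAt
  have := (hasDerivAt_integral_of_dominated_loc_of_deriv_le (μ := μ) (F := fun s x => u s x)
    (F' := fun s x => fderiv ℝ (fun p => u p x) s 1) (x₀ := (0 : ℝ)) (bound := fun _ => C)
    (s := Metric.ball 0 1) (Metric.ball_mem_nhds _ one_pos)
    (Filter.Eventually.of_forall fun s => (Fn.integrable μ (u s)).aestronglyMeasurable)
    (Fn.integrable μ (u 0)) (by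
      have : Continuous fun x : M => fderiv ℝ (fun p => u p x) 0 1 :=
        hc.comp (by fun_prop : Continuous fun x : M => ((0 : ℝ), x))
      exact (this.integrable_of_hasCompactSupport
        (HasCompactSupport.of_compactSpace _)).aestronglyMeasurable)
    (Filter.Eventually.of_forall fun x s hs => hC (s, x)
      ⟨Metric.ball_subset_closedBall hs, trivial⟩)
    (integrable_const C) (Filter.Eventually.of_forall fun x s _ => hd x s)).2
  refine this.congr_deriv (integral_congr_ae (Filter.Eventually.of_forall fun x => ?_))
  exact (hd x 0).unique (hu.hasDerivAt x)

end Ddt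

/-! ### Functions that are flat on the boundary -/

section Flat

open Topology

variable {n : ℕ} [NeZero n] {M : Type*} [TopologicalSpace M]
  [ChartedSpace (EuclideanHalfSpace n) M] [IsManifold (𝓡∂ n) ∞ M]

theorem mulLeft_mem_diffOps (g : Fn n M) : LinearMap.mulLeft ℝ g ∈ diffOps n M :=
  Algebra.subset_adjoin (Or.inl ⟨g, rfl⟩)

variable {K : Set M} {f g : Fn n M}

theorem FlatOn.apply (hf : FlatOn K f) {x : M} (hx : x ∈ K) : f x = 0 :=
  hf 1 (one_mem _) x hx

theorem FlatOn.diffOp (hf : FlatOn K f) {D : Module.End ℝ (Fn n M)} (hD : D ∈ diffOps n M) :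
    FlatOn K (D f) :=
  fun D' hD' => hf (D' * D) (mul_mem hD' hD)

theorem FlatOn.mul_left (g : Fn n M) (hf : FlatOn K f) : FlatOn K (g * f) :=
  hf.diffOp (mulLeft_mem_diffOps g)

theorem FlatOn.zero : FlatOn K (0 : Fn n M) := fun D _ x _ => by rw [map_zero]; rfl

theorem FlatOn.add (hf : FlatOn K f) (hg : FlatOn K g) : FlatOn K (f + g) := fun D hD x hx => by
  rw [map_add]
  exact (congrArg₂ (· + ·) (hf D hD x hx) (hg D hD x hx)).trans (add_zero 0)

theorem FlatOn.smul (a : ℝ) (hf : FlatOn K f) : FlatOn K (a • f) := fun D hD x hx => by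
  rw [map_smul]
  exact (congrArg (a * ·) (hf D hD x hx)).trans (mul_zero a)

theorem FlatOn.neg (hf : FlatOn K f) : FlatOn K (-f) := by
  simpa using hf.smul (-1)

theorem FlatOn.sub (hf : FlatOn K f) (hg : FlatOn K g) : FlatOn K (f - g) := by
  simpa [sub_eq_add_neg] using hf.add hg.neg

theorem FlatOn.sum {κ : Type*} {f : κ → Fn n M} (s : Finset κ) (hf : ∀ k ∈ s, FlatOn K (f k)) :
    FlatOn K (∑ k ∈ s, f k) :=
  Finset.sum_induction f (FlatOn K) (fun _ _ => FlatOn.add) FlatOn.zero hf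

theorem FlatOn.mono {K' : Set M} (hf : FlatOn K f) (h : K' ⊆ K) : FlatOn K' f :=
  fun D hD x hx => hf D hD x (h hx)

theorem flatOn_univ : FlatOn Set.univ f ↔ f = 0 :=
  ⟨fun h => by ext x; exact h.apply trivial, fun h => h ▸ FlatOn.zero⟩

/-- Differential operators are local. -/
theorem diffOp_eventuallyEq_zero {D : Module.End ℝ (Fn n M)} (hD : D ∈ diffOps n M) {u : Fn n M}
    {x : M} (hu : ∀ᶠ y in 𝓝 x, u y = 0) : ∀ᶠ y in 𝓝 x, D u y = 0 := by
  induction hD using Algebra.adjoin_induction generalizing u with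
  | mem D hD =>
    rcases hD with ⟨f, rfl⟩ | ⟨V, -, hX⟩
    · filter_upwards [hu] with y hy
      exact (congrArg (f y * ·) hy).trans (mul_zero _)
    · filter_upwards [hu.eventually_nhds] with y hy
      have hy' : (fun z => u z) =ᶠ[𝓝 y] fun _ => (0 : ℝ) := hy
      rw [hX, hy'.mfderiv_eq, mfderiv_const]
      rfl
  | algebraMap r =>
    filter_upwards [hu] with y hy
    exact (congrArg (r * ·) hy).trans (mul_zero _)
  | add D₁ D₂ _ _ h₁ h₂ =>
    filter_upwards [h₁ hu, h₂ hu] with y e₁ e₂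
    exact (congrArg₂ (· + ·) e₁ e₂).trans (add_zero 0)
  | mul D₁ D₂ _ _ h₁ h₂ => exact h₁ (h₂ hu)

theorem flatOn_boundary_of_tsupport {u : Fn n M} (hu : tsupport u ⊆ (𝓡∂ n).interior M) :
    FlatOn ((𝓡∂ n).boundary M) u := by
  intro D hD x hx
  have hxu : x ∉ tsupport u := fun h => by
    rw [← ModelWithCorners.compl_interior] at hx
    exact hx (hu h)
  exact (diffOp_eventuallyEq_zero hD (notMem_tsupport_iff_eventuallyEq.1 hxu)).self_of_nhds

theorem dense_interior : Dense ((𝓡∂ n).interior M) := by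
  intro x
  rw [mem_closure_iff_nhds]
  intro U hU
  have h1 : (extChartAt (𝓡∂ n) x).symm ⁻¹' U ∩ (extChartAt (𝓡∂ n) x).target ∈
      𝓝[Set.range (𝓡∂ n)] (extChartAt (𝓡∂ n) x x) := by
    refine Filter.inter_mem ?_ (extChartAt_target_mem_nhdsWithin x)
    have hc : ContinuousAt (extChartAt (𝓡∂ n) x).symm (extChartAt (𝓡∂ n) x x) :=
      continuousAt_extChartAt_symm x
    refine mem_nhdsWithin_of_mem_nhds (hc ?_)
    rwa [extChartAt_to_inv]
  obtain ⟨O, hO, hxO, hsub⟩ := mem_nhdsWithin.1 h1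
  have hcl : extChartAt (𝓡∂ n) x x ∈ closure (interior (Set.range (𝓡∂ n))) :=
    (𝓡∂ n).range_subset_closure_interior (by simp)
  obtain ⟨z, hzO, hzi⟩ := mem_closure_iff.1 hcl O hO hxO
  have hz := hsub ⟨hzO, interior_subset hzi⟩
  refine ⟨(extChartAt (𝓡∂ n) x).symm z, hz.1, ?_⟩
  have hsrc := (extChartAt (𝓡∂ n) x).map_target hz.2
  rw [extChartAt_source] at hsrc
  refine ((𝓡∂ n).isInteriorPoint_iff_of_mem_atlas (n := ∞) (by simp)
    (chart_mem_atlas _ x) hsrc).2 ?_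
  have : (chartAt (EuclideanHalfSpace n) x).extend (𝓡∂ n) ((extChartAt (𝓡∂ n) x).symm z) = z :=
    (extChartAt (𝓡∂ n) x).right_inv hz.2
  rw [this]
  exact mem_interior.2 ⟨O ∩ interior (Set.range (𝓡∂ n)),
    fun y hy => (hsub ⟨hy.1, interior_subset hy.2⟩).2, hO.inter isOpen_interior, hzO, hzi⟩

variable [CompactSpace M] [MeasurableSpace M] [BorelSpace M]

/-- Integration of smooth functions, as a linear form. -/
def integ (μ : Measure M) [IsFiniteMeasure μ] : Fn n M →ₗ[ℝ] ℝ where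
  toFun u := ∫ x, u x ∂μ
  map_add' u v := integral_add (Fn.integrable μ u) (Fn.integrable μ v)
  map_smul' a _ := integral_const_mul a _

/-- The fundamental lemma of the calculus of variations. -/
theorem eq_zero_of_integral_eq_zero [T2Space M] {μ : Measure M} [IsFiniteMeasure μ]
    (hμ : IsVolume (n := n) μ) {e : Fn n M}
    (h : ∀ u : Fn n M, tsupport u ⊆ (𝓡∂ n).interior M → integ μ (e * u) = 0) :
    e = 0 := by
  have := hμ.openPos
  have hint : ∀ x ∈ (𝓡∂ n).interior M, e x = 0 := by
    intro x hx
    by_contra hne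
    have ho : (𝓡∂ n).interior M ∈ 𝓝 x :=
      ((𝓡∂ n).isOpen_interior (n := ∞) (by simp)).mem_nhds hx
    obtain ⟨ψ, -, hψ⟩ := (SmoothBumpFunction.nhds_basis_tsupport (I := 𝓡∂ n) x).mem_iff.1 ho
    -- The test function is `ψ e` with a bump function `ψ` at `x`.
    let ψ' : Fn n M := ⟨ψ, ψ.contMDiff⟩
    have hsupp : tsupport (ψ' * e : Fn n M) ⊆ (𝓡∂ n).interior M :=
      (tsupport_mul_subset_left (f := ψ) (g := e)).trans hψ
    have h0 := h _ hsupp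
    have hcont : Continuous fun y => e y * (ψ' * e : Fn n M) y :=
      e.contMDiff.continuous.mul (ψ' * e : Fn n M).contMDiff.continuous
    have hval : ∀ y, e y * (ψ' * e : Fn n M) y = ψ y * (e y * e y) := fun y => by
      change e y * (ψ y * e y) = _
      ring
    refine (hcont.integral_pos_of_hasCompactSupport_nonneg_nonzero (μ := μ) (x := x)
      (HasCompactSupport.of_compactSpace _) (fun y => ?_) ?_).ne' h0
    · rw [hval]
      exact mul_nonneg ψ.nonneg (mul_self_nonneg _)
    · simp only [hval, ψ.eq_one]
      simpa using hne
  have hc : Continuous (fun x => e x) := e.contMDiff.continuous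
  have := Continuous.ext_on dense_interior hc continuous_const (g := fun _ => (0 : ℝ)) hint
  ext x
  exact congrFun this x

/-- Integration by parts: a linear differential operator has a formal adjoint, and there is no
boundary term when one of the two functions is flat on the boundary. -/
theorem exists_adjoint {μ : Measure M} [IsFiniteMeasure μ] (hμ : IsVolume (n := n) μ)
    {D : Module.End ℝ (Fn n M)} (hD : D ∈ diffOps n M) : ∃ D' ∈ diffOps n M, ∀ e u : Fn n M,
      (FlatOn ((𝓡∂ n).boundary M) e ∨ FlatOn ((𝓡∂ n).boundary M) u) →
      integ μ (e * D u) = integ μ (D' e * u) := by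
  induction hD using Algebra.adjoin_induction with
  | mem D hD =>
    rcases hD with ⟨f, rfl⟩ | hX
    · refine ⟨_, mulLeft_mem_diffOps f, fun e u _ => ?_⟩
      congr 1
      change e * (f * u) = f * e * u
      ring
    · have hDX : D ∈ diffOps n M := Algebra.subset_adjoin (Or.inr hX)
      -- The adjoint of the derivative along a vector field with divergence `d` is `-(D + d)`.
      obtain ⟨d, hd⟩ := hμ.divergence D hX
      refine ⟨-(D + LinearMap.mulLeft ℝ d),
        neg_mem (add_mem hDX (mulLeft_mem_diffOps d)), fun e u heu => ?_⟩
      obtain ⟨V, -, hV⟩ := hX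
      have hleib : ∀ x, D (e * u) x = e x * D u x + u x * D e x := by
        intro x
        rw [hV, hV, hV]
        have h1 := (e.contMDiff.mdifferentiableAt (by simp) (x := x)).hasMFDerivAt
        have h2 := (u.contMDiff.mdifferentiableAt (by simp) (x := x)).hasMFDerivAt
        have h3 := (h1.mul h2).mfderiv
        exact congrArg (fun L : TangentSpace (𝓡∂ n) x →L[ℝ] ℝ => L (V x)) h3
      have h0 := hd (e * u) fun x hx => by
        rcases heu with he | hu
        · exact (congrArg (· * u x) (he.apply hx)).trans (zero_mul _)
        · exact (congrArg (e x * ·) (hu.apply hx)).trans (mul_zero _)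
      rw [← sub_eq_zero, ← h0]
      rw [← map_sub]
      change ∫ x, (e x * D u x - -(D e x + d x * e x) * u x) ∂μ = _
      congr 1; ext x
      rw [hleib]
      change _ = _ + d x * (e x * u x)
      ring
  | algebraMap r =>
    refine ⟨algebraMap ℝ _ r, algebraMap_mem _ r, fun e u _ => ?_⟩
    congr 1
    change e * (r • u) = r • e * u
    simp
  | add D₁ D₂ _ _ h₁ h₂ =>
    obtain ⟨D₁', m₁, h₁⟩ := h₁
    obtain ⟨D₂', m₂, h₂⟩ := h₂
    refine ⟨D₁' + D₂', add_mem m₁ m₂, fun e u heu => ?_⟩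
    rw [LinearMap.add_apply, LinearMap.add_apply, mul_add, add_mul, map_add, map_add,
      h₁ e u heu, h₂ e u heu]
  | mul D₁ D₂ hm₁ hm₂ h₁ h₂ =>
    obtain ⟨D₁', m₁, h₁⟩ := h₁
    obtain ⟨D₂', m₂, h₂⟩ := h₂
    refine ⟨D₂' * D₁', mul_mem m₂ m₁, fun e u heu => ?_⟩
    exact (h₁ e (D₂ u) (heu.imp id fun hu => hu.diffOp hm₂)).trans
      (h₂ (D₁' e) u (heu.imp (fun he => he.diffOp m₁) id))

end Flat

/-! ### Calculus on the space of configurations -/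

section Calculus

variable {n : ℕ} [NeZero n] {M : Type*} [TopologicalSpace M]
  [ChartedSpace (EuclideanHalfSpace n) M] [IsManifold (𝓡∂ n) ∞ M] {N m : ℕ}
  {P Q : Type} [NormedAddCommGroup P] [NormedSpace ℝ P] [NormedAddCommGroup Q]
  [NormedSpace ℝ Q]

@[simp] theorem comp_add (c d : Config n M N m) (i) : comp (c + d) i = comp c i + comp d i := by
  rcases i with A | ⟨l, a⟩ <;> rfl

@[simp] theorem comp_sub (c d : Config n M N m) (i) : comp (c - d) i = comp c i - comp d i := by
  rcases i with A | ⟨l, a⟩ <;> rfl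

@[simp] theorem comp_smul (a : ℝ) (c : Config n M N m) (i) : comp (a • c) i = a • comp c i := by
  rcases i with A | ⟨l, a⟩ <;> rfl

@[simp] theorem comp_zero (i) : comp (0 : Config n M N m) i = 0 := by
  rcases i with A | ⟨l, a⟩ <;> rfl

theorem config_ext {c d : Config n M N m} (h : ∀ i, comp c i = comp d i) : c = d :=
  Prod.ext (funext fun A => h (Sum.inl A)) (funext fun l => funext fun a => h (Sum.inr (l, a)))

/-- The configuration with prescribed components. -/
def ofComp (g : Fin N ⊕ (ℕ × Fin m) → Fn n M) : Config n M N m :=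
  (fun A => g (Sum.inl A), fun l a => g (Sum.inr (l, a)))

@[simp] theorem comp_ofComp (g : Fin N ⊕ (ℕ × Fin m) → Fn n M) (i) : comp (ofComp g) i = g i := by
  rcases i with A | ⟨l, a⟩ <;> rfl

/-- The variation of the single component `i` by `u`. -/
def dir (i : Fin N ⊕ (ℕ × Fin m)) (u : Fn n M) : Config n M N m :=
  ofComp (Pi.single i u)

@[simp] theorem comp_dir_self (i : Fin N ⊕ (ℕ × Fin m)) (u : Fn n M) : comp (dir i u) i = u := by
  simp [dir]

theorem comp_dir_ne {i j : Fin N ⊕ (ℕ × Fin m)} (h : j ≠ i) (u : Fn n M) :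
    comp (dir i u) j = 0 := by
  simp [dir, h]

theorem comp_dir (i j : Fin N ⊕ (ℕ × Fin m)) (u : Fn n M) :
    comp (dir i u) j = if j = i then u else 0 := by
  split_ifs with h
  · subst h; simp
  · exact comp_dir_ne h u

theorem zDir_eq_dir (A : Fin N) : (zDir A : Fn n M → Config n M N m) = dir (Sum.inl A) := by
  funext u
  refine config_ext fun j => ?_
  rw [comp_dir]
  rcases j with B | ⟨l, b⟩
  · by_cases h : B = A
    · subst h; simp [comp, zDir]
    · simp [comp, zDir, h]
  · simp [comp, zDir]

theorem lDir_eq_dir (l : ℕ) (a : Fin m) :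
    (lDir l a : Fn n M → Config n M N m) = dir (Sum.inr (l, a)) := by
  funext u
  refine config_ext fun j => ?_
  rw [comp_dir]
  rcases j with B | ⟨k, b⟩
  · simp [comp, lDir]
  · by_cases h : k = l
    · subst h
      by_cases h' : b = a
      · subst h'; simp [comp, lDir]
      · simp [comp, lDir, h']
    · simp [comp, lDir, h]

/-- A family of configurations that depends smoothly on parameters in `P`. -/
def SmoothCfg (P : Type) [NormedAddCommGroup P] [NormedSpace ℝ P] (c : P → Config n M N m) : Prop :=
  ∀ i, SmoothFam P fun p => comp (c p) i

theorem SmoothCfg.const (c : Config n M N m) : SmoothCfg P fun _ => c :=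
  fun _ => SmoothFam.const _

theorem SmoothCfg.add {c d : P → Config n M N m} (hc : SmoothCfg P c) (hd : SmoothCfg P d) :
    SmoothCfg P fun p => c p + d p := fun i => by
  simpa using (hc i).add (hd i)

theorem SmoothCfg.smul {a : P → ℝ} {c : P → Config n M N m} (ha : ContDiff ℝ ∞ a)
    (hc : SmoothCfg P c) : SmoothCfg P fun p => a p • c p := fun i => by
  simpa using (hc i).smul ha

theorem SmoothCfg.comp {c : P → Config n M N m} (hc : SmoothCfg P c) {a : Q → P}
    (ha : ContDiff ℝ ∞ a) : SmoothCfg Q fun q => c (a q) :=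
  fun i => (hc i).comp ha

/-- A function-valued map on the space of configurations that sends smooth families to smooth
families. -/
def SmoothMap (f : ℝ → Config n M N m → Fn n M) : Prop :=
  ∀ (p : ℕ) (τ : (Fin p → ℝ) → ℝ) (c : (Fin p → ℝ) → Config n M N m),
    ContDiff ℝ ∞ τ → SmoothCfg (Fin p → ℝ) c → SmoothFam (Fin p → ℝ) fun s => f (τ s) (c s)

theorem isVariation_iff {δ : ℝ → Config n M N m → Config n M N m} :
    IsVariation δ ↔ ∀ i, SmoothMap fun t c => comp (δ t c) i :=
  ⟨fun h i p τ c hτ hc => h p τ c hτ hc i, fun h p τ c hτ hc i => h i p τ c hτ hc⟩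

theorem SmoothMap.apply [FiniteDimensional ℝ P] {f : ℝ → Config n M N m → Fn n M}
    (hf : SmoothMap f) {τ : P → ℝ} {c : P → Config n M N m} (hτ : ContDiff ℝ ∞ τ)
    (hc : SmoothCfg P c) : SmoothFam P fun p => f (τ p) (c p) := by
  have e : P ≃L[ℝ] (Fin (Module.finrank ℝ P) → ℝ) :=
    ContinuousLinearEquiv.ofFinrankEq (by simp)
  have := hf _ (fun s => τ (e.symm s)) (fun s => c (e.symm s))
    (hτ.comp e.symm.contDiff) (hc.comp e.symm.contDiff)
  simpa using this.comp e.contDiff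

theorem IsVariation.apply [FiniteDimensional ℝ P] {δ : ℝ → Config n M N m → Config n M N m}
    (hδ : IsVariation δ) {τ : P → ℝ} {c : P → Config n M N m} (hτ : ContDiff ℝ ∞ τ)
    (hc : SmoothCfg P c) : SmoothCfg P fun p => δ (τ p) (c p) :=
  fun i => (isVariation_iff.1 hδ i).apply hτ hc

theorem smoothMap_const (u : Fn n M) : SmoothMap fun _ (_ : Config n M N m) => u :=
  fun _ _ _ _ _ => SmoothFam.const u

theorem smoothMap_comp (i) : SmoothMap fun _ (c : Config n M N m) => comp c i :=
  fun _ _ _ _ hc => hc i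

variable {f g : ℝ → Config n M N m → Fn n M}

theorem SmoothMap.add (hf : SmoothMap f) (hg : SmoothMap g) : SmoothMap fun t c => f t c + g t c :=
  fun _ _ _ hτ hc => (hf _ _ _ hτ hc).add (hg _ _ _ hτ hc)

theorem SmoothMap.sub (hf : SmoothMap f) (hg : SmoothMap g) : SmoothMap fun t c => f t c - g t c :=
  fun _ _ _ hτ hc => (hf _ _ _ hτ hc).sub (hg _ _ _ hτ hc)

theorem SmoothMap.mul (hf : SmoothMap f) (hg : SmoothMap g) : SmoothMap fun t c => f t c * g t c :=
  fun _ _ _ hτ hc => (hf _ _ _ hτ hc).mul (hg _ _ _ hτ hc)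

theorem SmoothMap.const_smul (a : ℝ) (hf : SmoothMap f) : SmoothMap fun t c => a • f t c :=
  fun _ _ _ hτ hc => (hf _ _ _ hτ hc).const_smul a

theorem SmoothMap.sum {κ : Type*} {f : κ → ℝ → Config n M N m → Fn n M} (s : Finset κ)
    (hf : ∀ k, SmoothMap (f k)) : SmoothMap fun t c => ∑ k ∈ s, f k t c :=
  fun _ _ _ hτ hc => SmoothFam.sum s fun k => hf k _ _ _ hτ hc

theorem SmoothMap.diffOp {D : Module.End ℝ (Fn n M)} (hD : D ∈ diffOps n M) (hf : SmoothMap f) :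
    SmoothMap fun t c => D (f t c) :=
  fun _ _ _ hτ hc => (hf _ _ _ hτ hc).diffOp hD

theorem isVariation_const (v : Config n M N m) : IsVariation fun _ (_ : Config n M N m) => v :=
  isVariation_iff.2 fun _ => smoothMap_const _

/-- The derivative of `f` along the tangent vector `(α, v)` to the space of times and
configurations. -/
def lie (f : ℝ → Config n M N m → Fn n M) (t : ℝ) (c : Config n M N m) (α : ℝ)
    (v : Config n M N m) : Fn n M :=
  ddt fun s => f (t + s * α) (c + s • v)

theorem vary_eq_lie (f : ℝ → Config n M N m → Fn n M) (t : ℝ) (c v : Config n M N m) :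
    vary f t c v = lie f t c 0 v := by
  simp [vary, lie, ddt]

theorem timeDeriv_eq_lie (f : ℝ → Config n M N m → Fn n M) (t : ℝ) (c : Config n M N m)
    (w : Fin N → Fn n M) : timeDeriv f t c w = lie f t c 1 (evolution c w) := by
  simp [timeDeriv, lie, ddt]

theorem SmoothCfg.line (c v : Config n M N m) : SmoothCfg ℝ fun s => c + s • v :=
  (SmoothCfg.const c).add ((SmoothCfg.const v).smul contDiff_id)

theorem SmoothMap.line (hf : SmoothMap f) (t : ℝ) (c : Config n M N m) (α : ℝ)
    (v : Config n M N m) : SmoothFam ℝ fun s => f (t + s * α) (c + s • v) :=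
  hf.apply (by fun_prop) (SmoothCfg.line c v)

theorem SmoothMap.lie_of_isVariation (hf : SmoothMap f) (α : ℝ)
    {X : ℝ → Config n M N m → Config n M N m} (hX : IsVariation X) :
    SmoothMap fun t c => lie f t c α (X t c) := by
  intro p τ c hτ hc
  have hXc : SmoothCfg (Fin p → ℝ) fun s => X (τ s) (c s) := hX.apply hτ hc
  exact SmoothFam.ddt_param (u := fun y : ℝ × (Fin p → ℝ) =>
    f (τ y.2 + y.1 * α) (c y.2 + y.1 • X (τ y.2) (c y.2)))
    (hf.apply ((hτ.comp contDiff_snd).add (contDiff_fst.mul contDiff_const))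
      ((hc.comp contDiff_snd).add ((hXc.comp contDiff_snd).smul contDiff_fst)))

theorem SmoothMap.lie_add (hf : SmoothMap f) (t : ℝ) (c : Config n M N m) (α β : ℝ)
    (v w : Config n M N m) : lie f t c (α + β) (v + w) = lie f t c α v + lie f t c β w := by
  have := ddt_diag (u := fun y : ℝ × ℝ =>
    f (t + y.1 * α + y.2 * β) (c + y.1 • v + y.2 • w)) (hf.apply (by fun_prop)
      (((SmoothCfg.const c).add ((SmoothCfg.const v).smul contDiff_fst)).add
        ((SmoothCfg.const w).smul contDiff_snd)))
  simpa [lie, mul_add, add_assoc] using this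

theorem SmoothMap.lie_smul (hf : SmoothMap f) (t : ℝ) (c : Config n M N m) (a α : ℝ)
    (v : Config n M N m) : lie f t c (a * α) (a • v) = a • lie f t c α v := by
  have := ddt_comp_mul (hf.line t c α v) a
  simpa [lie, mul_assoc, smul_smul] using this

/-- The chain rule along a smooth curve of configurations. -/
theorem SmoothMap.ddt_comp (hf : SmoothMap f) {γ : ℝ → Config n M N m} (hγ : SmoothCfg ℝ γ)
    (t α : ℝ) : ddt (fun s => f (t + s * α) (γ s)) =
      lie f t (γ 0) α (ofComp fun i => ddt fun s => comp (γ s) i) := by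
  -- By Hadamard's lemma `γ s = γ 0 + s ρ(s)`, and the two occurrences of `s` can be varied
  -- separately.
  choose ρ hρ h h0 using fun i => (hγ i).exists_quotient_curve
  have hcomp : ∀ s, γ s = γ 0 + s • ofComp fun i => ρ i s := fun s => config_ext fun i => by
    simpa using h i s
  have hρ' : SmoothCfg ℝ fun s => ofComp fun i => ρ i s := fun i => by simpa using hρ i
  have := ddt_diag (u := fun y : ℝ × ℝ =>
    f (t + y.1 * α) (γ 0 + y.1 • ofComp fun i => ρ i y.2)) (hf.apply (by fun_prop)
      ((SmoothCfg.const (γ 0)).add ((hρ'.comp contDiff_snd).smul contDiff_fst)))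
  simp only [← hcomp, h0] at this
  rw [this]
  simp [lie, ddt_const]

theorem lie_comp (t : ℝ) (c : Config n M N m) (α : ℝ) (v : Config n M N m) (i) :
    lie (fun _ (c : Config n M N m) => comp c i) t c α v = comp v i := by
  refine ddt_eq_of_hasDerivAt ((smoothMap_comp i).line t c α v) fun x => ?_
  have : HasDerivAt (fun s : ℝ => comp c i x + s * comp v i x) (1 * comp v i x) 0 :=
    ((hasDerivAt_id (0 : ℝ)).mul_const _).const_add _
  refine (this.congr_deriv (one_mul _)).congr_of_eventuallyEq
    (Filter.Eventually.of_forall fun s => ?_)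
  simp only [comp_add, comp_smul]
  rfl

/-- The componentwise derivative of a vector field on the space of configurations. -/
def lieC (Y : ℝ → Config n M N m → Config n M N m) (t : ℝ) (c : Config n M N m) (α : ℝ)
    (v : Config n M N m) : Config n M N m :=
  ofComp fun i => lie (fun t c => comp (Y t c) i) t c α v

@[simp] theorem comp_lieC (Y : ℝ → Config n M N m → Config n M N m) (t : ℝ) (c : Config n M N m)
    (α : ℝ) (v : Config n M N m) (i) :
    comp (lieC Y t c α v) i = lie (fun t c => comp (Y t c) i) t c α v :=
  comp_ofComp _ _

/-- The bracket of the vector fields `(α, X)` and `(β, Y)` with constant time components. -/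
def brk (α : ℝ) (X : ℝ → Config n M N m → Config n M N m) (β : ℝ)
    (Y : ℝ → Config n M N m → Config n M N m) (t : ℝ) (c : Config n M N m) : Config n M N m :=
  lieC Y t c α (X t c) - lieC X t c β (Y t c)

variable {X Y : ℝ → Config n M N m → Config n M N m}

theorem IsVariation.brk (hX : IsVariation X) (hY : IsVariation Y) (α β : ℝ) :
    IsVariation (brk α X β Y) := by
  rw [isVariation_iff] at *
  intro i
  simp only [GaugeBC.brk, comp_sub, comp_lieC]
  exact ((hY i).lie_of_isVariation α (isVariation_iff.2 hX)).sub
    ((hX i).lie_of_isVariation β (isVariation_iff.2 hY))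

/-- The derivative along `X` of the derivative along `Y` is the second derivative in the frozen
directions `X t c` and `Y t c`, plus the derivative along the variation of `Y` along `X`. -/
theorem SmoothMap.lie_lie_eq (hf : SmoothMap f) (hY : IsVariation Y)
    (α β t : ℝ) (c : Config n M N m) :
    lie (fun t c => lie f t c β (Y t c)) t c α (X t c) =
      ddt (fun r => lie f (t + r * β) (c + r • Y t c) α (X t c)) +
        lie f t c 0 (lieC Y t c α (X t c)) := by
  set x := X t c
  set y := Y t c
  have hYc : SmoothCfg ℝ fun s => Y (t + s * α) (c + s • x) :=
    hY.apply (by fun_prop) (SmoothCfg.line c x)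
  choose ρ hρ h h0 using fun i => (hYc i).exists_quotient_curve
  set R : ℝ → Config n M N m := fun s => ofComp fun i => ρ i s
  have hR : SmoothCfg ℝ R := fun i => by simpa [R] using hρ i
  have hcomp : ∀ s, Y (t + s * α) (c + s • x) = y + s • R s := fun s => config_ext fun i => by
    simpa [R] using h i s
  have hR0 : R 0 = lieC Y t c α x := config_ext fun i => by
    rw [comp_ofComp, comp_lieC]
    exact h0 i
  -- The first derivative exchanges with the one along `Y`, whose direction varies with `s`.
  have hu : SmoothFam (ℝ × ℝ) fun z : ℝ × ℝ =>
      f (t + z.1 * α + z.2 * β) (c + z.1 • x + z.2 • (y + z.1 • R z.1)) := by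
    refine hf.apply (by fun_prop) (((SmoothCfg.const c).add
      ((SmoothCfg.const x).smul contDiff_fst)).add (SmoothCfg.smul contDiff_snd
      ((SmoothCfg.const y).add ((hR.comp contDiff_fst).smul contDiff_fst))))
  have h1 : lie (fun t c => lie f t c β (Y t c)) t c α x = ddt fun s => ddt fun r =>
      f (t + s * α + r * β) (c + s • x + r • (y + s • R s)) := by
    simp only [lie, hcomp]
  rw [h1, ddt_comm hu]
  have h2 : ∀ r : ℝ, (ddt fun s => f (t + s * α + r * β) (c + s • x + r • (y + s • R s))) =
      lie f (t + r * β) (c + r • y) α x + r • lie f (t + r * β) (c + r • y) 0 (R 0) := by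
    intro r
    have hγ : SmoothCfg ℝ fun s => c + s • x + r • (y + s • R s) := by
      refine (SmoothCfg.line c x).add (SmoothCfg.smul contDiff_const
        ((SmoothCfg.const y).add (hR.smul contDiff_id)))
    have h3 := hf.ddt_comp hγ (t + r * β) α
    have h4 : (ofComp fun i => ddt fun s => comp (c + s • x + r • (y + s • R s)) i) =
        x + r • R 0 := by
      refine config_ext fun i => ?_
      rw [comp_ofComp]
      refine ddt_eq_of_hasDerivAt (hγ i) fun p => ?_
      have hRd := (((hR i).contDiff p).differentiable (by simp) 0).hasDerivAt
      have : HasDerivAt (fun s : ℝ => comp c i p + s * comp x i p + r * (comp y i p +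
          s * comp (R s) i p)) (1 * comp x i p + r * (1 * comp (R 0) i p + 0 * _)) 0 :=
        (((hasDerivAt_id (0 : ℝ)).mul_const _).const_add _).add
          ((((hasDerivAt_id (0 : ℝ)).mul hRd).const_add _).const_mul r)
      refine (this.congr_deriv ?_).congr_of_eventuallyEq
        (Filter.Eventually.of_forall fun s => ?_)
      · rw [comp_add, comp_smul, one_mul, one_mul, zero_mul, add_zero]
        rfl
      · simp only [comp_add, comp_smul]
        rfl
    have h5 : (fun s => f (t + s * α + r * β) (c + s • x + r • (y + s • R s))) =
        fun s => f (t + r * β + s * α) (c + s • x + r • (y + s • R s)) := by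
      funext s; rw [add_right_comm]
    rw [h5, h3, h4]
    have h6 := hf.lie_add (t + r * β) (c + r • y) α 0 x (r • R 0)
    have h7 := hf.lie_smul (t + r * β) (c + r • y) r 0 (R 0)
    simp only [mul_zero, add_zero] at h6 h7
    rw [← h7, ← h6]
    simp
  have e1 : SmoothFam ℝ fun r => lie f (t + r * β) (c + r • y) α x :=
    (hf.lie_of_isVariation α (isVariation_const x)).line t c β y
  have e2 : SmoothFam ℝ fun r => lie f (t + r * β) (c + r • y) 0 (R 0) :=
    (hf.lie_of_isVariation 0 (isVariation_const (R 0))).line t c β y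
  have e3 : SmoothFam ℝ fun r => r • lie f (t + r * β) (c + r • y) 0 (R 0) :=
    e2.smul contDiff_id
  have e4 : ddt (fun r => r • lie f (t + r * β) (c + r • y) 0 (R 0)) = lie f t c 0 (R 0) := by
    refine ddt_eq_of_hasDerivAt e3 fun p => ?_
    have := (hasDerivAt_id (0 : ℝ)).mul ((e2.contDiff p).differentiable (by simp) 0).hasDerivAt
    refine this.congr_deriv ?_
    simp
  simp only [h2]
  rw [ddt_add e1 e3, e4, hR0]

/-- The commutator of two derivatives is the derivative along the bracket. -/
theorem SmoothMap.lie_lie_sub (hf : SmoothMap f) (hX : IsVariation X) (hY : IsVariation Y)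
    (α β t : ℝ) (c : Config n M N m) :
    lie (fun t c => lie f t c β (Y t c)) t c α (X t c) -
      lie (fun t c => lie f t c α (X t c)) t c β (Y t c) = lie f t c 0 (brk α X β Y t c) := by
  have h1 : (ddt fun r => lie f (t + r * β) (c + r • Y t c) α (X t c)) =
      ddt fun s => lie f (t + s * α) (c + s • X t c) β (Y t c) := by
    have hu : SmoothFam (ℝ × ℝ) fun z : ℝ × ℝ =>
        f (t + z.1 * β + z.2 * α) (c + z.1 • Y t c + z.2 • X t c) := by
      refine hf.apply (by fun_prop) (((SmoothCfg.const c).add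
        ((SmoothCfg.const _).smul contDiff_fst)).add ((SmoothCfg.const _).smul contDiff_snd))
    have := ddt_comm hu
    simpa only [lie, add_right_comm] using this
  have h2 := hf.lie_add t c 0 0 (brk α X β Y t c) (lieC X t c β (Y t c))
  rw [add_zero, brk, sub_add_cancel] at h2
  rw [hf.lie_lie_eq hY, hf.lie_lie_eq hX, h1, h2, brk]
  abel

end Calculus

/-! ### Calculus of functionals -/

section Functionals

variable {n : ℕ} [NeZero n] {M : Type*} [TopologicalSpace M]
  [ChartedSpace (EuclideanHalfSpace n) M] [IsManifold (𝓡∂ n) ∞ M] {N m : ℕ}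
  [CompactSpace M] [MeasurableSpace M] [BorelSpace M]

theorem SmoothFam.hasDerivAt_integ (μ : Measure M) [IsFiniteMeasure μ] {u : ℝ → Fn n M}
    (hu : SmoothFam ℝ u) : HasDerivAt (fun s => integ μ (u s)) (integ μ (ddt u)) 0 :=
  hu.hasDerivAt_integral μ

/-- The derivative of the functional `F` along the tangent vector `(α, v)`. -/
def lieF (F : ℝ → Config n M N m → ℝ) (t : ℝ) (c : Config n M N m) (α : ℝ)
    (v : Config n M N m) : ℝ :=
  deriv (fun s : ℝ => F (t + s * α) (c + s • v)) 0

theorem varyF_eq_lieF (F : ℝ → Config n M N m → ℝ) (t : ℝ) (c v : Config n M N m) :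
    varyF F t c v = lieF F t c 0 v := by
  simp [varyF, lieF]

theorem timeDerivF_eq_lieF (F : ℝ → Config n M N m → ℝ) (t : ℝ) (c : Config n M N m)
    (w : Fin N → Fn n M) : timeDerivF F t c w = lieF F t c 1 (evolution c w) := by
  simp [timeDerivF, lieF]

variable (μ ν : Measure M) [IsFiniteMeasure μ] [IsFiniteMeasure ν]

/-- `F = ∫ f dμ + ∫ k dν` with maps `f`, `k` that are smooth along smooth families. -/
def SmoothFnl (F : ℝ → Config n M N m → ℝ) : Prop :=
  ∃ f k : ℝ → Config n M N m → Fn n M, SmoothMap f ∧ SmoothMap k ∧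
    ∀ t c, F t c = integ μ (f t c) + integ ν (k t c)

variable {μ ν} {F G : ℝ → Config n M N m → ℝ} {f k : ℝ → Config n M N m → Fn n M}

theorem smoothFnl_integ (hf : SmoothMap f) : SmoothFnl μ ν fun t c => integ μ (f t c) :=
  ⟨f, fun _ _ => 0, hf, smoothMap_const 0, fun t c => by simp⟩

theorem smoothFnl_integ_boundary (hf : SmoothMap f) : SmoothFnl μ ν fun t c => integ ν (f t c) :=
  ⟨fun _ _ => 0, f, smoothMap_const 0, hf, fun t c => by simp⟩

theorem SmoothFnl.add (hF : SmoothFnl μ ν F) (hG : SmoothFnl μ ν G) :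
    SmoothFnl μ ν fun t c => F t c + G t c := by
  obtain ⟨f, k, hf, hk, h⟩ := hF
  obtain ⟨f', k', hf', hk', h'⟩ := hG
  refine ⟨_, _, hf.add hf', hk.add hk', fun t c => ?_⟩
  simp only [h, h', map_add]
  ring

theorem SmoothFnl.const_smul (a : ℝ) (hF : SmoothFnl μ ν F) :
    SmoothFnl μ ν fun t c => a * F t c := by
  obtain ⟨f, k, hf, hk, h⟩ := hF
  refine ⟨_, _, hf.const_smul a, hk.const_smul a, fun t c => ?_⟩
  simp only [h, map_smul, smul_eq_mul]
  ring

theorem SmoothFnl.sub (hF : SmoothFnl μ ν F) (hG : SmoothFnl μ ν G) :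
    SmoothFnl μ ν fun t c => F t c - G t c := by
  simpa [sub_eq_add_neg] using hF.add (hG.const_smul (-1))

/-- The chain rule for functionals along smooth curves of configurations. -/
theorem SmoothFnl.hasDerivAt_comp (hF : SmoothFnl μ ν F) {γ : ℝ → Config n M N m}
    (hγ : SmoothCfg ℝ γ) (t α : ℝ) : HasDerivAt (fun s => F (t + s * α) (γ s))
      (lieF F t (γ 0) α (ofComp fun i => ddt fun s => comp (γ s) i)) 0 := by
  obtain ⟨f, k, hf, hk, h⟩ := hF
  have key : ∀ {γ : ℝ → Config n M N m}, SmoothCfg ℝ γ → HasDerivAt (fun s => F (t + s * α) (γ s))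
      (integ μ (ddt fun s => f (t + s * α) (γ s)) + integ ν (ddt fun s => k (t + s * α) (γ s)))
      0 := by
    intro γ hγ
    simp only [h]
    exact ((hf.apply (by fun_prop) hγ).hasDerivAt_integ μ).add
      ((hk.apply (by fun_prop) hγ).hasDerivAt_integ ν)
  refine (key hγ).congr_deriv ?_
  rw [lieF, (key (SmoothCfg.line _ _)).deriv, hf.ddt_comp hγ, hk.ddt_comp hγ]
  rfl

theorem lieF_eq_integ (hf : SmoothMap f) (hk : SmoothMap k)
    (h : ∀ t c, F t c = integ μ (f t c) + integ ν (k t c)) (t : ℝ) (c : Config n M N m) (α : ℝ)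
    (v : Config n M N m) :
    lieF F t c α v = integ μ (lie f t c α v) + integ ν (lie k t c α v) := by
  simp only [lieF, h]
  exact (((hf.line t c α v).hasDerivAt_integ μ).add ((hk.line t c α v).hasDerivAt_integ ν)).deriv

theorem lieF_integ (hf : SmoothMap f) (t : ℝ) (c : Config n M N m) (α : ℝ) (v : Config n M N m) :
    lieF (fun t c => integ μ (f t c)) t c α v = integ μ (lie f t c α v) :=
  ((hf.line t c α v).hasDerivAt_integ μ).deriv

theorem SmoothFnl.hasDerivAt_line (hF : SmoothFnl μ ν F) (t : ℝ) (c : Config n M N m) (α : ℝ)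
    (v : Config n M N m) : HasDerivAt (fun s => F (t + s * α) (c + s • v)) (lieF F t c α v) 0 := by
  obtain ⟨f, k, hf, hk, h⟩ := hF
  rw [lieF_eq_integ hf hk h]
  simp only [h]
  exact ((hf.line t c α v).hasDerivAt_integ μ).add ((hk.line t c α v).hasDerivAt_integ ν)

theorem SmoothFnl.lieF_add_fnl (hF : SmoothFnl μ ν F) (hG : SmoothFnl μ ν G) (t : ℝ)
    (c : Config n M N m) (α : ℝ) (v : Config n M N m) :
    lieF (fun t c => F t c + G t c) t c α v = lieF F t c α v + lieF G t c α v :=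
  ((hF.hasDerivAt_line t c α v).add (hG.hasDerivAt_line t c α v)).deriv

theorem SmoothFnl.lieF_sub_fnl (hF : SmoothFnl μ ν F) (hG : SmoothFnl μ ν G) (t : ℝ)
    (c : Config n M N m) (α : ℝ) (v : Config n M N m) :
    lieF (fun t c => F t c - G t c) t c α v = lieF F t c α v - lieF G t c α v :=
  ((hF.hasDerivAt_line t c α v).sub (hG.hasDerivAt_line t c α v)).deriv

theorem SmoothFnl.lieF_const_mul (a : ℝ) (hF : SmoothFnl μ ν F) (t : ℝ)
    (c : Config n M N m) (α : ℝ) (v : Config n M N m) :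
    lieF (fun t c => a * F t c) t c α v = a * lieF F t c α v :=
  ((hF.hasDerivAt_line t c α v).const_mul a).deriv

theorem SmoothFnl.lieF_add (hF : SmoothFnl μ ν F) (t : ℝ) (c : Config n M N m) (α β : ℝ)
    (v w : Config n M N m) : lieF F t c (α + β) (v + w) = lieF F t c α v + lieF F t c β w := by
  obtain ⟨f, k, hf, hk, h⟩ := hF
  simp only [lieF_eq_integ hf hk h, hf.lie_add, hk.lie_add, map_add]
  ring

theorem SmoothFnl.lieF_smul (hF : SmoothFnl μ ν F) (t : ℝ) (c : Config n M N m) (a α : ℝ)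
    (v : Config n M N m) : lieF F t c (a * α) (a • v) = a * lieF F t c α v := by
  obtain ⟨f, k, hf, hk, h⟩ := hF
  simp only [lieF_eq_integ hf hk h, hf.lie_smul, hk.lie_smul, map_smul, smul_eq_mul]
  ring

variable {X Y : ℝ → Config n M N m → Config n M N m}

theorem SmoothFnl.lieF_of_isVariation (hF : SmoothFnl μ ν F) (α : ℝ) (hX : IsVariation X) :
    SmoothFnl μ ν fun t c => lieF F t c α (X t c) := by
  obtain ⟨f, k, hf, hk, h⟩ := hF
  exact ⟨_, _, hf.lie_of_isVariation α hX, hk.lie_of_isVariation α hX,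
    fun t c => lieF_eq_integ hf hk h t c α _⟩

theorem SmoothFnl.lieF_lieF_sub (hF : SmoothFnl μ ν F) (hX : IsVariation X) (hY : IsVariation Y)
    (α β t : ℝ) (c : Config n M N m) :
    lieF (fun t c => lieF F t c β (Y t c)) t c α (X t c) -
      lieF (fun t c => lieF F t c α (X t c)) t c β (Y t c) = lieF F t c 0 (brk α X β Y t c) := by
  obtain ⟨f, k, hf, hk, h⟩ := hF
  rw [lieF_eq_integ (hf.lie_of_isVariation β hY) (hk.lie_of_isVariation β hY)
      fun t c => lieF_eq_integ hf hk h t c β _,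
    lieF_eq_integ (hf.lie_of_isVariation α hX) (hk.lie_of_isVariation α hX)
      fun t c => lieF_eq_integ hf hk h t c α _,
    lieF_eq_integ hf hk h, ← hf.lie_lie_sub hX hY, ← hk.lie_lie_sub hX hY, map_sub, map_sub]
  ring

end Functionals

/-! ### Local functions -/

section Local

variable {n : ℕ} [NeZero n] {M : Type*} [TopologicalSpace M]
  [ChartedSpace (EuclideanHalfSpace n) M] [IsManifold (𝓡∂ n) ∞ M] {N m : ℕ}

/-- The derivative of a smooth family with respect to the parameters, in the direction `v`. -/
theorem SmoothFam.exists_fderiv {P : Type} [NormedAddCommGroup P] [NormedSpace ℝ P]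
    {g : P → Fn n M} (hg : SmoothFam P g) (v : P) : ∃ g' : P → Fn n M, SmoothFam P g' ∧
      ∀ p x, g' p x = fderiv ℝ (fun p => g p x) p v := by
  have h := contMDiff_fderiv_param hg v
  exact ⟨fun p => ⟨fun x => fderiv ℝ (fun p => g p x) p v,
    h.comp (contMDiff_const.prodMk contMDiff_id)⟩, h, fun _ _ => rfl⟩

/-- A local function can be given by any finite family of derivatives of the fields and by a smooth
family of functions on `M`, whose parameters are the time and the values of these derivatives. -/
theorem isLocal_of_repr {f : ℝ → Config n M N m → Fn n M} {κ : Type} [Fintype κ]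
    (i : κ → Fin N ⊕ (ℕ × Fin m)) (D : κ → Module.End ℝ (Fn n M)) (g : ℝ × (κ → ℝ) → Fn n M)
    (hD : ∀ j, D j ∈ diffOps n M) (hg : SmoothFam (ℝ × (κ → ℝ)) g)
    (h : ∀ t c x, f t c x = g (t, fun j => D j (comp c (i j)) x) x) : IsLocal f := by
  let e := Fintype.equivFin κ
  refine ⟨Fintype.card κ, i ∘ e.symm, D ∘ e.symm,
    fun y => g (y.1, fun j => y.2.2 (e j)) y.2.1, fun j => hD _, ?_, fun t c x => ?_⟩
  · refine hg.comp_contMDiff ?_ (contMDiff_fst.comp contMDiff_snd)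
    refine contMDiff_fst.prodMk_space (contMDiff_pi_space.2 fun j => ?_)
    have h1 : ContMDiff 𝓘(ℝ, Fin (Fintype.card κ) → ℝ) 𝓘(ℝ, ℝ) ∞
        fun y : Fin (Fintype.card κ) → ℝ => y (e j) :=
      (contDiff_apply ℝ ℝ (e j)).contMDiff
    exact h1.comp (contMDiff_snd.comp contMDiff_snd)
  · simp [h]

theorem IsLocal.exists_repr {f : ℝ → Config n M N m → Fn n M} (hf : IsLocal f) :
    ∃ (p : ℕ) (i : Fin p → Fin N ⊕ (ℕ × Fin m)) (D : Fin p → Module.End ℝ (Fn n M))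
      (g : ℝ × (Fin p → ℝ) → Fn n M), (∀ j, D j ∈ diffOps n M) ∧
      SmoothFam (ℝ × (Fin p → ℝ)) g ∧
      ∀ t c x, f t c x = g (t, fun j => D j (comp c (i j)) x) x := by
  obtain ⟨p, i, D, F, hD, hF, h⟩ := hf
  have hF' : ContMDiff (𝓘(ℝ, ℝ × (Fin p → ℝ)).prod (𝓡∂ n)) 𝓘(ℝ, ℝ) ∞
      fun y : (ℝ × (Fin p → ℝ)) × M => F (y.1.1, y.2, y.1.2) :=
    hF.comp ((contDiff_fst.contMDiff.comp contMDiff_fst).prodMk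
      (contMDiff_snd.prodMk (contDiff_snd.contMDiff.comp contMDiff_fst)))
  exact ⟨p, i, D, fun y => ⟨fun x => F (y.1, x, y.2),
    hF'.comp (contMDiff_const (c := y).prodMk contMDiff_id)⟩, hD, hF', h⟩

theorem IsLocal.smoothMap {f : ℝ → Config n M N m → Fn n M} (hf : IsLocal f) : SmoothMap f := by
  obtain ⟨q, i, D, g, hD, hg, h⟩ := hf.exists_repr
  intro p τ c hτ hc
  simp only [SmoothFam, h]
  refine hg.comp_contMDiff ?_ contMDiff_snd
  exact (hτ.contMDiff.comp contMDiff_fst).prodMk_space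
    (contMDiff_pi_space.2 fun j => (hc (i j)).diffOp (hD j))

/-- Local functions are closed under composition with smooth functions. -/
theorem IsLocal.compose {κ : Type} [Fintype κ] {f : κ → ℝ → Config n M N m → Fn n M}
    (hf : ∀ k, IsLocal (f k)) {g : ℝ × (κ → ℝ) → Fn n M} (hg : SmoothFam (ℝ × (κ → ℝ)) g)
    {F : ℝ → Config n M N m → Fn n M} (h : ∀ t c x, F t c x = g (t, fun k => f k t c x) x) :
    IsLocal F := by
  choose p i D G hD hG hfG using fun k => (hf k).exists_repr
  have hs : ContMDiff (𝓘(ℝ, ℝ × ((Σ k, Fin (p k)) → ℝ)).prod (𝓡∂ n)) 𝓘(ℝ, ℝ) ∞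
      fun y : (ℝ × ((Σ k, Fin (p k)) → ℝ)) × M =>
        g (y.1.1, fun k => G k (y.1.1, fun j => y.1.2 ⟨k, j⟩) y.2) y.2 := by
    have h1 : ContMDiff (𝓘(ℝ, ℝ × ((Σ k, Fin (p k)) → ℝ)).prod (𝓡∂ n)) 𝓘(ℝ, ℝ) ∞
        fun y : (ℝ × ((Σ k, Fin (p k)) → ℝ)) × M => y.1.1 :=
      contDiff_fst.contMDiff.comp contMDiff_fst
    refine hg.comp_contMDiff (h1.prodMk_space (contMDiff_pi_space.2 fun k => ?_)) contMDiff_snd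
    refine (hG k).comp_contMDiff (h1.prodMk_space (contMDiff_pi_space.2 fun j => ?_)) contMDiff_snd
    have h2 : ContDiff ℝ ∞ fun y : ℝ × ((Σ k, Fin (p k)) → ℝ) => y.2 ⟨k, j⟩ := by fun_prop
    exact h2.contMDiff.comp contMDiff_fst
  refine isLocal_of_repr (κ := Σ k, Fin (p k)) (fun j => i j.1 j.2) (fun j => D j.1 j.2)
    (fun y => ⟨fun x => g (y.1, fun k => G k (y.1, fun j => y.2 ⟨k, j⟩) x) x,
      hs.comp (contMDiff_const (c := y).prodMk contMDiff_id)⟩) (fun j => hD _ _) hs fun t c x => ?_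
  rw [h]
  simp only [hfG]
  rfl

theorem isLocal_const (u : Fn n M) : IsLocal fun _ (_ : Config n M N m) => u :=
  isLocal_of_repr (κ := Fin 0) (fun j => j.elim0) (fun j => j.elim0) (fun _ => u)
    (fun j => j.elim0) (SmoothFam.const u) fun _ _ _ => rfl

theorem isLocal_diffOp_comp {D : Module.End ℝ (Fn n M)} (hD : D ∈ diffOps n M) (i) :
    IsLocal fun _ (c : Config n M N m) => D (comp c i) := by
  have hs : ContMDiff (𝓘(ℝ, ℝ × (Unit → ℝ)).prod (𝓡∂ n)) 𝓘(ℝ, ℝ) ∞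
      fun y : (ℝ × (Unit → ℝ)) × M => y.1.2 () := by
    have : ContDiff ℝ ∞ fun y : ℝ × (Unit → ℝ) => y.2 () := by fun_prop
    exact this.contMDiff.comp contMDiff_fst
  exact isLocal_of_repr (κ := Unit) (fun _ => i) (fun _ => D)
    (fun y => ⟨fun _ => y.2 (), contMDiff_const⟩) (fun _ => hD) hs fun _ _ _ => rfl

theorem isLocal_comp (i) : IsLocal fun _ (c : Config n M N m) => comp c i :=
  isLocal_diffOp_comp (one_mem _) i

variable {f g : ℝ → Config n M N m → Fn n M}

theorem IsLocal.add (hf : IsLocal f) (hg : IsLocal g) : IsLocal fun t c => f t c + g t c := by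
  have hs : ContMDiff (𝓘(ℝ, ℝ × (Bool → ℝ)).prod (𝓡∂ n)) 𝓘(ℝ, ℝ) ∞
      fun y : (ℝ × (Bool → ℝ)) × M => y.1.2 true + y.1.2 false := by
    have : ContDiff ℝ ∞ fun y : ℝ × (Bool → ℝ) => y.2 true + y.2 false := by fun_prop
    exact this.contMDiff.comp contMDiff_fst
  exact IsLocal.compose (f := fun b : Bool => if b then f else g) (by simp [hf, hg])
    (g := fun y => ⟨fun _ => y.2 true + y.2 false, contMDiff_const⟩) hs fun _ _ _ => rfl

theorem IsLocal.mul (hf : IsLocal f) (hg : IsLocal g) : IsLocal fun t c => f t c * g t c := by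
  have hs : ContMDiff (𝓘(ℝ, ℝ × (Bool → ℝ)).prod (𝓡∂ n)) 𝓘(ℝ, ℝ) ∞
      fun y : (ℝ × (Bool → ℝ)) × M => y.1.2 true * y.1.2 false := by
    have : ContDiff ℝ ∞ fun y : ℝ × (Bool → ℝ) => y.2 true * y.2 false := by fun_prop
    exact this.contMDiff.comp contMDiff_fst
  exact IsLocal.compose (f := fun b : Bool => if b then f else g) (by simp [hf, hg])
    (g := fun y => ⟨fun _ => y.2 true * y.2 false, contMDiff_const⟩) hs fun _ _ _ => rfl

theorem IsLocal.const_smul (a : ℝ) (hf : IsLocal f) : IsLocal fun t c => a • f t c := by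
  have := (isLocal_const (N := N) (m := m) (a • (1 : Fn n M))).mul hf
  simpa using this

theorem IsLocal.sub (hf : IsLocal f) (hg : IsLocal g) : IsLocal fun t c => f t c - g t c := by
  simpa [sub_eq_add_neg] using hf.add (hg.const_smul (-1))

theorem IsLocal.sum {κ : Type*} {f : κ → ℝ → Config n M N m → Fn n M} (s : Finset κ)
    (hf : ∀ k, IsLocal (f k)) : IsLocal fun t c => ∑ k ∈ s, f k t c := by
  classical
  induction s using Finset.induction_on with
  | empty => simpa using isLocal_const (0 : Fn n M)
  | insert a s ha ih => simpa [Finset.sum_insert ha] using (hf a).add ih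

/-- The derivative at `x` of a real function along a tangent vector, as a real number. -/
def derivAlong (u : M → ℝ) (x : M) (V : TangentSpace (𝓡∂ n) x) : ℝ :=
  mfderiv (𝓡∂ n) 𝓘(ℝ, ℝ) u x V

/-- The total derivative with respect to `x` of a function of `x` and of fields at `x`. -/
theorem mfderiv_smoothFam_comp {κ : Type} [Fintype κ] {g : ℝ × (κ → ℝ) → Fn n M}
    (hg : SmoothFam (ℝ × (κ → ℝ)) g) (t : ℝ) (y : κ → Fn n M) (x : M)
    (V : TangentSpace (𝓡∂ n) x) :
    derivAlong (fun x => g (t, fun j => y j x) x) x V =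
      fderiv ℝ (fun p => g p x) (t, fun j => y j x) (0, fun j => derivAlong (y j) x V) +
        derivAlong (g (t, fun j => y j x)) x V := by
  let L : (κ → TangentSpace (𝓡∂ n) x →L[ℝ] ℝ) := fun j => mfderiv (𝓡∂ n) 𝓘(ℝ, ℝ) (y j) x
  have h1 : ∀ j, HasMFDerivAt (𝓡∂ n) 𝓘(ℝ, ℝ) (y j) x (L j) :=
    fun j => ((y j).contMDiff.mdifferentiableAt (by simp)).hasMFDerivAt
  let L' : TangentSpace (𝓡∂ n) x →L[ℝ] ℝ × (κ → ℝ) :=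
    (0 : TangentSpace (𝓡∂ n) x →L[ℝ] ℝ).prod (ContinuousLinearMap.pi L)
  have hy : HasMFDerivAt (𝓡∂ n) 𝓘(ℝ, ℝ × (κ → ℝ)) (fun x => (t, fun j => y j x)) x L' := by
    refine ⟨continuousAt_const.prodMk (continuousAt_pi.2 fun j => (h1 j).1), ?_⟩
    exact (hasFDerivWithinAt_const _ _ _).prodMk (hasFDerivWithinAt_pi.2 fun j => (h1 j).2)
  have hΨ := hy.prodMk (hasMFDerivAt_id (I := 𝓡∂ n) x)
  have hd : MDifferentiableAt (𝓘(ℝ, ℝ × (κ → ℝ)).prod (𝓡∂ n)) 𝓘(ℝ, ℝ)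
      (fun z : (ℝ × (κ → ℝ)) × M => g z.1 z.2) ((t, fun j => y j x), x) :=
    ContMDiffAt.mdifferentiableAt (hg _) (by simp)
  have hcomp := (HasMFDerivAt.comp (I := 𝓡∂ n) (I' := 𝓘(ℝ, ℝ × (κ → ℝ)).prod (𝓡∂ n))
    (f := fun x => ((t, fun j => y j x), x)) x hd.hasMFDerivAt hΨ).mfderiv
  let W : TangentSpace (𝓘(ℝ, ℝ × (κ → ℝ)).prod (𝓡∂ n)) (((t, fun j => y j x), x) :
      (ℝ × (κ → ℝ)) × M) := (L' V, V)
  have h2 := mfderiv_prod_eq_add_apply hd (v := W)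
  rw [mfderiv_eq_fderiv] at h2
  exact (DFunLike.congr_fun hcomp V).trans h2

/-- Derivatives of local functions are local: the total derivative along a vector field is the
derivative at fixed values of the fields, plus a term for each field. -/
theorem IsLocal.diffOp {D : Module.End ℝ (Fn n M)} (hD : D ∈ diffOps n M) (hf : IsLocal f) :
    IsLocal fun t c => D (f t c) := by
  induction hD using Algebra.adjoin_induction generalizing f with
  | mem D hD =>
    rcases hD with ⟨u, rfl⟩ | hX
    · exact (isLocal_const u).mul hf
    · have hDX : D ∈ diffOps n M := Algebra.subset_adjoin (Or.inr hX)
      obtain ⟨p, i, E, g, hE, hg, h⟩ := hf.exists_repr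
      choose g' hg' hgg' using fun j : Fin p => hg.exists_fderiv (0, Pi.single j 1)
      have hloc : ∀ j, IsLocal fun _ (c : Config n M N m) => E j (comp c (i j)) :=
        fun j => isLocal_diffOp_comp (hE j) _
      have hfun : ∀ (t : ℝ) (y : Fin p → Fn n M),
          ContMDiff (𝓡∂ n) 𝓘(ℝ, ℝ × (Fin p → ℝ)) ∞ fun x => (t, fun j => y j x) := fun t y =>
        contMDiff_const.prodMk_space (contMDiff_pi_space.2 fun j => (y j).contMDiff)
      let S : ∀ g : ℝ × (Fin p → ℝ) → Fn n M, SmoothFam (ℝ × (Fin p → ℝ)) g →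
          ℝ → Config n M N m → Fn n M := fun g hg t c =>
        ⟨fun x => g (t, fun j => E j (comp c (i j)) x) x,
          hg.comp_contMDiff (hfun t _) contMDiff_id⟩
      have hSl : ∀ g hg, IsLocal (S g hg) := fun g hg => IsLocal.compose hloc hg fun _ _ _ => rfl
      have hDg := hg.diffOp hDX
      have hmain : ∀ t c, D (f t c) = S _ hDg t c +
          ∑ j, S _ (hg' j) t c * D (E j (comp c (i j))) := by
        intro t c
        obtain ⟨V, -, hV⟩ := hX
        have hV' : ∀ (u : Fn n M) x, D u x = derivAlong u x (V x) := hV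
        ext x
        have hfx : (f t c : M → ℝ) = fun x => g (t, fun j => E j (comp c (i j)) x) x :=
          funext (h t c)
        have hsum : fderiv ℝ (fun p => g p x) (t, fun j => E j (comp c (i j)) x)
            (0, fun j => derivAlong (E j (comp c (i j))) x (V x)) =
            ∑ j, g' j (t, fun j => E j (comp c (i j)) x) x * D (E j (comp c (i j))) x := by
          have : ((0 : ℝ), fun j => derivAlong (E j (comp c (i j))) x (V x)) =
              ∑ j, D (E j (comp c (i j))) x • ((0 : ℝ), (Pi.single j (1 : ℝ) : Fin p → ℝ)) := by
            ext k
            · simp [Prod.fst_sum]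
            · simp [Finset.sum_apply, Prod.snd_sum, Pi.single_apply, hV']
          rw [this, map_sum]
          refine Finset.sum_congr rfl fun j _ => ?_
          rw [map_smul, hgg', smul_eq_mul, mul_comm]
        rw [hV', hfx, mfderiv_smoothFam_comp hg, add_comm, hsum, ← hV']
        refine congrArg (_ + ·) ?_
        exact (sum_fn_apply _ (fun j => S _ (hg' j) t c * D (E j (comp c (i j)))) x).symm
      simp only [hmain]
      have hDE : ∀ j, IsLocal fun _ (c : Config n M N m) => D (E j (comp c (i j))) := fun j =>
        isLocal_diffOp_comp (mul_mem hDX (hE j)) (i j)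
      exact (hSl _ hDg).add (IsLocal.sum _ fun j => (hSl _ (hg' j)).mul (hDE j))
  | algebraMap r => exact hf.const_smul r
  | add D₁ D₂ _ _ h₁ h₂ => exact (h₁ hf).add (h₂ hf)
  | mul D₁ D₂ _ _ h₁ h₂ => exact h₁ (h₂ hf)

end Local

/-! ### The linearisation of local functions -/

section Linearization

variable {n : ℕ} [NeZero n] {M : Type*} [TopologicalSpace M]
  [ChartedSpace (EuclideanHalfSpace n) M] [IsManifold (𝓡∂ n) ∞ M] {N m : ℕ}
  {f g : ℝ → Config n M N m → Fn n M}

/-- The derivative of a local function is a linear differential operator with local coefficients,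
applied to the variation of the fields. -/
theorem IsLocal.linearization (hf : IsLocal f) :
    ∃ (p : ℕ) (i : Fin p → Fin N ⊕ (ℕ × Fin m)) (D : Fin p → Module.End ℝ (Fn n M))
      (f' : ℝ → Config n M N m → Fn n M) (C : Fin p → ℝ → Config n M N m → Fn n M),
      (∀ j, D j ∈ diffOps n M) ∧ IsLocal f' ∧ (∀ j, IsLocal (C j)) ∧
      ∀ t c α v, lie f t c α v = α • f' t c + ∑ j, C j t c * D j (comp v (i j)) := by
  obtain ⟨p, i, D, g, hD, hg, h⟩ := hf.exists_repr
  obtain ⟨g₀, hg₀, hgg₀⟩ := hg.exists_fderiv (1, 0)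
  choose g' hg' hgg' using fun j : Fin p => hg.exists_fderiv (0, Pi.single j 1)
  have hloc : ∀ j, IsLocal fun _ (c : Config n M N m) => D j (comp c (i j)) :=
    fun j => isLocal_diffOp_comp (hD j) _
  have hfun : ∀ (t : ℝ) (y : Fin p → Fn n M),
      ContMDiff (𝓡∂ n) 𝓘(ℝ, ℝ × (Fin p → ℝ)) ∞ fun x => (t, fun j => y j x) := fun t y =>
    contMDiff_const.prodMk_space (contMDiff_pi_space.2 fun j => (y j).contMDiff)
  let S : ∀ g : ℝ × (Fin p → ℝ) → Fn n M, SmoothFam (ℝ × (Fin p → ℝ)) g →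
      ℝ → Config n M N m → Fn n M := fun g hg t c =>
    ⟨fun x => g (t, fun j => D j (comp c (i j)) x) x, hg.comp_contMDiff (hfun t _) contMDiff_id⟩
  have hSl : ∀ g hg, IsLocal (S g hg) := fun g hg => IsLocal.compose hloc hg fun _ _ _ => rfl
  refine ⟨p, i, D, S _ hg₀, fun j => S _ (hg' j), hD, hSl _ hg₀, fun j => hSl _ (hg' j),
    fun t c α v => ?_⟩
  refine ddt_eq_of_hasDerivAt (hf.smoothMap.line t c α v) fun x => ?_
  simp only [h]
  have hd := ((hg.contDiff x).differentiable (by simp)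
    (t, fun j => D j (comp c (i j)) x)).hasFDerivAt
  have hcurve : HasDerivAt (fun s : ℝ => (t + s * α, fun j => D j (comp (c + s • v) (i j)) x))
      (α, fun j => D j (comp v (i j)) x) 0 := by
    refine HasDerivAt.prodMk ?_ (hasDerivAt_pi.2 fun j => ?_)
    · simpa using ((hasDerivAt_id (0 : ℝ)).mul_const α).const_add t
    · have : HasDerivAt (fun s : ℝ => D j (comp c (i j)) x + s * D j (comp v (i j)) x)
          (1 * D j (comp v (i j)) x) 0 := ((hasDerivAt_id (0 : ℝ)).mul_const _).const_add _
      refine (this.congr_deriv (one_mul _)).congr_of_eventuallyEq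
        (Filter.Eventually.of_forall fun s => ?_)
      simp only [comp_add, comp_smul, map_add, map_smul]
      rfl
  have hcomp := HasFDerivAt.comp_hasDerivAt_of_eq (0 : ℝ) hd hcurve (by simp)
  refine hcomp.congr_deriv ?_
  have hvec : (α, fun j => D j (comp v (i j)) x) = α • ((1 : ℝ), (0 : Fin p → ℝ)) +
      ∑ j, D j (comp v (i j)) x • ((0 : ℝ), (Pi.single j (1 : ℝ) : Fin p → ℝ)) := by
    ext k
    · simp [Prod.fst_sum]
    · simp [Finset.sum_apply, Prod.snd_sum, Pi.single_apply]
  rw [hvec, map_add, map_smul, map_sum, smul_eq_mul, ← hgg₀]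
  refine congrArg₂ (· + ·) rfl ?_
  refine Eq.trans ?_ (sum_fn_apply _ (fun j => S _ (hg' j) t c * D j (comp v (i j))) x).symm
  refine Finset.sum_congr rfl fun j _ => ?_
  rw [map_smul, ← hgg', smul_eq_mul, mul_comm]
  rfl

/-- The vector field `X` on the space of configurations has local components. -/
def IsLocalField (X : ℝ → Config n M N m → Config n M N m) : Prop :=
  ∀ i, IsLocal fun t c => comp (X t c) i

theorem IsLocalField.isVariation {X : ℝ → Config n M N m → Config n M N m} (hX : IsLocalField X) :
    IsVariation X :=
  isVariation_iff.2 fun i => (hX i).smoothMap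

theorem IsLocal.lie_of_isLocalField {X : ℝ → Config n M N m → Config n M N m} (hf : IsLocal f)
    (α : ℝ) (hX : IsLocalField X) : IsLocal fun t c => lie f t c α (X t c) := by
  obtain ⟨p, i, D, f', C, hD, hf', hC, h⟩ := hf.linearization
  simp only [h]
  exact (hf'.const_smul α).add (IsLocal.sum _ fun j => (hC j).mul ((hX _).diffOp (hD j)))

/-- The finite set of the components `z^A` and `d_t^l λ^a` with `l < L`. -/
def idx (N m L : ℕ) : Finset (Fin N ⊕ (ℕ × Fin m)) :=
  Finset.univ.disjSum (Finset.range L ×ˢ Finset.univ)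

@[simp] theorem inl_mem_idx (L : ℕ) (A : Fin N) : Sum.inl A ∈ idx N m L := by
  simp [idx]

@[simp] theorem inr_mem_idx (L l : ℕ) (a : Fin m) : Sum.inr (l, a) ∈ idx N m L ↔ l < L := by
  simp [idx]

theorem idx_mono {L L' : ℕ} (h : L ≤ L') : idx N m L ⊆ idx N m L' := by
  rintro (A | ⟨l, a⟩) hi
  · simp
  · rw [inr_mem_idx] at *
    omega

theorem exists_mem_idx {κ : Type*} [Fintype κ] (i : κ → Fin N ⊕ (ℕ × Fin m)) :
    ∃ L, ∀ j, i j ∈ idx N m L := by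
  have h : ∀ i : Fin N ⊕ (ℕ × Fin m), ∃ L, i ∈ idx N m L := by
    rintro (A | ⟨l, a⟩)
    · exact ⟨0, by simp⟩
    · exact ⟨l + 1, by simp⟩
  choose L hL using h
  exact ⟨Finset.univ.sup fun j => L (i j), fun j =>
    idx_mono (Finset.le_sup (f := fun j => L (i j)) (Finset.mem_univ j)) (hL (i j))⟩

/-- As a function of the variation of a single field, the derivative of a local function at a given
configuration is a differential operator. -/
theorem IsLocal.exists_diffOp (hf : IsLocal f) (t : ℝ) (c : Config n M N m) (i) :
    ∃ D ∈ diffOps n M, ∀ u, lie f t c 0 (dir i u) = D u := by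
  obtain ⟨p, k, D, f', C, hD, hf', hC, h⟩ := hf.linearization
  refine ⟨∑ j, if k j = i then LinearMap.mulLeft ℝ (C j t c) * D j else 0,
    sum_mem fun j _ => ?_, fun u => ?_⟩
  · split_ifs
    · exact mul_mem (mulLeft_mem_diffOps _) (hD j)
    · exact zero_mem _
  · rw [h, zero_smul, zero_add, LinearMap.sum_apply]
    refine Finset.sum_congr rfl fun j _ => ?_
    rw [comp_dir]
    split_ifs
    · rfl
    · simp

/-- A local function depends on finitely many fields. -/
theorem IsLocal.exists_sum_dir (hf : IsLocal f) : ∃ L₀, ∀ L, L₀ ≤ L → ∀ t c v,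
    lie f t c 0 v = ∑ i ∈ idx N m L, lie f t c 0 (dir i (comp v i)) := by
  obtain ⟨p, k, D, f', C, hD, hf', hC, h⟩ := hf.linearization
  obtain ⟨L₀, hL₀⟩ := exists_mem_idx k
  refine ⟨L₀, fun L hL t c v => ?_⟩
  simp only [h, zero_smul, zero_add]
  rw [Finset.sum_comm]
  refine Finset.sum_congr rfl fun j _ => ?_
  rw [Finset.sum_eq_single_of_mem (k j) (idx_mono hL (hL₀ j)) fun i _ hi => ?_]
  · simp
  · rw [comp_dir_ne hi.symm, map_zero, mul_zero]

theorem IsLocal.flatOn_lie {K : Set M} (hf : IsLocal f) (t : ℝ) (c : Config n M N m)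
    {v : Config n M N m} (hv : ∀ i, FlatOn K (comp v i)) : FlatOn K (lie f t c 0 v) := by
  obtain ⟨p, k, D, f', C, hD, hf', hC, h⟩ := hf.linearization
  rw [h, zero_smul, zero_add]
  exact FlatOn.sum _ fun j _ => ((hv _).diffOp (hD j)).mul_left _

/-- The derivatives of a local function at `x` only depend on the derivatives of the fields
at `x`. -/
theorem IsLocal.flatOn_sub {K : Set M} (hf : IsLocal f) (t : ℝ) {c d : Config n M N m}
    (h : ∀ i, FlatOn K (comp c i - comp d i)) : FlatOn K (f t c - f t d) := by
  have key : ∀ {f : ℝ → Config n M N m → Fn n M}, IsLocal f → ∀ x ∈ K, f t c x = f t d x := by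
    intro f hf x hx
    obtain ⟨p, k, D, g, hD, hg, hfg⟩ := hf.exists_repr
    rw [hfg, hfg]
    congr 2
    refine Prod.ext rfl (funext fun j => ?_)
    have := h (k j) (D j) (hD j) x hx
    rw [map_sub] at this
    exact sub_eq_zero.1 this
  intro D hD x hx
  rw [map_sub]
  exact sub_eq_zero.2 (key (hf.diffOp hD) x hx)

end Linearization

/-! ### Functional derivatives of local functionals -/

section Lie

variable {n : ℕ} [NeZero n] {M : Type*} [TopologicalSpace M]
  [ChartedSpace (EuclideanHalfSpace n) M] [IsManifold (𝓡∂ n) ∞ M] {N m : ℕ}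
  {f g : ℝ → Config n M N m → Fn n M}

theorem SmoothMap.lie_add_fn (hf : SmoothMap f) (hg : SmoothMap g) (t : ℝ) (c : Config n M N m)
    (α : ℝ) (v : Config n M N m) :
    lie (fun t c => f t c + g t c) t c α v = lie f t c α v + lie g t c α v :=
  ddt_add (hf.line t c α v) (hg.line t c α v)

theorem SmoothMap.lie_sub_fn (hf : SmoothMap f) (hg : SmoothMap g) (t : ℝ) (c : Config n M N m)
    (α : ℝ) (v : Config n M N m) :
    lie (fun t c => f t c - g t c) t c α v = lie f t c α v - lie g t c α v :=
  ddt_sub (hf.line t c α v) (hg.line t c α v)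

theorem SmoothMap.lie_const_smul (a : ℝ) (hf : SmoothMap f) (t : ℝ) (c : Config n M N m)
    (α : ℝ) (v : Config n M N m) :
    lie (fun t c => a • f t c) t c α v = a • lie f t c α v :=
  ddt_const_smul a (hf.line t c α v)

theorem SmoothMap.lie_mul (hf : SmoothMap f) (hg : SmoothMap g) (t : ℝ) (c : Config n M N m)
    (α : ℝ) (v : Config n M N m) :
    lie (fun t c => f t c * g t c) t c α v = lie f t c α v * g t c + f t c * lie g t c α v := by
  simpa [lie] using ddt_mul (hf.line t c α v) (hg.line t c α v)

theorem SmoothMap.lie_sum {κ : Type*} {f : κ → ℝ → Config n M N m → Fn n M} (s : Finset κ)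
    (hf : ∀ k, SmoothMap (f k)) (t : ℝ) (c : Config n M N m) (α : ℝ) (v : Config n M N m) :
    lie (fun t c => ∑ k ∈ s, f k t c) t c α v = ∑ k ∈ s, lie (f k) t c α v :=
  ddt_sum s fun k => (hf k).line t c α v

theorem lie_const (u : Fn n M) (t : ℝ) (c : Config n M N m) (α : ℝ) (v : Config n M N m) :
    lie (fun _ _ => u) t c α v = 0 :=
  ddt_const u

theorem SmoothMap.lie_diffOp {D : Module.End ℝ (Fn n M)} (hD : D ∈ diffOps n M) (hf : SmoothMap f)
    (t : ℝ) (c : Config n M N m) (α : ℝ) (v : Config n M N m) :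
    lie (fun t c => D (f t c)) t c α v = D (lie f t c α v) :=
  ddt_diffOp hD (hf.line t c α v)

theorem lieC_const (v : Config n M N m) (t : ℝ) (c : Config n M N m) (α : ℝ)
    (w : Config n M N m) : lieC (fun _ _ => v) t c α w = 0 :=
  config_ext fun _ => by simp [lie_const]

end Lie

section FuncDeriv

variable {n : ℕ} [NeZero n] {M : Type*} [TopologicalSpace M] [T2Space M] [CompactSpace M]
  [ChartedSpace (EuclideanHalfSpace n) M] [IsManifold (𝓡∂ n) ∞ M] [MeasurableSpace M]
  [BorelSpace M] {N m : ℕ} {μ ν : Measure M} [IsFiniteMeasure μ] [IsFiniteMeasure ν]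

theorem integ_eq_zero_of_boundary (hν : ν ((𝓡∂ n).interior M) = 0) {u : Fn n M}
    (hu : ∀ x ∈ (𝓡∂ n).boundary M, u x = 0) : integ ν u = 0 := by
  refine integral_eq_zero_of_ae ?_
  refine measure_mono_null (fun x hx => ?_) hν
  by_contra h
  rw [← Set.mem_compl_iff, ModelWithCorners.compl_interior] at h
  exact hx (hu x h)

theorem IsLocal.exists_adjoint_lie {f : ℝ → Config n M N m → Fn n M} (hμ : IsVolume (n := n) μ)
    (hf : IsLocal f) (t : ℝ) (c : Config n M N m) (i) : ∃ A ∈ diffOps n M, ∀ e u : Fn n M,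
      (FlatOn ((𝓡∂ n).boundary M) e ∨ FlatOn ((𝓡∂ n).boundary M) u) →
      integ μ (e * lie f t c 0 (dir i u)) = integ μ (A e * u) := by
  obtain ⟨D, hD, h⟩ := hf.exists_diffOp t c i
  obtain ⟨A, hA, hAD⟩ := exists_adjoint hμ hD
  exact ⟨A, hA, fun e u heu => by rw [h, hAD e u heu]⟩

variable (μ ν) in
/-- `F = ∫ f dμ + ∫ k dν` with local functions `f` and `k`. -/
def IsLocalFnl (F : ℝ → Config n M N m → ℝ) : Prop :=
  ∃ f k : ℝ → Config n M N m → Fn n M, IsLocal f ∧ IsLocal k ∧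
    ∀ t c, F t c = integ μ (f t c) + integ ν (k t c)

variable {F G : ℝ → Config n M N m → ℝ}

theorem IsLocalFnl.smoothFnl (hF : IsLocalFnl μ ν F) : SmoothFnl μ ν F := by
  obtain ⟨f, k, hf, hk, h⟩ := hF
  exact ⟨f, k, hf.smoothMap, hk.smoothMap, h⟩

theorem isLocalFnl_integ {f : ℝ → Config n M N m → Fn n M} (hf : IsLocal f) :
    IsLocalFnl μ ν fun t c => integ μ (f t c) :=
  ⟨f, fun _ _ => 0, hf, isLocal_const 0, fun t c => by simp⟩

theorem isLocalFnl_integ_boundary {f : ℝ → Config n M N m → Fn n M} (hf : IsLocal f) :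
    IsLocalFnl μ ν fun t c => integ ν (f t c) :=
  ⟨fun _ _ => 0, f, isLocal_const 0, hf, fun t c => by simp⟩

theorem IsLocalFnl.add (hF : IsLocalFnl μ ν F) (hG : IsLocalFnl μ ν G) :
    IsLocalFnl μ ν fun t c => F t c + G t c := by
  obtain ⟨f, k, hf, hk, h⟩ := hF
  obtain ⟨f', k', hf', hk', h'⟩ := hG
  refine ⟨_, _, hf.add hf', hk.add hk', fun t c => ?_⟩
  simp only [h, h', map_add]
  ring

theorem IsLocalFnl.const_smul (a : ℝ) (hF : IsLocalFnl μ ν F) :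
    IsLocalFnl μ ν fun t c => a * F t c := by
  obtain ⟨f, k, hf, hk, h⟩ := hF
  refine ⟨_, _, hf.const_smul a, hk.const_smul a, fun t c => ?_⟩
  simp only [h, map_smul, smul_eq_mul]
  ring

theorem IsLocalFnl.sub (hF : IsLocalFnl μ ν F) (hG : IsLocalFnl μ ν G) :
    IsLocalFnl μ ν fun t c => F t c - G t c := by
  simpa [sub_eq_add_neg] using hF.add (hG.const_smul (-1))

theorem IsLocalFnl.lieF_of_isLocalField {X : ℝ → Config n M N m → Config n M N m}
    (hF : IsLocalFnl μ ν F) (α : ℝ) (hX : IsLocalField X) :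
    IsLocalFnl μ ν fun t c => lieF F t c α (X t c) := by
  obtain ⟨f, k, hf, hk, h⟩ := hF
  exact ⟨_, _, hf.lie_of_isLocalField α hX, hk.lie_of_isLocalField α hX,
    fun t c => lieF_eq_integ hf.smoothMap hk.smoothMap h t c α _⟩

variable (μ) in
/-- The functional derivative of `F` with respect to the component `i` of the configuration, which
treats `z^A` and the derivatives of `λ^a` uniformly. -/
def el (F : ℝ → Config n M N m → ℝ) (i : Fin N ⊕ (ℕ × Fin m)) : ℝ → Config n M N m → Fn n M :=
  funcDeriv μ F (dir i)

/-- The functional derivative is unique. -/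
theorem el_eq (hμ : IsVolume (n := n) μ) (hF : SmoothFnl μ ν F) {i} {t : ℝ} {c : Config n M N m}
    {e : Fn n M} (h : ∀ u : Fn n M, FlatOn ((𝓡∂ n).boundary M) u →
      lieF F t c 0 (dir i u) = integ μ (e * u)) : el μ F i t c = e := by
  have hder : ∀ u : Fn n M, HasDerivAt (fun s : ℝ => F t (c + s • dir i u))
      (lieF F t c 0 (dir i u)) 0 := fun u => by
    simpa using hF.hasDerivAt_line t c 0 (dir i u)
  have hex : ∃ e : Fn n M, ∀ u : Fn n M, tsupport u ⊆ (𝓡∂ n).interior M →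
      HasDerivAt (fun s : ℝ => F t (c + s • dir i u)) (∫ x, e x * u x ∂μ) 0 := by
    refine ⟨e, fun u hu => (hder u).congr_deriv ?_⟩
    exact h u (flatOn_boundary_of_tsupport hu)
  have hdef : el μ F i t c = hex.choose := by
    rw [el, funcDeriv, dif_pos hex]
  rw [← sub_eq_zero]
  refine eq_zero_of_integral_eq_zero hμ fun u hu => ?_
  have h1 := (hex.choose_spec u hu).unique (hder u)
  rw [h u (flatOn_boundary_of_tsupport hu), ← hdef] at h1
  rw [sub_mul, map_sub, sub_eq_zero]
  exact h1

/-- A local functional has local functional derivatives, only finitely many of which do not vanish.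
They describe its variation under all variations of the fields that are flat on the boundary. -/
theorem IsLocalFnl.exists_el (hμ : IsVolume (n := n) μ) (hν : ν ((𝓡∂ n).interior M) = 0)
    (hF : IsLocalFnl μ ν F) : (∀ i, IsLocal (el μ F i)) ∧ ∃ L₀,
      (∀ i ∉ idx N m L₀, ∀ t c, el μ F i t c = 0) ∧ ∀ t c v,
        (∀ i, FlatOn ((𝓡∂ n).boundary M) (comp v i)) →
        lieF F t c 0 v = ∑ i ∈ idx N m L₀, integ μ (el μ F i t c * comp v i) := by
  have hFs := hF.smoothFnl
  obtain ⟨f, k, hf, hk, h⟩ := hF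
  obtain ⟨p, κ, D, f', C, hD, hf', hC, hlin⟩ := hf.linearization
  choose D' hD' hadj using fun j => exists_adjoint hμ (hD j)
  obtain ⟨L₀, hL₀⟩ := exists_mem_idx κ
  let e : (Fin N ⊕ (ℕ × Fin m)) → ℝ → Config n M N m → Fn n M := fun i t c =>
    ∑ j, if κ j = i then D' j (C j t c) else 0
  have hmain : ∀ t c v, (∀ i, FlatOn ((𝓡∂ n).boundary M) (comp v i)) →
      lieF F t c 0 v = ∑ j, integ μ (D' j (C j t c) * comp v (κ j)) := by
    intro t c v hv
    rw [lieF_eq_integ hf.smoothMap hk.smoothMap h, hlin, zero_smul, zero_add, map_sum,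
      integ_eq_zero_of_boundary hν fun x hx => (hk.flatOn_lie t c hv).apply hx, add_zero]
    exact Finset.sum_congr rfl fun j _ => hadj j _ _ (Or.inr (hv _))
  have hel : ∀ i t c, el μ F i t c = e i t c := by
    intro i t c
    refine el_eq hμ hFs fun u hu => ?_
    have hdir : ∀ k, FlatOn ((𝓡∂ n).boundary M) (comp (dir i u : Config n M N m) k) := fun k => by
      rw [comp_dir]
      split_ifs
      · exact hu
      · exact FlatOn.zero
    rw [hmain t c _ hdir, Finset.sum_mul, map_sum]
    refine Finset.sum_congr rfl fun j _ => ?_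
    rw [comp_dir]
    split_ifs <;> simp
  refine ⟨fun i => ?_, L₀, fun i hi t c => ?_, fun t c v hv => ?_⟩
  · have : el μ F i = e i := by funext t c; exact hel i t c
    rw [this]
    refine IsLocal.sum _ fun j => ?_
    split_ifs
    · exact (hC j).diffOp (hD' j)
    · exact isLocal_const 0
  · rw [hel]
    refine Finset.sum_eq_zero fun j _ => if_neg ?_
    rintro rfl
    exact hi (hL₀ j)
  · simp only [hel, hmain t c v hv, e, Finset.sum_mul, map_sum]
    rw [Finset.sum_comm]
    refine Finset.sum_congr rfl fun j _ => ?_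
    rw [Finset.sum_eq_single_of_mem (κ j) (hL₀ j) fun i _ hi => ?_]
    · rw [if_pos rfl]
    · rw [if_neg hi.symm, zero_mul, map_zero]

theorem IsLocalFnl.isLocal_el (hμ : IsVolume (n := n) μ) (hν : ν ((𝓡∂ n).interior M) = 0)
    (hF : IsLocalFnl μ ν F) (i) : IsLocal (el μ F i) :=
  (hF.exists_el hμ hν).1 i

theorem flatOn_comp_dir {K : Set M} {u : Fn n M} (hu : FlatOn K u) (i k) :
    FlatOn K (comp (dir i u : Config n M N m) k) := by
  rw [comp_dir]
  split_ifs
  · exact hu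
  · exact FlatOn.zero

theorem IsLocalFnl.exists_el_sum (hμ : IsVolume (n := n) μ) (hν : ν ((𝓡∂ n).interior M) = 0)
    (hF : IsLocalFnl μ ν F) : ∃ L₀, ∀ L, L₀ ≤ L →
      (∀ i ∉ idx N m L, ∀ t c, el μ F i t c = 0) ∧ ∀ t c v,
        (∀ i, FlatOn ((𝓡∂ n).boundary M) (comp v i)) →
        lieF F t c 0 v = ∑ i ∈ idx N m L, integ μ (el μ F i t c * comp v i) := by
  obtain ⟨-, L₀, h0, h⟩ := hF.exists_el hμ hν
  refine ⟨L₀, fun L hL => ⟨fun i hi => h0 i fun h' => hi (idx_mono hL h'), fun t c v hv => ?_⟩⟩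
  rw [h t c v hv]
  refine Finset.sum_subset (idx_mono hL) fun i _ hi => ?_
  rw [h0 i hi, zero_mul, map_zero]

theorem IsLocalFnl.lieF_dir (hμ : IsVolume (n := n) μ) (hν : ν ((𝓡∂ n).interior M) = 0)
    (hF : IsLocalFnl μ ν F) (t : ℝ) (c : Config n M N m) (i) {u : Fn n M}
    (hu : FlatOn ((𝓡∂ n).boundary M) u) :
    lieF F t c 0 (dir i u) = integ μ (el μ F i t c * u) := by
  obtain ⟨-, L₀, h0, h⟩ := hF.exists_el hμ hν
  rw [h t c _ (flatOn_comp_dir hu i)]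
  by_cases hi : i ∈ idx N m L₀
  · rw [Finset.sum_eq_single_of_mem i hi fun k _ hk => ?_]
    · simp
    · rw [comp_dir_ne hk, mul_zero, map_zero]
  · rw [h0 i hi, zero_mul, map_zero]
    refine Finset.sum_eq_zero fun k hk => ?_
    rw [comp_dir_ne (ne_of_mem_of_not_mem hk hi), mul_zero, map_zero]

/-- The second variation of a local functional, along a local vector field and along a variation
of a single field that is flat on the boundary. -/
theorem IsLocalFnl.exists_lieF_lieF (hμ : IsVolume (n := n) μ)
    (hν : ν ((𝓡∂ n).interior M) = 0) (hF : IsLocalFnl μ ν F) : ∃ L₀, ∀ L, L₀ ≤ L →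
    ∀ {X : ℝ → Config n M N m → Config n M N m} (_ : IsLocalField X) (α t : ℝ)
      (c : Config n M N m) (i) {u : Fn n M} (_ : FlatOn ((𝓡∂ n).boundary M) u),
      lieF (fun t c => lieF F t c α (X t c)) t c 0 (dir i u) =
        integ μ (lie (el μ F i) t c α (X t c) * u) + ∑ k ∈ idx N m L,
          integ μ (el μ F k t c * lie (fun t c => comp (X t c) k) t c 0 (dir i u)) := by
  obtain ⟨L₀, hL₀⟩ := hF.exists_el_sum hμ hν
  refine ⟨L₀, fun L hL X hX α t c i u hu => ?_⟩
  have hFs := hF.smoothFnl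
  have h1 := hFs.lieF_lieF_sub hX.isVariation (isVariation_const (dir i u)) α 0 t c
  have h2 : (fun t c => lieF F t c 0 (dir i u)) =
      fun t c => integ μ (el μ F i t c * u) := by
    funext t c; exact hF.lieF_dir hμ hν t c i hu
  have hs := (hF.isLocal_el hμ hν i).smoothMap
  rw [h2, lieF_integ (hs.mul (smoothMap_const u)), hs.lie_mul (smoothMap_const u), lie_const,
    mul_zero, add_zero] at h1
  have h3 : brk α X 0 (fun _ _ => dir i u) t c = (-1 : ℝ) • lieC X t c 0 (dir i u) := by
    rw [brk, lieC_const]; simp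
  have h4 := hFs.lieF_smul t c (-1) 0 (lieC X t c 0 (dir i u))
  rw [mul_zero, ← h3, ← h1, (hL₀ L hL).2 t c _ fun k => ?_] at h4
  · simp only [comp_lieC] at h4
    linarith
  · rw [comp_lieC]
    exact (hX k).flatOn_lie t c (flatOn_comp_dir hu i)

end FuncDeriv

/-! ### The time evolution and tangent vectors of the constraint surfaces -/

theorem sum_idx {N m : ℕ} {A : Type*} [AddCommMonoid A] (L : ℕ)
    (f : Fin N ⊕ (ℕ × Fin m) → A) : ∑ i ∈ idx N m L, f i =
      ∑ A, f (Sum.inl A) + ∑ l ∈ Finset.range L, ∑ a, f (Sum.inr (l, a)) := by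
  rw [idx, Finset.sum_disjSum, Finset.sum_product]

section

variable {n : ℕ} [NeZero n] {M : Type*} [TopologicalSpace M]
  [ChartedSpace (EuclideanHalfSpace n) M] [IsManifold (𝓡∂ n) ∞ M] {N m : ℕ}

theorem lie_eq_zero_of_const {f : ℝ → Config n M N m → Fn n M} {t : ℝ} {c v : Config n M N m}
    (h : ∀ s : ℝ, f t (c + s • v) = f t c) : lie f t c 0 v = 0 := by
  simp [lie, h, ddt_const]

end

namespace Theory

variable {n : ℕ} [NeZero n] {M : Type*} [TopologicalSpace M] [T2Space M] [CompactSpace M]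
  [ChartedSpace (EuclideanHalfSpace n) M] [IsManifold (𝓡∂ n) ∞ M] [MeasurableSpace M]
  [BorelSpace M] {N m r : ℕ} {T : Theory n M N m r}

theorem dz_eq_el (F : ℝ → Config n M N m → ℝ) (A : Fin N) : T.dz F A = el T.μ F (Sum.inl A) := by
  rw [dz, zDir_eq_dir, el]

theorem dl_eq_el (F : ℝ → Config n M N m → ℝ) (l : ℕ) (a : Fin m) :
    T.dl F l a = el T.μ F (Sum.inr (l, a)) := by
  rw [dl, lDir_eq_dir, el]

theorem Z_apply (F : ℝ → Config n M N m → ℝ) (t : ℝ) (c : Config n M N m) (A : Fin N) :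
    T.Z F t c A = ∑ B, T.σ A B • el T.μ F (Sum.inl B) t c := by
  simp only [Z, dz_eq_el]

/-- The antisymmetric form defined by the matrix `σ`. -/
theorem sum_sigma_antisymm (hσ : T.σ.transpose = -T.σ) (a b : Fin N → Fn n M) :
    ∑ A, a A * ∑ B, T.σ A B • b B = -∑ A, b A * ∑ B, T.σ A B • a B := by
  have h : ∀ A B, T.σ B A = -T.σ A B := fun A B => congrFun (congrFun hσ A) B
  simp only [Finset.mul_sum]
  rw [Finset.sum_comm, ← Finset.sum_neg_distrib]
  refine Finset.sum_congr rfl fun B _ => ?_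
  rw [← Finset.sum_neg_distrib]
  refine Finset.sum_congr rfl fun A _ => ?_
  rw [h B A, mul_smul_comm, mul_smul_comm, neg_smul, mul_comm]

variable (T) in
/-- The constraints vanish on `K` together with all their derivatives. -/
def ConstraintOn (K : Set M) (c : Config n M N m) : Prop :=
  ∀ a, FlatOn K (T.φ a c.1)

variable (T) in
/-- The vector `v` solves the linearisation at `c` of the condition `ConstraintOn K`. -/
def TangentOn (K : Set M) (t : ℝ) (c v : Config n M N m) : Prop :=
  ∀ a, FlatOn K (lie (T.phi a) t c 0 v)

theorem ConstraintOn.mono {K K' : Set M} (h : K' ⊆ K) {c : Config n M N m}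
    (hc : T.ConstraintOn K c) : T.ConstraintOn K' c :=
  fun a => (hc a).mono h

/-- Adding variations that are flat on `K` does not change the constraints on `K`. -/
theorem ConstraintOn.of_flat {K : Set M} (hT : T.Admissible) {c d : Config n M N m}
    (hc : T.ConstraintOn K c) (h : ∀ i, FlatOn K (comp d i - comp c i)) : T.ConstraintOn K d := by
  intro a
  have h1 := (hT.local_phi a).flatOn_sub 0 h
  have h2 := h1.add (hc a)
  simpa [phi] using h2

/-- Regularity for configurations: the constraints do not involve the multipliers, which move along
a straight line. -/
theorem RegularOn.exists_curve {K : Set M} (hK : T.RegularOn K) {t : ℝ} {c v : Config n M N m}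
    (hc : T.ConstraintOn K c) (hv : T.TangentOn K t c v) : ∃ γ : ℝ → Config n M N m,
      SmoothCfg ℝ γ ∧ γ 0 = c ∧ (ofComp fun i => ddt fun s => comp (γ s) i) = v ∧
        ∀ s, T.ConstraintOn K (γ s) := by
  have hv' : ∀ a, FlatOn K (vary (T.phi a) 0 (c.1, 0) (v.1, 0)) := fun a => by
    have : vary (T.phi a) 0 (c.1, 0) (v.1, 0) = lie (T.phi a) t c 0 v := rfl
    rw [this]; exact hv a
  obtain ⟨γ, hγ, h0, hder, hγK⟩ := hK c.1 v.1 hc hv'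
  have hline := SmoothCfg.line c v
  have hs : SmoothCfg ℝ fun s => ((γ s, c.2 + s • v.2) : Config n M N m) := by
    rintro (A | ⟨l, a⟩)
    · exact hγ A
    · exact hline (Sum.inr (l, a))
  refine ⟨fun s => (γ s, c.2 + s • v.2), hs, ?_, ?_, fun s => hγK s⟩
  · simp [h0]
  · refine config_ext fun i => ?_
    rw [comp_ofComp]
    refine ddt_eq_of_hasDerivAt (hs i) fun x => ?_
    rcases i with A | ⟨l, a⟩
    · exact hder A x
    · have := (hline (Sum.inr (l, a))).hasDerivAt x
      have h2 := lie_comp 0 c 0 v (Sum.inr (l, a))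
      simp only [lie] at h2
      rw [h2] at this
      exact this

variable {K : Set M} {f : ℝ → Config n M N m → Fn n M} {t : ℝ} {c v : Config n M N m}

/-- The derivative along a tangent vector of a function that vanishes on a constraint surface. -/
theorem RegularOn.lie_eq_zero (hK : T.RegularOn K) (hf : SmoothMap f) {x : M}
    (h : ∀ t c, T.ConstraintOn K c → f t c x = 0) (hc : T.ConstraintOn K c)
    (hv : T.TangentOn K t c v) (α : ℝ) : lie f t c α v x = 0 := by
  obtain ⟨γ, hγ, rfl, rfl, hγK⟩ := hK.exists_curve hc hv
  rw [← hf.ddt_comp hγ]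
  have h1 := (hf.apply (τ := fun s => t + s * α) (by fun_prop) hγ).hasDerivAt x
  simp only [h _ _ (hγK _)] at h1
  exact h1.unique (hasDerivAt_const _ _)

theorem RegularOn.flatOn_lie (hK : T.RegularOn K) (hf : SmoothMap f) {K' : Set M}
    (h : ∀ t c, T.ConstraintOn K c → FlatOn K' (f t c)) (hc : T.ConstraintOn K c)
    (hv : T.TangentOn K t c v) (α : ℝ) : FlatOn K' (lie f t c α v) := by
  intro D hD x hx
  rw [← hf.lie_diffOp hD]
  exact hK.lie_eq_zero (hf.diffOp hD) (fun t c hc => h t c hc D hD x hx) hc hv α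

theorem RegularOn.lieF_eq_zero {μ ν : Measure M} [IsFiniteMeasure μ] [IsFiniteMeasure ν]
    (hK : T.RegularOn K) {F : ℝ → Config n M N m → ℝ}
    (hF : SmoothFnl μ ν F) (h : ∀ t c, T.ConstraintOn K c → F t c = 0) (hc : T.ConstraintOn K c)
    (hv : T.TangentOn K t c v) (α : ℝ) : lieF F t c α v = 0 := by
  obtain ⟨γ, hγ, rfl, rfl, hγK⟩ := hK.exists_curve hc hv
  have h1 := hF.hasDerivAt_comp hγ t α
  simp only [h _ _ (hγK _)] at h1
  exact h1.unique (hasDerivAt_const _ _)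

variable (T) in
/-- The vector field of the time evolution on the space of configurations. -/
def evol (t : ℝ) (c : Config n M N m) : Config n M N m :=
  evolution c (T.Z T.H t c)

@[simp] theorem comp_evol_inl (t : ℝ) (c : Config n M N m) (A : Fin N) :
    comp (T.evol t c) (Sum.inl A) = T.Z T.H t c A := rfl

@[simp] theorem comp_evol_inr (t : ℝ) (c : Config n M N m) (l : ℕ) (a : Fin m) :
    comp (T.evol t c) (Sum.inr (l, a)) = comp c (Sum.inr (l + 1, a)) := rfl

theorem deltaT_eq_lie (f : ℝ → Config n M N m → Fn n M) :
    T.deltaT f = fun t c => lie f t c 1 (T.evol t c) := by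
  funext t c
  rw [deltaT, timeDeriv_eq_lie]; rfl

variable [IsFiniteMeasure T.μ] [IsFiniteMeasure T.ν]

variable {F G : ℝ → Config n M N m → ℝ}

theorem isLocal_Z (hT : T.Admissible) (hF : IsLocalFnl T.μ T.ν F) (A : Fin N) :
    IsLocal fun t c => T.Z F t c A := by
  simp only [Z_apply]
  exact IsLocal.sum _ fun B =>
    (hF.isLocal_el hT.volume hT.boundary_carried _).const_smul _

theorem integral_lambda_phi (t : ℝ) (c : Config n M N m) :
    ∫ x, ∑ a, c.2 0 a x * T.φ a c.1 x ∂T.μ =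
      integ T.μ (∑ a, comp c (Sum.inr (0, a)) * T.phi a t c) := by
  refine integral_congr_ae (Filter.Eventually.of_forall fun x => ?_)
  exact (sum_fn_apply _ (fun a => comp c (Sum.inr (0, a)) * T.phi a t c) x).symm

theorem H_eq_integ (t : ℝ) (c : Config n M N m) :
    T.H t c = integ T.μ (T.h c.1 + ∑ a, comp c (Sum.inr (0, a)) * T.phi a t c) +
      integ T.ν (T.bH c.1 (c.2 0)) := by
  refine congrArg₂ (· + ·) (integral_congr_ae (Filter.Eventually.of_forall fun x => ?_)) rfl
  refine congrArg (T.h c.1 x + ·) ?_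
  exact (sum_fn_apply _ (fun a => comp c (Sum.inr (0, a)) * T.phi a t c) x).symm

theorem isLocal_lambda_phi (hT : T.Admissible) (a : Fin m) :
    IsLocal fun t (c : Config n M N m) => comp c (Sum.inr (0, a)) * T.phi a t c :=
  (isLocal_comp _).mul (hT.local_phi a)

theorem isLocalFnl_H (hT : T.Admissible) : IsLocalFnl T.μ T.ν T.H :=
  ⟨fun t c => T.h c.1 + ∑ a, comp c (Sum.inr (0, a)) * T.phi a t c,
    fun _ c => T.bH c.1 (c.2 0), hT.local_h.add (IsLocal.sum _ (isLocal_lambda_phi hT)),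
    hT.local_bH, H_eq_integ⟩

theorem isLocalField_evol (hT : T.Admissible) : IsLocalField T.evol := by
  rintro (A | ⟨l, a⟩)
  · exact isLocal_Z hT (isLocalFnl_H hT) A
  · exact isLocal_comp (Sum.inr (l + 1, a))

theorem isLocal_deltaT (hT : T.Admissible) (hf : IsLocal f) : IsLocal (T.deltaT f) := by
  rw [deltaT_eq_lie]
  exact hf.lie_of_isLocalField 1 (isLocalField_evol hT)

theorem isLocal_deltaT_iterate (hT : T.Admissible) (hf : IsLocal f) (k : ℕ) :
    IsLocal (T.deltaT^[k] f) := by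
  induction k generalizing f with
  | zero => exact hf
  | succ k ih => exact ih (isLocal_deltaT hT hf)

theorem isLocalField_tilde (hT : T.Admissible) {G : Couple n M N m}
    (hG : IsLocalFnl T.μ T.ν G.1) (hΛ : ∀ a, IsLocal fun t c => G.2 t c a) :
    IsLocalField (T.tilde G) := by
  rintro (A | ⟨l, a⟩)
  · exact isLocal_Z hT hG A
  · exact isLocal_deltaT_iterate hT (hΛ a) l

/-- The multipliers `λ^a` occur in the Hamiltonian only through `λ^a φ_a`. -/
theorem el_H_inr (hT : T.Admissible) (t : ℝ) (c : Config n M N m) (l : ℕ) (a : Fin m) :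
    el T.μ T.H (Sum.inr (l, a)) t c = if l = 0 then T.phi a t c else 0 := by
  refine el_eq hT.volume (isLocalFnl_H hT).smoothFnl fun u hu => ?_
  have hl := fun a => (isLocal_lambda_phi hT a).smoothMap
  have hd := hT.local_h.add (IsLocal.sum Finset.univ (isLocal_lambda_phi hT))
  have hz : (dir (Sum.inr (l, a)) u : Config n M N m).1 = 0 := by
    funext A
    exact comp_dir_ne (i := Sum.inr (l, a)) (j := Sum.inl A) (by simp) u
  have hφ : ∀ b, lie (T.phi b) t c 0 (dir (Sum.inr (l, a)) u) = 0 := fun b =>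
    lie_eq_zero_of_const fun s => by
      simp only [phi, Prod.fst_add, Prod.smul_fst, hz, smul_zero, add_zero]
  have hh : lie (fun _ (c : Config n M N m) => T.h c.1) t c 0 (dir (Sum.inr (l, a)) u) = 0 :=
    lie_eq_zero_of_const fun s => by
      simp only [Prod.fst_add, Prod.smul_fst, hz, smul_zero, add_zero]
  rw [lieF_eq_integ hd.smoothMap hT.local_bH.smoothMap H_eq_integ,
    integ_eq_zero_of_boundary hT.boundary_carried
      fun x hx => (hT.local_bH.flatOn_lie t c (flatOn_comp_dir hu _)).apply hx, add_zero,
    hT.local_h.smoothMap.lie_add_fn (SmoothMap.sum _ hl), hh, zero_add, SmoothMap.lie_sum _ hl]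
  congr 1
  simp only [(smoothMap_comp _).lie_mul (hT.local_phi _).smoothMap, hφ, lie_comp, mul_zero,
    add_zero, comp_dir]
  by_cases h0 : l = 0
  · subst h0
    rw [Finset.sum_eq_single a]
    · simp [mul_comm]
    · intro b _ hb
      simp [hb]
    · simp
  · rw [if_neg h0, zero_mul]
    refine Finset.sum_eq_zero fun b _ => ?_
    rw [if_neg (by simp [Ne.symm h0]), zero_mul]

/-- The time evolution is tangent to the constraint surfaces. -/
theorem tangentOn_evol (hT : T.Admissible) (hc : T.ConstraintOn K c) :
    T.TangentOn K t c (T.evol t c) := by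
  -- By the first-class property, the brackets of the constraints with the two parts of the
  -- Hamiltonian are combinations of the constraints; the boundary term has no bulk derivative.
  have hcomb : ∀ {f : ℝ → Config n M N m → Fn n M}, T.IsCombination f → FlatOn K (f t c) := by
    rintro f ⟨q, a, D, C, hD, h⟩
    rw [h]
    exact FlatOn.sum _ fun j _ => ((hc (a j)).diffOp (hD j).1).mul_left _
  have hh : IsLocalFnl T.μ T.ν fun _ (c : Config n M N m) => ∫ x, T.h c.1 x ∂T.μ :=
    isLocalFnl_integ hT.local_h
  have hlam : IsLocalFnl T.μ T.ν
      fun _ (c : Config n M N m) => ∫ x, ∑ a, c.2 0 a x * T.φ a c.1 x ∂T.μ := by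
    simp only [integral_lambda_phi 0]
    exact isLocalFnl_integ (IsLocal.sum _ (isLocal_lambda_phi hT))
  have hb : IsLocalFnl T.μ T.ν fun _ (c : Config n M N m) => integ T.ν (T.bH c.1 (c.2 0)) :=
    isLocalFnl_integ_boundary hT.local_bH
  have hHsum : T.H = fun t c => (∫ x, T.h c.1 x ∂T.μ +
      ∫ x, ∑ a, c.2 0 a x * T.φ a c.1 x ∂T.μ) + integ T.ν (T.bH c.1 (c.2 0)) := by
    funext t c
    rw [integral_lambda_phi t c, H_eq_integ, map_add]
    rfl
  have hel : ∀ A, el T.μ T.H (Sum.inl A) t c =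
      el T.μ (fun _ c => ∫ x, T.h c.1 x ∂T.μ) (Sum.inl A) t c +
      el T.μ (fun _ c => ∫ x, ∑ a, c.2 0 a x * T.φ a c.1 x ∂T.μ) (Sum.inl A) t c := by
    intro A
    refine el_eq hT.volume (isLocalFnl_H hT).smoothFnl fun u hu => ?_
    rw [hHsum, (hh.add hlam).smoothFnl.lieF_add_fnl hb.smoothFnl,
      hh.smoothFnl.lieF_add_fnl hlam.smoothFnl,
      hh.lieF_dir hT.volume hT.boundary_carried _ _ _ hu,
      hlam.lieF_dir hT.volume hT.boundary_carried _ _ _ hu,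
      hb.lieF_dir hT.volume hT.boundary_carried _ _ _ hu, add_mul, map_add]
    have : el T.μ (fun _ (c : Config n M N m) => integ T.ν (T.bH c.1 (c.2 0)))
        (Sum.inl A) t c = 0 := by
      refine el_eq hT.volume hb.smoothFnl fun u hu => ?_
      rw [lieF_integ hT.local_bH.smoothMap, integ_eq_zero_of_boundary hT.boundary_carried
        fun x hx => (hT.local_bH.flatOn_lie t c (flatOn_comp_dir hu _)).apply hx]
      simp
    rw [this]; simp
  intro b
  have h1 := hcomb (hT.first_class b).1
  have h2 := hcomb (hT.first_class b).2
  simp only [vary_eq_lie] at h1 h2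
  have h3 := (hT.local_phi b).smoothMap.lie_add t c 0 0
    (T.Z (fun _ c => ∫ x, T.h c.1 x ∂T.μ) t c, 0)
    (T.Z (fun _ c => ∫ x, ∑ a, c.2 0 a x * T.φ a c.1 x ∂T.μ) t c, 0)
  rw [add_zero] at h3
  have h4 : lie (T.phi b) t c 0 (T.evol t c) = lie (T.phi b) t c 0 (T.Z T.H t c, 0) := rfl
  have h5 : ((T.Z T.H t c, 0) : Config n M N m) =
      (T.Z (fun _ c => ∫ x, T.h c.1 x ∂T.μ) t c, 0) +
      (T.Z (fun _ c => ∫ x, ∑ a, c.2 0 a x * T.φ a c.1 x ∂T.μ) t c, 0) := by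
    refine Prod.ext (funext fun A => ?_) (by simp)
    simp only [Prod.fst_add, Pi.add_apply, Z_apply, hel, smul_add, Finset.sum_add_distrib]
  rw [h4, h5, h3]
  exact h1.add h2

end Theory

/-! ### The Noether identities of a symmetry -/

namespace Theory

variable {n : ℕ} [NeZero n] {M : Type*} [TopologicalSpace M] [T2Space M] [CompactSpace M]
  [ChartedSpace (EuclideanHalfSpace n) M] [IsManifold (𝓡∂ n) ∞ M] [MeasurableSpace M]
  [BorelSpace M] {N m r : ℕ} {T : Theory n M N m r} [IsFiniteMeasure T.μ] [IsFiniteMeasure T.ν]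

variable (T) in
/-- The Hamiltonian form of the invariance of the action: at the configurations that obey the
external boundary conditions, `δ_t G - {G, H} - δ_G H` is the boundary term `∮ V`. -/
structure IsNoether (G : Couple n M N m) (V : ℝ → Config n M N m → Fn n M) : Prop where
  local_functional : IsLocalFnl T.μ T.ν G.1
  local_multiplier : ∀ a, IsLocal fun t c => G.2 t c a
  local_term : IsLocal V
  identity : ∀ t c, T.ConstraintOn ((𝓡∂ n).boundary M) c →
    lieF G.1 t c 1 (T.evol t c) - integ T.μ (∑ A, el T.μ G.1 (Sum.inl A) t c * T.Z T.H t c A) -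
      lieF T.H t c 0 (T.tilde G t c) = integ T.ν (V t c)

/-- The family `g` with the index of the time derivatives of the multipliers shifted by one. -/
def shift (g : Fin N ⊕ (ℕ × Fin m) → Fn n M) : Fin N ⊕ (ℕ × Fin m) → Fn n M
  | Sum.inl _ => 0
  | Sum.inr (0, _) => 0
  | Sum.inr (l + 1, a) => g (Sum.inr (l, a))

/-- The transposed shift, which comes from `d_t λ^{(l)} = λ^{(l+1)}`. -/
theorem sum_mul_comp_dir_succ {L : ℕ} {g : Fin N ⊕ (ℕ × Fin m) → Fn n M}
    (hg : ∀ i ∉ idx N m L, g i = 0) (i) (u : Fn n M) :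
    ∑ l ∈ Finset.range L, ∑ a, g (Sum.inr (l, a)) *
      comp (dir i u : Config n M N m) (Sum.inr (l + 1, a)) = shift g i * u := by
  rcases i with A | ⟨_ | k, b⟩
  · simp [shift, comp_dir]
  · simp [shift, comp_dir]
  · by_cases hk : k < L
    · rw [Finset.sum_eq_single_of_mem k (Finset.mem_range.2 hk) fun l _ hl => ?_]
      · rw [Finset.sum_eq_single_of_mem b (Finset.mem_univ b) fun a _ ha => ?_]
        · simp [shift]
        · rw [comp_dir_ne (by simp [ha]), mul_zero]
      · refine Finset.sum_eq_zero fun a _ => ?_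
        rw [comp_dir_ne (by simp [hl]), mul_zero]
    · rw [shift, hg _ (by simpa using hk), zero_mul]
      refine Finset.sum_eq_zero fun l hl => Finset.sum_eq_zero fun a _ => ?_
      have : l ≠ k := fun h => hk (h ▸ Finset.mem_range.1 hl)
      rw [comp_dir_ne (by simp [this]), mul_zero]

variable {G : Couple n M N m} {V : ℝ → Config n M N m → Fn n M}

theorem IsNoether.isLocalField (hT : T.Admissible) (hG : T.IsNoether G V) :
    IsLocalField (T.tilde G) :=
  isLocalField_tilde hT hG.local_functional hG.local_multiplier

theorem IsNoether.isLocal_el (hT : T.Admissible) (hG : T.IsNoether G V) (i) :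
    IsLocal (el T.μ G.1 i) :=
  hG.local_functional.isLocal_el hT.volume hT.boundary_carried i

theorem lie_Z (hT : T.Admissible) {F : ℝ → Config n M N m → ℝ} (hF : IsLocalFnl T.μ T.ν F)
    (A : Fin N) (t : ℝ) (c : Config n M N m) (α : ℝ) (v : Config n M N m) :
    lie (fun t c => T.Z F t c A) t c α v =
      ∑ B, T.σ A B • lie (el T.μ F (Sum.inl B)) t c α v := by
  have h := fun B => (hF.isLocal_el hT.volume hT.boundary_carried (Sum.inl B)).smoothMap
  simp only [Z_apply]
  rw [SmoothMap.lie_sum _ fun B => (h B).const_smul _]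
  exact Finset.sum_congr rfl fun B _ => (h B).lie_const_smul _ _ _ _ _

/-- The Noether identities: the functional derivatives of the invariance condition. For `z^A` and
`λ^{(l)a}` they read `δ_t (δG/δz^A) ≈ δ_G (δH/δz^A)` and
`δ_t (δG/δλ^{(l)a}) + δG/δλ^{(l-1)a} ≈ δ_G (δH/δλ^{(l)a})`, up to derivatives of the constraints. -/
theorem IsNoether.el_identity (hT : T.Admissible) (hG : T.IsNoether G V) (i) (t : ℝ)
    {c : Config n M N m} (hc : T.ConstraintOn ((𝓡∂ n).boundary M) c) :
    ∃ A : Fin m → Module.End ℝ (Fn n M), (∀ a, A a ∈ diffOps n M) ∧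
      T.deltaT (el T.μ G.1 i) t c + shift (fun i => el T.μ G.1 i t c) i =
        lie (el T.μ T.H i) t c 0 (T.tilde G t c) + ∑ a, A a (T.phi a t c) := by
  have hμ := hT.volume
  have hν := hT.boundary_carried
  have hH := isLocalFnl_H hT
  have hX := hG.isLocalField hT
  have hE := isLocalField_evol hT
  have hGl := hG.local_functional
  have hGe := fun i => (hG.isLocal_el hT i).smoothMap
  obtain ⟨L₁, h₁⟩ := hGl.exists_lieF_lieF hμ hν
  obtain ⟨L₂, h₂⟩ := hH.exists_lieF_lieF hμ hν
  obtain ⟨L₃, h₃⟩ := hGl.exists_el_sum hμ hν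
  set L := L₁ + L₂ + L₃ + 1 with hL
  choose A hA hAadj using fun a => (hG.local_multiplier a).exists_adjoint_lie hμ t c i
  refine ⟨A, hA, ?_⟩
  rw [← sub_eq_zero]
  refine eq_zero_of_integral_eq_zero hμ fun u hu' => ?_
  have hu := flatOn_boundary_of_tsupport hu'
  have hZs : ∀ B, SmoothMap fun t c => T.Z T.H t c B := fun B => (isLocal_Z hT hH B).smoothMap
  have hs2 : SmoothMap fun t c => ∑ B, el T.μ G.1 (Sum.inl B) t c * T.Z T.H t c B :=
    SmoothMap.sum _ fun B => (hGe _).mul (hZs B)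
  have hF1 : SmoothFnl T.μ T.ν fun t c => lieF G.1 t c 1 (T.evol t c) :=
    hGl.smoothFnl.lieF_of_isVariation 1 hE.isVariation
  have hF2 : SmoothFnl T.μ T.ν fun t c =>
      integ T.μ (∑ B, el T.μ G.1 (Sum.inl B) t c * T.Z T.H t c B) := smoothFnl_integ hs2
  have hF3 : SmoothFnl T.μ T.ν fun t c => lieF T.H t c 0 (T.tilde G t c) :=
    hH.smoothFnl.lieF_of_isVariation 0 hX.isVariation
  have hF4 : SmoothFnl T.μ T.ν fun t c => integ T.ν (V t c) :=
    smoothFnl_integ_boundary hG.local_term.smoothMap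
  -- The external boundary conditions are preserved by the variation of a field by `u`.
  have hzero : lieF (fun t c => lieF G.1 t c 1 (T.evol t c) -
      integ T.μ (∑ B, el T.μ G.1 (Sum.inl B) t c * T.Z T.H t c B) -
      lieF T.H t c 0 (T.tilde G t c) - integ T.ν (V t c)) t c 0 (dir i u) = 0 := by
    have hcs : ∀ s : ℝ, T.ConstraintOn ((𝓡∂ n).boundary M) (c + s • dir i u) := fun s =>
      hc.of_flat hT fun k => by
        rw [comp_add, comp_smul, add_sub_cancel_left]
        exact (flatOn_comp_dir hu i k).smul s
    rw [lieF]
    simp only [hG.identity _ _ (hcs _), sub_self, deriv_const]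
  have hV0 : integ T.ν (lie V t c 0 (dir i u)) = 0 := integ_eq_zero_of_boundary hν
    fun x hx => (hG.local_term.flatOn_lie t c (flatOn_comp_dir hu i)).apply hx
  rw [((hF1.sub hF2).sub hF3).lieF_sub_fnl hF4, (hF1.sub hF2).lieF_sub_fnl hF3,
    hF1.lieF_sub_fnl hF2, lieF_integ hs2, h₁ L (by omega) hE 1 t c i hu,
    h₂ L (by omega) hX 0 t c i hu, lieF_integ hG.local_term.smoothMap, hV0,
    SmoothMap.lie_sum _ fun B => (hGe _).mul (hZs B), ← map_sum, ← map_sum, sum_idx, sum_idx]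
    at hzero
  simp only [comp_evol_inl, comp_evol_inr, lie_comp] at hzero
  rw [sum_mul_comp_dir_succ (g := fun i => el T.μ G.1 i t c)
    (fun i hi => (h₃ L (by omega)).1 i hi t c)] at hzero
  have hHlam : ∑ l ∈ Finset.range L, ∑ a, el T.μ T.H (Sum.inr (l, a)) t c *
      lie (fun t c => comp (T.tilde G t c) (Sum.inr (l, a))) t c 0 (dir i u) =
      ∑ a, T.phi a t c * lie (fun t c => G.2 t c a) t c 0 (dir i u) := by
    rw [Finset.sum_eq_single_of_mem 0 (by simp [hL]) fun l _ hl => ?_]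
    · simp only [el_H_inr hT, if_true]
      rfl
    · simp [el_H_inr hT, hl]
  have hanti := sum_sigma_antisymm hT.antisymm
    (fun B => lie (el T.μ G.1 (Sum.inl B)) t c 0 (dir i u)) fun B => el T.μ T.H (Sum.inl B) t c
  have hZG : ∀ B, lie (fun t c => comp (T.tilde G t c) (Sum.inl B)) t c 0 (dir i u) =
      ∑ C, T.σ B C • lie (el T.μ G.1 (Sum.inl C)) t c 0 (dir i u) := fun B =>
    lie_Z hT hGl B t c 0 _
  simp only [hHlam, hZG, (hGe _).lie_mul (hZs _), Finset.sum_add_distrib, Z_apply T.H t c, hanti,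
    map_add, map_neg] at hzero
  have hadj : integ T.μ (∑ a, T.phi a t c * lie (fun t c => G.2 t c a) t c 0 (dir i u)) =
      integ T.μ ((∑ a, A a (T.phi a t c)) * u) := by
    rw [map_sum, Finset.sum_mul, map_sum]
    exact Finset.sum_congr rfl fun a _ => hAadj a _ _ (Or.inr hu)
  rw [hadj] at hzero
  rw [sub_mul, add_mul, add_mul, map_sub, map_add, map_add, deltaT_eq_lie]
  linarith

variable {K : Set M}

/-- On the constraint surfaces, the functional derivatives of `G` with respect to the multipliers
vanish. This is a downward induction on the number of time derivatives of the multiplier. -/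
theorem IsNoether.flatOn_el_inr (hT : T.Admissible) (hG : T.IsNoether G V)
    (hK : T.RegularOn K) (hb : (𝓡∂ n).boundary M ⊆ K) (l : ℕ) (a : Fin m) (t : ℝ)
    {c : Config n M N m} (hc : T.ConstraintOn K c) :
    FlatOn K (el T.μ G.1 (Sum.inr (l, a)) t c) := by
  obtain ⟨L, hL⟩ := hG.local_functional.exists_el_sum hT.volume hT.boundary_carried
  by_cases hl : L ≤ l
  · rw [(hL L le_rfl).1 _ (by simpa using hl)]
    exact FlatOn.zero
  · push Not at hl
    induction hl.le using Nat.decreasingInduction generalizing t c with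
    | self =>
      rw [(hL L le_rfl).1 _ (by simp)]
      exact FlatOn.zero
    | of_succ l hl ih =>
      obtain ⟨A, hA, h⟩ := hG.el_identity hT (Sum.inr (l + 1, a)) t (hc.mono hb)
      have hH0 : lie (el T.μ T.H (Sum.inr (l + 1, a))) t c 0 (T.tilde G t c) = 0 :=
        lie_eq_zero_of_const fun s => by simp [el_H_inr hT]
      rw [hH0, zero_add, deltaT_eq_lie] at h
      have h1 : el T.μ G.1 (Sum.inr (l, a)) t c = ∑ a, A a (T.phi a t c) -
          lie (el T.μ G.1 (Sum.inr (l + 1, a))) t c 1 (T.evol t c) := by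
        rw [← h, add_sub_cancel_left]; rfl
      rw [h1]
      refine (FlatOn.sum _ fun b _ => (hc b).diffOp (hA b)).sub ?_
      refine hK.flatOn_lie (hG.isLocal_el hT _).smoothMap (fun t c hc => ?_) hc
        (tangentOn_evol hT hc) 1
      by_cases hl' : l + 1 < L
      · exact ih (t := t) (c := c) (hc := hc) hl'
      · rw [(hL L le_rfl).1 _ (by simpa using hl')]
        exact FlatOn.zero

/-- A symmetry transformation is tangent to the constraint surfaces. -/
theorem IsNoether.tangentOn (hT : T.Admissible) (hG : T.IsNoether G V)
    (hK : T.RegularOn K) (hb : (𝓡∂ n).boundary M ⊆ K) (t : ℝ)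
    {c : Config n M N m} (hc : T.ConstraintOn K c) : T.TangentOn K t c (T.tilde G t c) := by
  intro a
  obtain ⟨A, hA, h⟩ := hG.el_identity hT (Sum.inr (0, a)) t (hc.mono hb)
  have hH0 : el T.μ T.H (Sum.inr (0, a)) = T.phi a := by
    funext t c; simp [el_H_inr hT]
  rw [hH0, deltaT_eq_lie] at h
  have h1 : lie (T.phi a) t c 0 (T.tilde G t c) =
      lie (el T.μ G.1 (Sum.inr (0, a))) t c 1 (T.evol t c) - ∑ a, A a (T.phi a t c) := by
    rw [eq_sub_iff_add_eq, ← h]; simp [shift]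
  rw [h1]
  refine FlatOn.sub ?_ (FlatOn.sum _ fun b _ => (hc b).diffOp (hA b))
  exact hK.flatOn_lie (hG.isLocal_el hT _).smoothMap
    (fun t c hc => hG.flatOn_el_inr hT hK hb 0 a t hc) hc (tangentOn_evol hT hc) 1

/-- On the constraint surfaces, a symmetry transformation commutes with the time evolution. -/
theorem IsNoether.flatOn_brk_evol (hT : T.Admissible) (hG : T.IsNoether G V)
    (hb : (𝓡∂ n).boundary M ⊆ K) (t : ℝ) {c : Config n M N m} (hc : T.ConstraintOn K c) (i) :
    FlatOn K (comp (brk 0 (T.tilde G) 1 T.evol t c) i) := by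
  rw [brk, comp_sub, comp_lieC, comp_lieC]
  rcases i with B | ⟨l, a⟩
  · have e1 : lie (fun t c => comp (T.evol t c) (Sum.inl B)) t c 0 (T.tilde G t c) =
        ∑ C, T.σ B C • lie (el T.μ T.H (Sum.inl C)) t c 0 (T.tilde G t c) :=
      lie_Z hT (isLocalFnl_H hT) B t c 0 _
    have e2 : lie (fun t c => comp (T.tilde G t c) (Sum.inl B)) t c 1 (T.evol t c) =
        ∑ C, T.σ B C • lie (el T.μ G.1 (Sum.inl C)) t c 1 (T.evol t c) :=
      lie_Z hT hG.local_functional B t c 1 _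
    rw [e1, e2, ← Finset.sum_sub_distrib]
    refine FlatOn.sum _ fun C _ => ?_
    rw [← smul_sub]
    refine FlatOn.smul _ ?_
    obtain ⟨A, hA, h⟩ := hG.el_identity hT (Sum.inl C) t (hc.mono hb)
    rw [deltaT_eq_lie] at h
    have h1 : lie (el T.μ T.H (Sum.inl C)) t c 0 (T.tilde G t c) -
        lie (el T.μ G.1 (Sum.inl C)) t c 1 (T.evol t c) = -∑ a, A a (T.phi a t c) := by
      have : lie (el T.μ G.1 (Sum.inl C)) t c 1 (T.evol t c) + 0 = _ := h
      rw [add_zero] at this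
      rw [this]; abel
    rw [h1]
    exact (FlatOn.sum _ fun b _ => (hc b).diffOp (hA b)).neg
  · have e1 : lie (fun t c => comp (T.evol t c) (Sum.inr (l, a))) t c 0 (T.tilde G t c) =
        (T.deltaT^[l + 1] fun t c => G.2 t c a) t c := by
      simp only [comp_evol_inr, lie_comp]
      rfl
    have e2 : lie (fun t c => comp (T.tilde G t c) (Sum.inr (l, a))) t c 1 (T.evol t c) =
        (T.deltaT^[l + 1] fun t c => G.2 t c a) t c := by
      rw [Function.iterate_succ_apply', deltaT_eq_lie]
      rfl
    rw [e1, e2, sub_self]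
    exact FlatOn.zero

end Theory

/-! ### Variations that preserve the internal boundary conditions -/

namespace Theory

variable {n : ℕ} [NeZero n] {M : Type*} [TopologicalSpace M] [T2Space M] [CompactSpace M]
  [ChartedSpace (EuclideanHalfSpace n) M] [IsManifold (𝓡∂ n) ∞ M] [MeasurableSpace M]
  [BorelSpace M] {N m r : ℕ} {T : Theory n M N m r} [IsFiniteMeasure T.μ] [IsFiniteMeasure T.ν]

variable {G : Couple n M N m} {V : ℝ → Config n M N m → Fn n M}
  {f g : ℝ → Config n M N m → Fn n M}

/-- On the constraint surfaces, a symmetry transformation commutes with the time derivatives of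
local functions. -/
theorem IsNoether.flatOn_lie_deltaT_sub (hT : T.Admissible) (hG : T.IsNoether G V) {K : Set M}
    (hK : T.RegularOn K) (hb : (𝓡∂ n).boundary M ⊆ K) (hf : IsLocal f) (k : ℕ) (t : ℝ)
    {c : Config n M N m} (hc : T.ConstraintOn K c) :
    FlatOn K (lie (T.deltaT^[k] f) t c 0 (T.tilde G t c) -
      (T.deltaT^[k] fun t c => lie f t c 0 (T.tilde G t c)) t c) := by
  have hX := hG.isLocalField hT
  have hE := isLocalField_evol hT
  induction k generalizing t c with
  | zero => simpa using FlatOn.zero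
  | succ k ih =>
    have hg := isLocal_deltaT_iterate hT hf k
    have h1 := hg.lie_of_isLocalField 0 hX
    have h2 := isLocal_deltaT_iterate hT (hf.lie_of_isLocalField 0 hX) k
    have h3 := hg.smoothMap.lie_lie_sub hX.isVariation hE.isVariation 0 1 t c
    have h4 := hK.flatOn_lie (t := t) (h1.sub h2).smoothMap (fun t c hc => ih t hc) hc
      (tangentOn_evol hT hc) 1
    rw [h1.smoothMap.lie_sub_fn h2.smoothMap] at h4
    have h5 := h4.add (hg.flatOn_lie t c (hG.flatOn_brk_evol hT hb t hc))
    rw [← h3] at h5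
    rw [Function.iterate_succ_apply', Function.iterate_succ_apply', deltaT_eq_lie, deltaT_eq_lie]
    convert h5 using 1
    abel

variable (T) in
/-- `δ` is a smooth variation that preserves the internal boundary conditions. -/
def Preserving (δ : ℝ → Config n M N m → Config n M N m) : Prop :=
  IsVariation δ ∧ T.PreservesInternal δ

variable (T) in
/-- The boundary values of `g` are determined by the boundary fields: they are left invariant by
the variations that preserve the internal boundary conditions. -/
def BoundaryInvariant (g : ℝ → Config n M N m → Fn n M) : Prop :=
  ∀ δ, T.Preserving δ → ∀ t c, T.ConstraintOn ((𝓡∂ n).boundary M) c →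
    ∀ x ∈ (𝓡∂ n).boundary M, lie g t c 0 (δ t c) x = 0

variable {δ X : ℝ → Config n M N m → Config n M N m}

theorem Preserving.tangentOn (hδ : T.Preserving δ) (t : ℝ) {c : Config n M N m}
    (hc : T.ConstraintOn ((𝓡∂ n).boundary M) c) :
    T.TangentOn ((𝓡∂ n).boundary M) t c (δ t c) := fun a => by
  rw [← vary_eq_lie]; exact (hδ.2 t c hc).1 a

theorem Preserving.boundaryInvariant (α : Fin r) (k : ℕ) :
    T.BoundaryInvariant (T.deltaT^[k] (T.chi α)) := fun δ hδ t c hc x hx => by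
  rw [← vary_eq_lie]; exact (hδ.2 t c hc).2 k α x hx

theorem Preserving.mk (hδ : IsVariation δ)
    (h1 : ∀ t c, T.ConstraintOn ((𝓡∂ n).boundary M) c →
      T.TangentOn ((𝓡∂ n).boundary M) t c (δ t c))
    (h2 : ∀ t c, T.ConstraintOn ((𝓡∂ n).boundary M) c → ∀ k α, ∀ x ∈ (𝓡∂ n).boundary M,
      lie (T.deltaT^[k] (T.chi α)) t c 0 (δ t c) x = 0) : T.Preserving δ :=
  ⟨hδ, fun t c hc => ⟨fun a => by rw [vary_eq_lie]; exact h1 t c hc a,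
    fun k α x hx => by rw [vary_eq_lie]; exact h2 t c hc k α x hx⟩⟩

/-- The bracket of a symmetry of the boundary conditions with a variation that preserves the
internal boundary conditions preserves them, too. -/
theorem Preserving.brk (hT : T.Admissible) (hδ : T.Preserving δ) (hX : IsVariation X) (β : ℝ)
    (h1 : ∀ t c, T.ConstraintOn ((𝓡∂ n).boundary M) c →
      T.TangentOn ((𝓡∂ n).boundary M) t c (X t c))
    (h2 : ∀ k α, T.BoundaryInvariant fun t c => lie (T.deltaT^[k] (T.chi α)) t c β (X t c)) :
    T.Preserving (brk β X 0 δ) := by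
  have hK := hT.regular_boundary
  refine Preserving.mk (hX.brk hδ.1 β 0) (fun t c hc a => ?_) fun t c hc k α x hx => ?_
  · have hφ := (hT.local_phi a).smoothMap
    rw [← hφ.lie_lie_sub hX hδ.1]
    refine (hK.flatOn_lie (hφ.lie_of_isVariation 0 hδ.1) (fun t c hc => hδ.tangentOn t hc a) hc
      (h1 t c hc) β).sub ?_
    exact hK.flatOn_lie (hφ.lie_of_isVariation β hX) (fun t c hc => h1 t c hc a) hc
      (hδ.tangentOn t hc) 0
  · have hχ := (isLocal_deltaT_iterate hT (hT.local_chi α) k).smoothMap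
    rw [← hχ.lie_lie_sub hX hδ.1]
    have h3 := hK.lie_eq_zero (hχ.lie_of_isVariation 0 hδ.1)
      (fun t c hc => Preserving.boundaryInvariant α k δ hδ t c hc x hx) hc (h1 t c hc) β
    have h4 := h2 k α δ hδ t c hc x hx
    rw [ContMDiffMap.coe_sub, Pi.sub_apply, h3, h4, sub_zero]

theorem Preserving.brk_evol (hT : T.Admissible) (hδ : T.Preserving δ) :
    T.Preserving (GaugeBC.brk 1 T.evol 0 δ) := by
  refine hδ.brk hT (isLocalField_evol hT).isVariation 1 (fun t c hc => tangentOn_evol hT hc)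
    fun k α => ?_
  have := Preserving.boundaryInvariant (T := T) α (k + 1)
  rwa [Function.iterate_succ_apply', deltaT_eq_lie] at this

/-- A derivation that is tangent to the external boundary conditions, and whose commutators with
the variations that preserve the internal boundary conditions are such variations, maps functions
of the boundary fields to functions of the boundary fields. -/
theorem BoundaryInvariant.lie (hT : T.Admissible) (hg : SmoothMap g) (h : T.BoundaryInvariant g)
    (hX : IsVariation X) (β : ℝ)
    (h1 : ∀ t c, T.ConstraintOn ((𝓡∂ n).boundary M) c →
      T.TangentOn ((𝓡∂ n).boundary M) t c (X t c))
    (h2 : ∀ δ, T.Preserving δ → T.Preserving (GaugeBC.brk β X 0 δ)) :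
    T.BoundaryInvariant fun t c => lie g t c β (X t c) := by
  intro δ hδ t c hc x hx
  have h3 := hg.lie_lie_sub hX hδ.1 β 0 t c
  have h4 := hT.regular_boundary.lie_eq_zero (hg.lie_of_isVariation 0 hδ.1)
    (fun t c hc => h δ hδ t c hc x hx) hc (h1 t c hc) β
  have h5 := h _ (h2 δ hδ) t c hc x hx
  have h6 := congrArg (fun u : Fn n M => u x) h3
  simp only [ContMDiffMap.coe_sub, Pi.sub_apply] at h6
  rw [h4, h5] at h6
  linarith

theorem BoundaryInvariant.deltaT_iterate (hT : T.Admissible) (hg : IsLocal g)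
    (h : T.BoundaryInvariant g) (k : ℕ) : T.BoundaryInvariant (T.deltaT^[k] g) := by
  induction k with
  | zero => exact h
  | succ k ih =>
    rw [Function.iterate_succ_apply', deltaT_eq_lie]
    exact ih.lie hT (isLocal_deltaT_iterate hT hg k).smoothMap (isLocalField_evol hT).isVariation 1
      (fun t c hc => tangentOn_evol hT hc) fun δ hδ => hδ.brk_evol hT

/-- A symmetry transformation whose action on the boundary fields only depends on the boundary
fields maps the variations that preserve the internal boundary conditions to such variations. -/
theorem IsNoether.preserving_brk (hT : T.Admissible) (hG : T.IsNoether G V)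
    (hχ : ∀ α, T.BoundaryInvariant fun t c => lie (T.chi α) t c 0 (T.tilde G t c))
    (hδ : T.Preserving δ) : T.Preserving (brk 0 (T.tilde G) 0 δ) := by
  have hX := hG.isLocalField hT
  have hK := hT.regular_boundary
  refine hδ.brk hT hX.isVariation 0 (fun t c hc => hG.tangentOn hT hK subset_rfl t hc)
    fun k α => ?_
  intro δ hδ t c hc x hx
  have hl := hT.local_chi α
  have h1 := (isLocal_deltaT_iterate hT hl k).lie_of_isLocalField 0 hX
  have h2 := isLocal_deltaT_iterate hT (hl.lie_of_isLocalField 0 hX) k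
  have h3 := hK.lie_eq_zero (h1.sub h2).smoothMap (x := x) (fun t c hc =>
    (hG.flatOn_lie_deltaT_sub hT hK subset_rfl hl k t hc).apply hx) hc (hδ.tangentOn t hc) 0
  rw [h1.smoothMap.lie_sub_fn h2.smoothMap] at h3
  have h4 := (hχ α).deltaT_iterate hT (hl.lie_of_isLocalField 0 hX) k δ hδ t c hc x hx
  rw [ContMDiffMap.coe_sub, Pi.sub_apply, h4, sub_zero] at h3
  exact h3

theorem IsNoether.boundaryInvariant_lie (hT : T.Admissible) (hG : T.IsNoether G V)
    (hχ : ∀ α, T.BoundaryInvariant fun t c => GaugeBC.lie (T.chi α) t c 0 (T.tilde G t c))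
    (hg : SmoothMap g) (h : T.BoundaryInvariant g) :
    T.BoundaryInvariant fun t c => GaugeBC.lie g t c 0 (T.tilde G t c) :=
  h.lie hT hg (hG.isLocalField hT).isVariation 0
    (fun t _ hc => hG.tangentOn hT hT.regular_boundary subset_rfl t hc)
    fun _ hδ => hG.preserving_brk hT hχ hδ

/-- The condition on the sources: `δ χ = 0` holds at all configurations that obey the external
boundary conditions, to which symmetry transformations are tangent, so that only one half of the
commutator `[δ_G, δ] χ` remains. -/
theorem IsNoether.sources_iff (hT : T.Admissible) (hG : T.IsNoether G V) :
    (∀ δ, IsVariation δ → T.PreservesInternal δ → ∀ t c, T.ExternalBC c →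
      ∀ α, ∀ x ∈ (𝓡∂ n).boundary M,
        vary (fun t c => vary (T.chi α) t c (δ t c)) t c (T.tilde G t c) x
          - vary (fun t c => vary (T.chi α) t c (T.tilde G t c)) t c (δ t c) x = 0) ↔
      ∀ α, T.BoundaryInvariant fun t c => GaugeBC.lie (T.chi α) t c 0 (T.tilde G t c) := by
  have key : ∀ δ, T.Preserving δ → ∀ t c, T.ConstraintOn ((𝓡∂ n).boundary M) c →
      ∀ α, ∀ x ∈ (𝓡∂ n).boundary M,
        GaugeBC.lie (fun t c => GaugeBC.lie (T.chi α) t c 0 (δ t c)) t c 0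
          (T.tilde G t c) x = 0 := by
    intro δ hδ t c hc α x hx
    exact hT.regular_boundary.lie_eq_zero ((hT.local_chi α).smoothMap.lie_of_isVariation 0 hδ.1)
      (fun t c hc => Preserving.boundaryInvariant α 0 δ hδ t c hc x hx) hc
      (hG.tangentOn hT hT.regular_boundary subset_rfl t hc) 0
  simp only [vary_eq_lie]
  constructor
  · intro h α δ hδ t c hc x hx
    have h1 := h δ hδ.1 hδ.2 t c hc α x hx
    rw [key δ hδ t c hc α x hx] at h1
    linarith
  · intro h δ h1 h2 t c hc α x hx
    rw [key δ ⟨h1, h2⟩ t c hc α x hx, h α δ ⟨h1, h2⟩ t c hc x hx, sub_zero]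

end Theory

/-! ### The invariance of the action in Hamiltonian form -/

namespace Theory

variable {n : ℕ} [NeZero n] {M : Type*} [TopologicalSpace M] [T2Space M] [CompactSpace M]
  [ChartedSpace (EuclideanHalfSpace n) M] [IsManifold (𝓡∂ n) ∞ M] [MeasurableSpace M]
  [BorelSpace M] {N m r : ℕ} {T : Theory n M N m r} [IsFiniteMeasure T.μ] [IsFiniteMeasure T.ν]

variable (T) in
/-- The density of the symplectic form. -/
def sympDensity (z w : Fin N → Fn n M) : Fn n M := ∑ A, ∑ B, T.σ⁻¹ A B • (z A * w B)

theorem symp_eq_integ (z w : Fin N → Fn n M) : T.symp z w = integ T.μ (T.sympDensity z w) := by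
  refine integral_congr_ae (Filter.Eventually.of_forall fun x => ?_)
  simp only [sympDensity, sum_fn_apply]
  refine Finset.sum_congr rfl fun A _ => Finset.sum_congr rfl fun B _ => ?_
  simp only [ContMDiffMap.coe_smul, Pi.smul_apply, ContMDiffMap.coe_mul, Pi.mul_apply, smul_eq_mul]
  ring

theorem sympDensity_line (z v w u : Fin N → Fn n M) (s : ℝ) :
    T.sympDensity (z + s • v) (w + s • u) = T.sympDensity z w +
      s • (T.sympDensity v w + T.sympDensity z u) + (s * s) • T.sympDensity v u := by
  simp only [sympDensity, Finset.smul_sum, smul_add, ← Finset.sum_add_distrib, Pi.add_apply,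
    Pi.smul_apply, add_mul, mul_add, smul_mul_assoc, mul_smul_comm]
  refine Finset.sum_congr rfl fun A _ => Finset.sum_congr rfl fun B _ => ?_
  module

theorem hasDerivAt_symp (z v w u : Fin N → Fn n M) :
    HasDerivAt (fun s : ℝ => T.symp (z + s • v) (w + s • u)) (T.symp v w + T.symp z u) 0 := by
  simp only [symp_eq_integ, sympDensity_line, map_add, map_smul, smul_eq_mul]
  have h1 := ((hasDerivAt_id (0 : ℝ)).mul_const
    (integ T.μ (T.sympDensity v w) + integ T.μ (T.sympDensity z u))).const_add
      (integ T.μ (T.sympDensity z w))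
  have h2 := ((hasDerivAt_id (0 : ℝ)).mul (hasDerivAt_id (0 : ℝ))).mul_const
    (integ T.μ (T.sympDensity v u))
  refine (h1.add h2).congr_deriv ?_
  simp

theorem inv_antisymm (hT : T.Admissible) (A B : Fin N) : T.σ⁻¹ B A = -T.σ⁻¹ A B := by
  have h : (T.σ⁻¹).transpose = -T.σ⁻¹ := by
    rw [Matrix.transpose_nonsing_inv, hT.antisymm]
    refine Matrix.inv_eq_left_inv ?_
    rw [neg_mul_neg, Matrix.nonsing_inv_mul _ hT.invertible]
  exact congrFun (congrFun h A) B

theorem symp_antisymm (hT : T.Admissible) (z w : Fin N → Fn n M) : T.symp z w = -T.symp w z := by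
  rw [symp_eq_integ, symp_eq_integ, ← map_neg]
  congr 1
  rw [sympDensity, sympDensity, Finset.sum_comm, ← Finset.sum_neg_distrib]
  refine Finset.sum_congr rfl fun A _ => ?_
  rw [← Finset.sum_neg_distrib]
  refine Finset.sum_congr rfl fun B _ => ?_
  rw [inv_antisymm hT A B, neg_smul, mul_comm]

theorem symp_Z (hT : T.Admissible) (F : ℝ → Config n M N m → ℝ) (t : ℝ) (c : Config n M N m)
    (w : Fin N → Fn n M) :
    T.symp (T.Z F t c) w = -integ T.μ (∑ A, el T.μ F (Sum.inl A) t c * w A) := by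
  rw [symp_antisymm hT, symp_eq_integ]
  congr 2
  rw [sympDensity]
  have h : ∀ A, ∑ B, T.σ⁻¹ A B • T.Z F t c B = el T.μ F (Sum.inl A) t c := by
    intro A
    simp only [Z_apply, Finset.smul_sum, smul_smul]
    rw [Finset.sum_comm]
    simp only [← Finset.sum_smul, ← Matrix.mul_apply, Matrix.nonsing_inv_mul _ hT.invertible]
    rw [Finset.sum_eq_single A (fun B _ hB => by rw [Matrix.one_apply_ne hB.symm, zero_smul])
      (by simp), Matrix.one_apply_eq, one_smul]
  refine Finset.sum_congr rfl fun A _ => ?_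
  simp only [← mul_smul_comm]
  rw [← Finset.mul_sum, h, mul_comm]

variable {G : Couple n M N m} {V : ℝ → Config n M N m → Fn n M}

theorem isLocal_sympDensity (hT : T.Admissible) {F : ℝ → Config n M N m → ℝ}
    (hF : IsLocalFnl T.μ T.ν F) : IsLocal fun t c => T.sympDensity c.1 (T.Z F t c) :=
  IsLocal.sum _ fun A => IsLocal.sum _ fun B =>
    ((isLocal_comp (Sum.inl A)).mul (isLocal_Z hT hF B)).const_smul _

theorem lieF_symp (hT : T.Admissible) {F : ℝ → Config n M N m → ℝ} (hF : IsLocalFnl T.μ T.ν F)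
    (t : ℝ) (c : Config n M N m) (w : Fin N → Fn n M) :
    lieF (fun t c => T.symp c.1 (T.Z F t c)) t c 1 (evolution c w) =
      T.symp w (T.Z F t c) + T.symp c.1 fun A => timeDeriv (fun t c => T.Z F t c A) t c w := by
  have hZ := fun B => (isLocal_Z hT hF B).smoothMap
  have hs := fun A B => ((smoothMap_comp (n := n) (M := M) (m := m)
    (Sum.inl A)).mul (hZ B)).const_smul (T.σ⁻¹ A B)
  simp only [symp_eq_integ]
  rw [lieF_integ (isLocal_sympDensity hT hF).smoothMap, ← map_add]
  congr 1
  simp only [sympDensity, ← Finset.sum_add_distrib]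
  refine (SmoothMap.lie_sum _ (fun A => SmoothMap.sum _ (hs A)) t c 1 _).trans ?_
  refine Finset.sum_congr rfl fun A _ => ?_
  rw [SmoothMap.lie_sum _ (hs A)]
  refine Finset.sum_congr rfl fun B _ => ?_
  rw [((smoothMap_comp _).mul (hZ B)).lie_const_smul, (smoothMap_comp _).lie_mul (hZ B), lie_comp,
    smul_add, timeDeriv_eq_lie]
  rfl

theorem varyLagrangian_eq (hT : T.Admissible) (G : Couple n M N m) (t : ℝ) (c : Config n M N m)
    (w : Fin N → Fn n M) : T.varyLagrangian G t c w =
      1 / 2 * (T.symp (T.Z G.1 t c) w +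
        T.symp c.1 fun A => timeDeriv (fun t c => T.Z G.1 t c A) t c w) -
      lieF T.H t c 0 (T.tilde G t c) := by
  have h1 := (hasDerivAt_symp (T := T) c.1 (T.Z G.1 t c) w
    fun A => timeDeriv (fun t c => T.Z G.1 t c A) t c w).const_mul (1 / 2)
  have h2 := (isLocalFnl_H hT).smoothFnl.hasDerivAt_line t c 0 (T.tilde G t c)
  simp only [mul_zero, add_zero] at h2
  exact (h1.sub h2).deriv

/-- The invariance condition only depends on the velocities through the equations of motion on
the boundary; this is how it turns into a condition on the phase space. -/
theorem varyLagrangian_sub (hT : T.Admissible) (hG : IsLocalFnl T.μ T.ν G.1) (t : ℝ)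
    (c : Config n M N m) {w : Fin N → Fn n M}
    (hw : ∀ A, FlatOn ((𝓡∂ n).boundary M) (w A - T.Z T.H t c A)) :
    T.varyLagrangian G t c w -
        timeDerivF (fun t c => 1 / 2 * T.symp c.1 (T.Z G.1 t c) - G.1 t c) t c w =
      lieF G.1 t c 1 (T.evol t c) - integ T.μ (∑ A, el T.μ G.1 (Sum.inl A) t c * T.Z T.H t c A) -
        lieF T.H t c 0 (T.tilde G t c) := by
  have hS : IsLocalFnl T.μ T.ν fun t c => T.symp c.1 (T.Z G.1 t c) := by
    simp only [symp_eq_integ]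
    exact isLocalFnl_integ (isLocal_sympDensity hT hG)
  obtain ⟨L, hL⟩ := hG.exists_el_sum hT.volume hT.boundary_carried
  have h1 : lieF G.1 t c 1 (evolution c w) = lieF G.1 t c 1 (T.evol t c) +
      integ T.μ (∑ A, el T.μ G.1 (Sum.inl A) t c * (w A - T.Z T.H t c A)) := by
    have h2 := hG.smoothFnl.lieF_add t c 1 0 (T.evol t c) (evolution c w - T.evol t c)
    rw [add_zero, add_sub_cancel] at h2
    rw [h2, (hL L le_rfl).2 t c _ ?_, ← map_sum, sum_idx]
    · have h3 : ∀ l a, comp (evolution c w - T.evol t c) (Sum.inr (l, a)) = 0 := fun l a => by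
        rw [comp_sub, comp_evol_inr]; exact sub_self _
      simp only [h3, mul_zero, Finset.sum_const_zero, add_zero, comp_sub]
      rfl
    · rintro (A | ⟨l, a⟩)
      · exact hw A
      · rw [comp_sub, comp_evol_inr]
        exact (sub_self (c.2 (l + 1) a)).symm ▸ FlatOn.zero
  rw [varyLagrangian_eq hT, timeDerivF_eq_lieF,
    (hS.const_smul (1 / 2)).smoothFnl.lieF_sub_fnl hG.smoothFnl, hS.smoothFnl.lieF_const_mul,
    lieF_symp hT hG, symp_antisymm hT w, symp_Z hT, h1]
  simp only [mul_sub, Finset.sum_sub_distrib, map_sub]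
  ring

/-- The invariance of the action in Hamiltonian form. The functional `U` is determined by `G`, and
it suffices to consider the velocities `dz/dt = σ δH/δz`. -/
theorem invariance_iff (hT : T.Admissible) (hG : IsLocalFnl T.μ T.ν G.1)
    (hΛ : ∀ a, IsLocal fun t c => G.2 t c a) :
    (∃ U : ℝ → Config n M N m → ℝ, ∃ V : ℝ → Config n M N m → Fn n M,
      T.IsLocalFunctional U ∧ IsLocal V ∧
      (∀ t c, G.1 t c = (1 / 2) * T.symp c.1 (T.Z G.1 t c) - U t c) ∧
      (∀ t c w, T.ExternalBC c →
        (∀ A, FlatOn ((𝓡∂ n).boundary M) (w A - T.Z T.H t c A)) →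
        T.varyLagrangian G t c w = timeDerivF U t c w + ∫ x, V t c x ∂T.ν) ∧
      ∀ δ, IsVariation δ → T.PreservesInternal δ → ∀ t c, T.ExternalBC c →
        varyF (fun t c => ∫ x, V t c x ∂T.ν) t c (δ t c) = 0) ↔
    ∃ V, T.IsNoether G V ∧ ∀ δ, T.Preserving δ → ∀ t c,
      T.ConstraintOn ((𝓡∂ n).boundary M) c → integ T.ν (lie V t c 0 (δ t c)) = 0 := by
  constructor
  · rintro ⟨U, V, hU, hV, hGU, h, hδ⟩
    have hU' : U = fun t c => 1 / 2 * T.symp c.1 (T.Z G.1 t c) - G.1 t c := by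
      funext t c
      linarith [hGU t c]
    refine ⟨V, ⟨hG, hΛ, hV, fun t c hc => ?_⟩, fun δ hδ' t c hc => ?_⟩
    · have hw : ∀ A, FlatOn ((𝓡∂ n).boundary M) (T.Z T.H t c A - T.Z T.H t c A) := fun A => by
        rw [sub_self]; exact FlatOn.zero
      rw [← varyLagrangian_sub hT hG t c hw, h t c _ hc hw, ← hU', add_sub_cancel_left]
      rfl
    · rw [← lieF_integ hV.smoothMap, ← varyF_eq_lieF]
      exact hδ δ hδ'.1 hδ'.2 t c hc
  · rintro ⟨V, hGV, hδ⟩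
    refine ⟨fun t c => 1 / 2 * T.symp c.1 (T.Z G.1 t c) - G.1 t c, V, ?_, hGV.local_term,
      fun t c => by ring, fun t c w hc hw => ?_, fun δ h1 h2 t c hc => ?_⟩
    · simp only [symp_eq_integ]
      exact ((isLocalFnl_integ (isLocal_sympDensity hT hG)).const_smul _).sub hG
    · have h1 := varyLagrangian_sub hT hG t c hw
      rw [hGV.identity t c hc] at h1
      exact sub_eq_iff_eq_add'.1 h1
    · have := hδ δ ⟨h1, h2⟩ t c hc
      rw [← lieF_integ hGV.local_term.smoothMap] at this
      rw [varyF_eq_lieF]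
      exact this

end Theory

/-! ### The bracket of couples -/

namespace Theory

variable {n : ℕ} [NeZero n] {M : Type*} [TopologicalSpace M] [T2Space M] [CompactSpace M]
  [ChartedSpace (EuclideanHalfSpace n) M] [IsManifold (𝓡∂ n) ∞ M] [MeasurableSpace M]
  [BorelSpace M] {N m r : ℕ} {T : Theory n M N m r} [IsFiniteMeasure T.μ] [IsFiniteMeasure T.ν]

variable (T) in
/-- The density of the Poisson bracket. -/
def poissonDensity (F G : ℝ → Config n M N m → ℝ) (t : ℝ) (c : Config n M N m) : Fn n M :=
  ∑ A, el T.μ F (Sum.inl A) t c * T.Z G t c A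

variable {F G : ℝ → Config n M N m → ℝ}

theorem poisson_eq_integ (F G : ℝ → Config n M N m → ℝ) (t : ℝ) (c : Config n M N m) :
    T.poisson F G t c = integ T.μ (T.poissonDensity F G t c) := by
  refine integral_congr_ae (Filter.Eventually.of_forall fun x => ?_)
  simp only [poissonDensity, Z_apply, dz_eq_el, Finset.mul_sum, sum_fn_apply]
  refine Finset.sum_congr rfl fun A _ => Finset.sum_congr rfl fun B _ => ?_
  simp only [ContMDiffMap.coe_smul, Pi.smul_apply, ContMDiffMap.coe_mul, Pi.mul_apply, smul_eq_mul]
  ring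

theorem poissonDensity_antisymm (hT : T.Admissible) (F G : ℝ → Config n M N m → ℝ) (t : ℝ)
    (c : Config n M N m) : T.poissonDensity F G t c = -T.poissonDensity G F t c := by
  simp only [poissonDensity, Z_apply]
  exact sum_sigma_antisymm hT.antisymm (fun A => el T.μ F (Sum.inl A) t c)
    fun A => el T.μ G (Sum.inl A) t c

theorem isLocal_poissonDensity (hT : T.Admissible) (hF : IsLocalFnl T.μ T.ν F)
    (hG : IsLocalFnl T.μ T.ν G) : IsLocal (T.poissonDensity F G) :=
  IsLocal.sum _ fun A =>
    (hF.isLocal_el hT.volume hT.boundary_carried _).mul (isLocal_Z hT hG A)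

theorem lie_poissonDensity (hT : T.Admissible) (hF : IsLocalFnl T.μ T.ν F)
    (hG : IsLocalFnl T.μ T.ν G) (t : ℝ) (c : Config n M N m) (α : ℝ) (v : Config n M N m) :
    lie (T.poissonDensity F G) t c α v =
      ∑ A, el T.μ F (Sum.inl A) t c * lie (fun t c => T.Z G t c A) t c α v -
        ∑ A, el T.μ G (Sum.inl A) t c * lie (fun t c => T.Z F t c A) t c α v := by
  have hZ := fun A => (isLocal_Z hT hG A).smoothMap
  have he := fun A => (hF.isLocal_el hT.volume hT.boundary_carried (Sum.inl A)).smoothMap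
  have h := sum_sigma_antisymm hT.antisymm (fun A => lie (el T.μ F (Sum.inl A)) t c α v)
    fun A => el T.μ G (Sum.inl A) t c
  simp only [← Z_apply, ← lie_Z hT hF] at h
  refine (SmoothMap.lie_sum _ (fun A => (he A).mul (hZ A)) t c α v).trans ?_
  simp only [(he _).lie_mul (hZ _), Finset.sum_add_distrib, h]
  abel

variable {G₁ G₂ : Couple n M N m} {V V₁ V₂ : ℝ → Config n M N m → Fn n M}

theorem bracket_fst (G₁ G₂ : Couple n M N m) : (T.bracket G₁ G₂).1 = fun t c =>
    lieF G₂.1 t c 0 (T.tilde G₁ t c) - lieF G₁.1 t c 0 (T.tilde G₂ t c) -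
      integ T.μ (T.poissonDensity G₂.1 G₁.1 t c) := by
  funext t c
  simp only [bracket, varyF_eq_lieF, poisson_eq_integ]

theorem bracket_snd (G₁ G₂ : Couple n M N m) (a : Fin m) :
    (fun t c => (T.bracket G₁ G₂).2 t c a) = fun t c =>
      lie (fun t c => G₂.2 t c a) t c 0 (T.tilde G₁ t c) -
        lie (fun t c => G₁.2 t c a) t c 0 (T.tilde G₂ t c) := by
  funext t c
  simp only [bracket, vary_eq_lie]

variable (T) in
/-- A couple of a local functional and a local function. -/
def IsLocalCouple (G : Couple n M N m) : Prop :=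
  IsLocalFnl T.μ T.ν G.1 ∧ ∀ a, IsLocal fun t c => G.2 t c a

theorem IsLocalCouple.isLocalField {G : Couple n M N m} (hT : T.Admissible)
    (hG : T.IsLocalCouple G) : IsLocalField (T.tilde G) :=
  isLocalField_tilde hT hG.1 hG.2

theorem IsLocalCouple.bracket (hT : T.Admissible) (h₁ : T.IsLocalCouple G₁)
    (h₂ : T.IsLocalCouple G₂) : T.IsLocalCouple (T.bracket G₁ G₂) := by
  have hX₁ := h₁.isLocalField hT
  have hX₂ := h₂.isLocalField hT
  refine ⟨?_, fun a => ?_⟩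
  · rw [bracket_fst]
    exact ((h₂.1.lieF_of_isLocalField 0 hX₁).sub (h₁.1.lieF_of_isLocalField 0 hX₂)).sub
      (isLocalFnl_integ (isLocal_poissonDensity hT h₂.1 h₁.1))
  · rw [bracket_snd]
    exact ((h₂.2 a).lie_of_isLocalField 0 hX₁).sub ((h₁.2 a).lie_of_isLocalField 0 hX₂)

theorem comp_tilde_inr (G : Couple n M N m) (l : ℕ) (a : Fin m) :
    (fun t c => comp (T.tilde G t c) (Sum.inr (l, a))) = T.deltaT^[l] fun t c => G.2 t c a := rfl

theorem comp_tilde_inl (G : Couple n M N m) (A : Fin N) :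
    (fun t c => comp (T.tilde G t c) (Sum.inl A)) = fun t c => T.Z G.1 t c A := rfl

/-- The variation of the bracket functional: its part with the variations of the Hamiltonian
vector fields cancels because `σ` is antisymmetric. -/
theorem lieF_bracket (hT : T.Admissible) (h₁ : T.IsLocalCouple G₁) (h₂ : T.IsLocalCouple G₂)
    {t : ℝ} {c v : Config n M N m} {L : ℕ} {p₁ p₂ : ℝ}
    (e₂ : lieF (fun t c => lieF G₂.1 t c 0 (T.tilde G₁ t c)) t c 0 v = p₂ + ∑ k ∈ idx N m L,
      integ T.μ (el T.μ G₂.1 k t c * lie (fun t c => comp (T.tilde G₁ t c) k) t c 0 v))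
    (e₁ : lieF (fun t c => lieF G₁.1 t c 0 (T.tilde G₂ t c)) t c 0 v = p₁ + ∑ k ∈ idx N m L,
      integ T.μ (el T.μ G₁.1 k t c * lie (fun t c => comp (T.tilde G₂ t c) k) t c 0 v)) :
    lieF (T.bracket G₁ G₂).1 t c 0 v = p₂ - p₁ + ∑ l ∈ Finset.range L, ∑ a,
      (integ T.μ (el T.μ G₂.1 (Sum.inr (l, a)) t c *
          lie (T.deltaT^[l] fun t c => G₁.2 t c a) t c 0 v) -
        integ T.μ (el T.μ G₁.1 (Sum.inr (l, a)) t c *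
          lie (T.deltaT^[l] fun t c => G₂.2 t c a) t c 0 v)) := by
  have hX₁ := (h₁.isLocalField hT).isVariation
  have hX₂ := (h₂.isLocalField hT).isVariation
  have hF₁ := h₁.1.smoothFnl.lieF_of_isVariation 0 hX₂
  have hF₂ := h₂.1.smoothFnl.lieF_of_isVariation 0 hX₁
  have hp := isLocal_poissonDensity hT h₂.1 h₁.1
  rw [sum_idx] at e₁ e₂
  simp only [comp_tilde_inr, comp_tilde_inl, ← map_sum] at e₁ e₂
  rw [bracket_fst, (hF₂.sub hF₁).lieF_sub_fnl (isLocalFnl_integ hp).smoothFnl,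
    hF₂.lieF_sub_fnl hF₁, lieF_integ hp.smoothMap, e₁, e₂, lie_poissonDensity hT h₂.1 h₁.1]
  simp only [map_sub, ← map_sum, Finset.sum_sub_distrib]
  ring

/-- The functional derivatives of the bracket functional. The operators `A₁` and `A₂` are the
adjoints of the linearisations of the transformations of the multipliers. -/
theorem exists_el_bracket (hT : T.Admissible) (h₁ : T.IsLocalCouple G₁)
    (h₂ : T.IsLocalCouple G₂) : ∃ L₀, ∀ L, L₀ ≤ L → ∀ (t : ℝ) (c : Config n M N m) (i),
    ∃ A₁ A₂ : ℕ → Fin m → Module.End ℝ (Fn n M),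
      (∀ l a, A₁ l a ∈ diffOps n M ∧ ∀ e u : Fn n M,
        (FlatOn ((𝓡∂ n).boundary M) e ∨ FlatOn ((𝓡∂ n).boundary M) u) →
        integ T.μ (e * lie (T.deltaT^[l] fun t c => G₁.2 t c a) t c 0 (dir i u)) =
          integ T.μ (A₁ l a e * u)) ∧
      (∀ l a, A₂ l a ∈ diffOps n M ∧ ∀ e u : Fn n M,
        (FlatOn ((𝓡∂ n).boundary M) e ∨ FlatOn ((𝓡∂ n).boundary M) u) →
        integ T.μ (e * lie (T.deltaT^[l] fun t c => G₂.2 t c a) t c 0 (dir i u)) =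
          integ T.μ (A₂ l a e * u)) ∧
      el T.μ (T.bracket G₁ G₂).1 i t c = lie (el T.μ G₂.1 i) t c 0 (T.tilde G₁ t c) -
        lie (el T.μ G₁.1 i) t c 0 (T.tilde G₂ t c) + ∑ l ∈ Finset.range L, ∑ a,
          (A₁ l a (el T.μ G₂.1 (Sum.inr (l, a)) t c) -
            A₂ l a (el T.μ G₁.1 (Sum.inr (l, a)) t c)) := by
  have hμ := hT.volume
  have hν := hT.boundary_carried
  obtain ⟨L₁, k₁⟩ := h₁.1.exists_lieF_lieF hμ hν
  obtain ⟨L₂, k₂⟩ := h₂.1.exists_lieF_lieF hμ hν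
  refine ⟨max L₁ L₂, fun L hL t c i => ?_⟩
  choose A₁ hA₁ using fun l a =>
    (isLocal_deltaT_iterate hT (h₁.2 a) l).exists_adjoint_lie hμ t c i
  choose A₂ hA₂ using fun l a =>
    (isLocal_deltaT_iterate hT (h₂.2 a) l).exists_adjoint_lie hμ t c i
  refine ⟨A₁, A₂, hA₁, hA₂, el_eq hμ (h₁.bracket hT h₂).1.smoothFnl fun u hu => ?_⟩
  rw [lieF_bracket hT h₁ h₂
    (k₂ L (le_of_max_le_right hL) (h₁.isLocalField hT) 0 t c i hu)
    (k₁ L (le_of_max_le_left hL) (h₂.isLocalField hT) 0 t c i hu), add_mul, sub_mul, map_add,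
    map_sub, Finset.sum_mul, map_sum]
  congr 1
  refine Finset.sum_congr rfl fun l _ => ?_
  rw [Finset.sum_mul, map_sum]
  refine Finset.sum_congr rfl fun a _ => ?_
  rw [(hA₁ l a).2 _ _ (Or.inr hu), (hA₂ l a).2 _ _ (Or.inr hu), sub_mul, map_sub]

theorem IsNoether.isLocalCouple {G : Couple n M N m} (hG : T.IsNoether G V) : T.IsLocalCouple G :=
  ⟨hG.local_functional, hG.local_multiplier⟩

theorem deltaT_iterate_add_smul (hT : T.Admissible) {f g : ℝ → Config n M N m → Fn n M}
    (hf : IsLocal f) (hg : IsLocal g) (a : ℝ) (k : ℕ) :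
    (T.deltaT^[k] fun t c => f t c + a • g t c) =
      fun t c => (T.deltaT^[k] f) t c + a • (T.deltaT^[k] g) t c := by
  induction k with
  | zero => rfl
  | succ k ih =>
    have h₁ := (isLocal_deltaT_iterate hT hf k).smoothMap
    have h₂ := (isLocal_deltaT_iterate hT hg k).smoothMap
    simp only [Function.iterate_succ_apply', ih, deltaT_eq_lie]
    funext t c
    rw [h₁.lie_add_fn (h₂.const_smul a), h₂.lie_const_smul]

theorem deltaT_iterate_sub (hT : T.Admissible) {f g : ℝ → Config n M N m → Fn n M}
    (hf : IsLocal f) (hg : IsLocal g) (k : ℕ) : (T.deltaT^[k] fun t c => f t c - g t c) =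
      fun t c => (T.deltaT^[k] f) t c - (T.deltaT^[k] g) t c := by
  simpa [sub_eq_add_neg] using deltaT_iterate_add_smul hT hf hg (-1) k

/-- On the constraint surfaces, the transformation generated by the bracket of two couples is the
commutator of their transformations. -/
theorem IsNoether.flatOn_tilde_bracket (hT : T.Admissible) (h₁ : T.IsNoether G₁ V₁)
    (h₂ : T.IsNoether G₂ V₂) {K : Set M} (hK : T.RegularOn K) (hb : (𝓡∂ n).boundary M ⊆ K)
    (t : ℝ) {c : Config n M N m} (hc : T.ConstraintOn K c) (i) :
    FlatOn K (comp (T.tilde (T.bracket G₁ G₂) t c -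
      brk 0 (T.tilde G₁) 0 (T.tilde G₂) t c) i) := by
  have l₁ := h₁.isLocalCouple
  have l₂ := h₂.isLocalCouple
  rw [comp_sub, brk, comp_sub, comp_lieC, comp_lieC]
  rcases i with A | ⟨l, a⟩
  · have e : comp (T.tilde (T.bracket G₁ G₂) t c) (Sum.inl A) =
      ∑ B, T.σ A B • el T.μ (T.bracket G₁ G₂).1 (Sum.inl B) t c := Z_apply _ _ _ _
    rw [comp_tilde_inl, comp_tilde_inl, lie_Z hT l₁.1, lie_Z hT l₂.1, e,
      ← Finset.sum_sub_distrib, ← Finset.sum_sub_distrib]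
    refine FlatOn.sum _ fun B _ => ?_
    rw [← smul_sub, ← smul_sub]
    refine FlatOn.smul _ ?_
    obtain ⟨L, hL⟩ := exists_el_bracket hT l₁ l₂
    obtain ⟨A₁, A₂, hA₁, hA₂, hel⟩ := hL L le_rfl t c (Sum.inl B)
    rw [hel, add_sub_cancel_left]
    exact FlatOn.sum _ fun l _ => FlatOn.sum _ fun a _ =>
      ((h₂.flatOn_el_inr hT hK hb l a t hc).diffOp (hA₁ l a).1).sub
        ((h₁.flatOn_el_inr hT hK hb l a t hc).diffOp (hA₂ l a).1)
  · have e : comp (T.tilde (T.bracket G₁ G₂) t c) (Sum.inr (l, a)) =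
        (T.deltaT^[l] fun t c => (T.bracket G₁ G₂).2 t c a) t c := rfl
    rw [comp_tilde_inr, comp_tilde_inr, e, bracket_snd, deltaT_iterate_sub hT
      ((l₂.2 a).lie_of_isLocalField 0 (l₁.isLocalField hT))
      ((l₁.2 a).lie_of_isLocalField 0 (l₂.isLocalField hT))]
    have f₁ := h₁.flatOn_lie_deltaT_sub hT hK hb (l₂.2 a) l t hc
    have f₂ := h₂.flatOn_lie_deltaT_sub hT hK hb (l₁.2 a) l t hc
    convert f₂.sub f₁ using 1
    rw [sub_sub_sub_comm, ← neg_sub (lie _ _ _ _ _), ← neg_sub (lie _ _ _ _ _), neg_sub_neg]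

/-- The invariance condition of the bracket is the antisymmetrised derivative of the invariance
conditions of the two couples: the terms that do not cancel are products with variations which are
flat on the boundary, and can be integrated by parts. -/
theorem IsNoether.bracket (hT : T.Admissible) (h₁ : T.IsNoether G₁ V₁) (h₂ : T.IsNoether G₂ V₂) :
    T.IsNoether (T.bracket G₁ G₂) fun t c =>
      lie V₂ t c 0 (T.tilde G₁ t c) - lie V₁ t c 0 (T.tilde G₂ t c) := by
  have hμ := hT.volume
  have hν := hT.boundary_carried
  have hK := hT.regular_boundary
  have hH := isLocalFnl_H hT
  have hE := isLocalField_evol hT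
  have l₁ := h₁.isLocalCouple
  have l₂ := h₂.isLocalCouple
  have l₃ := l₁.bracket hT l₂
  have X₁ := l₁.isLocalField hT
  have X₂ := l₂.isLocalField hT
  have hV₁ := h₁.local_term.lie_of_isLocalField 0 X₂
  have hV₂ := h₂.local_term.lie_of_isLocalField 0 X₁
  refine ⟨l₃.1, l₃.2, hV₂.sub hV₁, fun t c hc => ?_⟩
  obtain ⟨L, k⟩ := hH.exists_el_sum hμ hν
  -- The derivative of the invariance condition of one couple along the transformation of the other.
  have key : ∀ {G G' : Couple n M N m} {V V'} (_ : T.IsNoether G V) (_ : T.IsNoether G' V'),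
      lieF (fun t c => lieF G'.1 t c 0 (T.tilde G t c)) t c 1 (T.evol t c) =
        integ T.μ (∑ A, el T.μ G'.1 (Sum.inl A) t c *
            lie (fun t c => T.Z G.1 t c A) t c 1 (T.evol t c) -
          ∑ A, el T.μ T.H (Sum.inl A) t c *
            lie (fun t c => T.Z G'.1 t c A) t c 0 (T.tilde G t c)) +
        lieF (fun t c => lieF T.H t c 0 (T.tilde G' t c)) t c 0 (T.tilde G t c) +
        integ T.ν (lie V' t c 0 (T.tilde G t c)) := by
    intro G G' V V' hG hG'
    have l := hG.isLocalCouple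
    have l' := hG'.isLocalCouple
    have X := l.isLocalField hT
    have X' := l'.isLocalField hT
    have hP := isLocal_poissonDensity hT l'.1 hH
    have s₁ := l'.1.smoothFnl.lieF_of_isVariation 1 hE.isVariation
    have s₂ : SmoothFnl T.μ T.ν fun t c => integ T.μ (T.poissonDensity G'.1 T.H t c) :=
      smoothFnl_integ hP.smoothMap
    have s₃ := hH.smoothFnl.lieF_of_isVariation 0 X'.isVariation
    have s₄ : SmoothFnl T.μ T.ν fun t c => integ T.ν (V' t c) :=
      smoothFnl_integ_boundary hG'.local_term.smoothMap
    have d := hK.lieF_eq_zero (((s₁.sub s₂).sub s₃).sub s₄)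
      (fun t c hc => sub_eq_zero.2 (hG'.identity t c hc)) hc
      (hG.tangentOn hT hK subset_rfl t hc) 0
    rw [((s₁.sub s₂).sub s₃).lieF_sub_fnl s₄, (s₁.sub s₂).lieF_sub_fnl s₃, s₁.lieF_sub_fnl s₂,
      lieF_integ hP.smoothMap, lieF_integ hG'.local_term.smoothMap,
      lie_poissonDensity hT l'.1 hH] at d
    have b := l'.1.smoothFnl.lieF_lieF_sub X.isVariation hE.isVariation 0 1 t c
    obtain ⟨L, k⟩ := l'.1.exists_el_sum hμ hν
    rw [(k L le_rfl).2 t c _ fun i => hG.flatOn_brk_evol hT subset_rfl t hc i, sum_idx] at b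
    have z : ∀ l a, comp (brk 0 (T.tilde G) 1 T.evol t c) (Sum.inr (l, a)) = 0 := fun l a => by
      rw [brk, comp_sub, comp_lieC, comp_lieC, comp_tilde_inr]
      simp only [comp_evol_inr, lie_comp]
      rw [sub_eq_zero, ← comp_tilde_inr]
      exact (congrFun (congrFun (Function.iterate_succ_apply' T.deltaT l
        fun t c => G.2 t c a) t) c).trans (by rw [deltaT_eq_lie]; rfl)
    simp only [z, mul_zero, map_zero, Finset.sum_const_zero, add_zero] at b
    simp only [brk, comp_sub, comp_lieC, comp_tilde_inl, comp_evol_inl, mul_sub, map_sub,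
      Finset.sum_sub_distrib, ← map_sum] at b
    rw [map_sub] at d ⊢
    linarith
  -- The transformation of the bracket differs from the commutator of the two transformations by a
  -- variation that is flat on the boundary.
  have b := hH.smoothFnl.lieF_lieF_sub X₁.isVariation X₂.isVariation 0 0 t c
  have e := hH.smoothFnl.lieF_add t c 0 0 (brk 0 (T.tilde G₁) 0 (T.tilde G₂) t c)
    (T.tilde (T.bracket G₁ G₂) t c - brk 0 (T.tilde G₁) 0 (T.tilde G₂) t c)
  rw [add_zero, add_sub_cancel, (k (L + 1) (by omega)).2 t c _
    (h₁.flatOn_tilde_bracket hT h₂ hK subset_rfl t hc), sum_idx] at e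
  -- On the multipliers `λ^a` themselves, the two transformations agree, and the Hamiltonian does
  -- not depend on the derivatives of `λ^a`.
  have z : ∑ l ∈ Finset.range (L + 1), ∑ a, integ T.μ (el T.μ T.H (Sum.inr (l, a)) t c *
      comp (T.tilde (T.bracket G₁ G₂) t c - brk 0 (T.tilde G₁) 0 (T.tilde G₂) t c)
        (Sum.inr (l, a))) = 0 := by
    refine Finset.sum_eq_zero fun l _ => Finset.sum_eq_zero fun a _ => ?_
    rw [el_H_inr hT]
    rcases l with _ | l
    · have : comp (T.tilde (T.bracket G₁ G₂) t c - brk 0 (T.tilde G₁) 0 (T.tilde G₂) t c)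
          (Sum.inr (0, a)) = 0 := by
        rw [comp_sub, brk, comp_sub, comp_lieC, comp_lieC, sub_eq_zero]
        exact congrFun (congrFun (bracket_snd G₁ G₂ a) t) c
      rw [this, mul_zero, map_zero]
    · simp
  have hP := isLocal_poissonDensity hT l₂.1 l₁.1
  have s₁ := l₁.1.smoothFnl.lieF_of_isVariation 0 X₂.isVariation
  have s₂ := l₂.1.smoothFnl.lieF_of_isVariation 0 X₁.isVariation
  have a := poissonDensity_antisymm hT (T.bracket G₁ G₂).1 T.H t c
  have a' : ∑ A, el T.μ (T.bracket G₁ G₂).1 (Sum.inl A) t c * T.Z T.H t c A =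
      -∑ A, el T.μ T.H (Sum.inl A) t c * T.Z (T.bracket G₁ G₂).1 t c A := a
  have q := congrArg (fun F => lieF F t c 1 (T.evol t c)) (bracket_fst (T := T) G₁ G₂)
  beta_reduce at q
  rw [(s₂.sub s₁).lieF_sub_fnl (smoothFnl_integ hP.smoothMap), s₂.lieF_sub_fnl s₁,
    lieF_integ hP.smoothMap, lie_poissonDensity hT l₂.1 l₁.1, key h₁ h₂, key h₂ h₁] at q
  have w : ∀ A, comp (T.tilde (T.bracket G₁ G₂) t c) (Sum.inl A) =
    T.Z (T.bracket G₁ G₂).1 t c A := fun A => rfl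
  rw [z, add_zero] at e
  simp only [brk, comp_sub, comp_lieC, comp_tilde_inl, w, mul_sub, map_sub,
      Finset.sum_sub_distrib, ← map_sum] at e
  rw [q, a', map_neg, map_sub]
  simp only [map_sub, brk] at *
  linarith

end Theory

/-! ### Symmetries and their brackets -/

namespace Theory

variable {n : ℕ} [NeZero n] {M : Type*} [TopologicalSpace M] [T2Space M] [CompactSpace M]
  [ChartedSpace (EuclideanHalfSpace n) M] [IsManifold (𝓡∂ n) ∞ M] [MeasurableSpace M]
  [BorelSpace M] {N m r : ℕ} {T : Theory n M N m r} [IsFiniteMeasure T.μ] [IsFiniteMeasure T.ν]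

variable {F : ℝ → Config n M N m → ℝ} {G G₁ G₂ Γ : Couple n M N m}
  {V V₁ V₂ : ℝ → Config n M N m → Fn n M} {δ : ℝ → Config n M N m → Config n M N m}

/-- Since only finitely many functional derivatives do not vanish, the sum over the time derivatives
of the multipliers is finite. -/
theorem isDifferentiable_iff {L : ℕ}
    (hL : ∀ i ∉ idx N m L, ∀ t c, el T.μ F i t c = 0) :
    T.IsDifferentiable F ↔ ∀ δ, T.Preserving δ → ∀ t c,
      T.ConstraintOn ((𝓡∂ n).boundary M) c →
        lieF F t c 0 (δ t c) = ∑ k ∈ idx N m L, integ T.μ (el T.μ F k t c * comp (δ t c) k) := by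
  have key : ∀ t (c v : Config n M N m),
      ∫ x, (∑ A, T.dz F A t c x * v.1 A x + ∑ᶠ l, ∑ a, T.dl F l a t c x * v.2 l a x) ∂T.μ =
        ∑ k ∈ idx N m L, integ T.μ (el T.μ F k t c * comp v k) := by
    intro t c v
    rw [← map_sum]
    refine integral_congr_ae (Filter.Eventually.of_forall fun x => ?_)
    refine Eq.trans ?_ (sum_fn_apply _ (fun k => el T.μ F k t c * comp v k) x).symm
    change _ = ∑ k ∈ idx N m L, el T.μ F k t c x * comp v k x
    simp only [sum_idx, dz_eq_el, dl_eq_el]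
    refine congrArg₂ (· + ·) rfl ?_
    refine finsum_eq_finsetSum_of_support_subset _ fun l hl => ?_
    by_contra hl'
    refine hl (Finset.sum_eq_zero fun a _ => ?_)
    rw [hL _ (by simpa using hl')]
    exact zero_mul _
  simp only [IsDifferentiable, key, varyF_eq_lieF]
  exact ⟨fun h δ hδ t c hc => h δ hδ.1 hδ.2 t c hc, fun h δ h1 h2 t c hc => h δ ⟨h1, h2⟩ t c hc⟩

variable (T) in
/-- The couple `G` generates an external symmetry, in Hamiltonian form. -/
structure IsSymmetry (G : Couple n M N m) (V : ℝ → Config n M N m → Fn n M) : Prop where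
  noether : T.IsNoether G V
  boundary_fields : ∀ α, T.BoundaryInvariant fun t c => lie (T.chi α) t c 0 (T.tilde G t c)
  differentiable : T.IsDifferentiable G.1
  term_invariant : ∀ δ, T.Preserving δ → ∀ t c, T.ConstraintOn ((𝓡∂ n).boundary M) c →
    integ T.ν (lie V t c 0 (δ t c)) = 0

theorem isExternalSymmetry_iff (hT : T.Admissible) :
    T.IsExternalSymmetry G ↔ ∃ V, T.IsSymmetry G V := by
  constructor
  · intro h
    obtain ⟨V, hV, hδ⟩ := (invariance_iff hT h.local_functional h.local_multiplier).1 h.invariance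
    exact ⟨V, hV, (hV.sources_iff hT).1 h.sources, h.differentiable, hδ⟩
  · rintro ⟨V, h⟩
    exact ⟨h.noether.local_functional, h.noether.local_multiplier,
      (h.noether.sources_iff hT).2 h.boundary_fields, h.differentiable,
      (invariance_iff hT h.noether.local_functional h.noether.local_multiplier).2
        ⟨V, h.noether, h.term_invariant⟩⟩

theorem IsSymmetry.preserving_brk (hT : T.Admissible) (hG : T.IsSymmetry G V)
    (hδ : T.Preserving δ) : T.Preserving (brk 0 (T.tilde G) 0 δ) :=
  hG.noether.preserving_brk hT hG.boundary_fields hδ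

theorem IsSymmetry.tangentOn (hT : T.Admissible) (hG : T.IsSymmetry G V) (t : ℝ)
    {c : Config n M N m} (hc : T.ConstraintOn ((𝓡∂ n).boundary M) c) :
    T.TangentOn ((𝓡∂ n).boundary M) t c (T.tilde G t c) :=
  hG.noether.tangentOn hT hT.regular_boundary subset_rfl t hc

/-- The boundary term of the invariance condition stays a function of the boundary fields under
a symmetry transformation. -/
theorem IsSymmetry.integ_lie_lie (hT : T.Admissible) (hG : T.IsSymmetry G V)
    {W : ℝ → Config n M N m → Fn n M} (hW : IsLocal W)
    (h : ∀ δ, T.Preserving δ → ∀ t c, T.ConstraintOn ((𝓡∂ n).boundary M) c →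
      integ T.ν (lie W t c 0 (δ t c)) = 0) (hδ : T.Preserving δ) (t : ℝ)
    {c : Config n M N m} (hc : T.ConstraintOn ((𝓡∂ n).boundary M) c) :
    integ T.ν (lie (fun t c => lie W t c 0 (T.tilde G t c)) t c 0 (δ t c)) = 0 := by
  have hX := hG.noether.isLocalField hT
  have h1 := hW.smoothMap.lie_lie_sub hX.isVariation hδ.1 0 0 t c
  have h2 := h _ (hG.preserving_brk hT hδ) t c hc
  have hs := hW.smoothMap.lie_of_isVariation 0 hδ.1
  have h3 := hT.regular_boundary.lieF_eq_zero (smoothFnl_integ_boundary (μ := T.μ) (ν := T.ν) hs)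
    (fun t c hc => h δ hδ t c hc) hc (hG.tangentOn hT t hc) 0
  rw [lieF_integ hs] at h3
  rw [← h1, map_sub, h3] at h2
  linarith

/-- The second variation of a differentiable functional, along a symmetry transformation and along
a variation that preserves the internal boundary conditions. -/
theorem IsSymmetry.lieF_lieF (hT : T.Admissible) (hG : T.IsSymmetry G V)
    (hF : IsLocalFnl T.μ T.ν F) (hd : T.IsDifferentiable F) {L : ℕ}
    (hL : ∀ i ∉ idx N m L, ∀ t c, el T.μ F i t c = 0) (hδ : T.Preserving δ) (t : ℝ)
    {c : Config n M N m} (hc : T.ConstraintOn ((𝓡∂ n).boundary M) c) :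
    lieF (fun t c => lieF F t c 0 (T.tilde G t c)) t c 0 (δ t c) =
      ∑ k ∈ idx N m L, integ T.μ (lie (el T.μ F k) t c 0 (T.tilde G t c) * comp (δ t c) k) +
      ∑ k ∈ idx N m L,
        integ T.μ (el T.μ F k t c * lie (fun t c => comp (T.tilde G t c) k) t c 0 (δ t c)) := by
  have hX := (hG.noether.isLocalField hT).isVariation
  have he := fun k => (hF.isLocal_el hT.volume hT.boundary_carried k).smoothMap
  have hδs := isVariation_iff.1 hδ.1
  have hdiff := (isDifferentiable_iff hL).1 hd
  have h1 := hF.smoothFnl.lieF_lieF_sub hX hδ.1 0 0 t c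
  have hs : SmoothMap fun t c => ∑ k ∈ idx N m L, el T.μ F k t c * comp (δ t c) k :=
    SmoothMap.sum _ fun k => (he k).mul (hδs k)
  have hs₁ := hF.smoothFnl.lieF_of_isVariation 0 hδ.1
  have h2 := hT.regular_boundary.lieF_eq_zero (hs₁.sub (smoothFnl_integ hs))
    (fun t c hc => by rw [hdiff δ hδ t c hc, map_sum, sub_self]) hc (hG.tangentOn hT t hc) 0
  rw [hs₁.lieF_sub_fnl (smoothFnl_integ hs), lieF_integ hs,
    SmoothMap.lie_sum _ fun k => (he k).mul (hδs k)] at h2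
  rw [hdiff _ (hG.preserving_brk hT hδ) t c hc] at h1
  simp only [(he _).lie_mul (hδs _), brk, comp_sub, comp_lieC, mul_sub, map_sub, map_add, map_sum,
    Finset.sum_add_distrib, Finset.sum_sub_distrib] at h1 h2
  linarith

theorem exists_sum_dir_deltaT (hT : T.Admissible) (hΛ : ∀ a, IsLocal fun t c => G.2 t c a)
    (K : ℕ) : ∃ L₀, ∀ L, L₀ ≤ L → ∀ l < K, ∀ a t (c v : Config n M N m),
      lie (T.deltaT^[l] fun t c => G.2 t c a) t c 0 v = ∑ i ∈ idx N m L,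
        lie (T.deltaT^[l] fun t c => G.2 t c a) t c 0 (dir i (comp v i)) := by
  choose L hL using fun l a => (isLocal_deltaT_iterate hT (hΛ a) l).exists_sum_dir
  refine ⟨(Finset.range K).sup fun l => Finset.univ.sup fun a => L l a,
    fun L' hL' l hl a t c v => hL l a L' ?_ t c v⟩
  refine le_trans ?_ hL'
  exact (Finset.le_sup (f := fun a => L l a) (Finset.mem_univ a)).trans
    (Finset.le_sup (f := fun l => Finset.univ.sup fun a => L l a) (Finset.mem_range.2 hl))

/-- The variation of the bracket functional has no boundary term: by `IsSymmetry.lieF_lieF` its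
second variations have none, and the functional derivatives with respect to the multipliers are
flat on the boundary, so that the variations of `Λ₁` and `Λ₂` can be integrated by parts. -/
theorem IsSymmetry.isDifferentiable_bracket (hT : T.Admissible) (h₁ : T.IsSymmetry G₁ V₁)
    (h₂ : T.IsSymmetry G₂ V₂) : T.IsDifferentiable (T.bracket G₁ G₂).1 := by
  have hμ := hT.volume
  have hν := hT.boundary_carried
  have l₁ := h₁.noether.isLocalCouple
  have l₂ := h₂.noether.isLocalCouple
  obtain ⟨K₁, k₁⟩ := l₁.1.exists_el_sum hμ hν
  obtain ⟨K₂, k₂⟩ := l₂.1.exists_el_sum hμ hν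
  obtain ⟨K₃, k₃⟩ := (l₁.bracket hT l₂).1.exists_el_sum hμ hν
  obtain ⟨M₁, m₁⟩ := exists_sum_dir_deltaT hT l₁.2 (max K₁ K₂)
  obtain ⟨M₂, m₂⟩ := exists_sum_dir_deltaT hT l₂.2 (max K₁ K₂)
  obtain ⟨L₀, b⟩ := exists_el_bracket hT l₁ l₂
  set L := K₁ + K₂ + K₃ + M₁ + M₂ + L₀ with hL
  refine (isDifferentiable_iff (k₃ L (by omega)).1).2
    fun δ hδ t c hc => ?_
  rw [lieF_bracket hT l₁ l₂
    (h₁.lieF_lieF hT l₂.1 h₂.differentiable (k₂ L (by omega)).1 hδ t hc)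
    (h₂.lieF_lieF hT l₁.1 h₁.differentiable (k₁ L (by omega)).1 hδ t hc)]
  choose A₁ A₂ hA₁ hA₂ hel using b L (by omega) t c
  simp only [hel, add_mul, sub_mul, map_add, map_sub, Finset.sum_add_distrib,
    Finset.sum_sub_distrib, Finset.sum_mul, map_sum]
  -- Integration by parts is allowed since these functional derivatives are flat on the boundary.
  have key : ∀ {G G' : Couple n M N m} {V' : ℝ → Config n M N m → Fn n M} {K' : ℕ}
      {A : Fin N ⊕ (ℕ × Fin m) → ℕ → Fin m → Module.End ℝ (Fn n M)}
      (_ : T.IsNoether G' V') (_ : ∀ i ∉ idx N m K', ∀ t c, el T.μ G'.1 i t c = 0)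
      (_ : ∀ i l a, A i l a ∈ diffOps n M ∧ ∀ e u : Fn n M,
        (FlatOn ((𝓡∂ n).boundary M) e ∨ FlatOn ((𝓡∂ n).boundary M) u) →
        integ T.μ (e * lie (T.deltaT^[l] fun t c => G.2 t c a) t c 0 (dir i u)) =
          integ T.μ (A i l a e * u))
      (_ : ∀ l < K', ∀ a t (c v : Config n M N m),
        lie (T.deltaT^[l] fun t c => G.2 t c a) t c 0 v = ∑ i ∈ idx N m L,
          lie (T.deltaT^[l] fun t c => G.2 t c a) t c 0 (dir i (comp v i))) (l : ℕ) (a : Fin m),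
      integ T.μ (el T.μ G'.1 (Sum.inr (l, a)) t c *
          lie (T.deltaT^[l] fun t c => G.2 t c a) t c 0 (δ t c)) =
        ∑ i ∈ idx N m L, integ T.μ (A i l a (el T.μ G'.1 (Sum.inr (l, a)) t c) *
          comp (δ t c) i) := by
    intro G G' V' K' A hG' h0 hA hm l a
    by_cases hl : l < K'
    · rw [hm l hl, Finset.mul_sum, map_sum]
      refine Finset.sum_congr rfl fun i _ => (hA i l a).2 _ _ (Or.inl ?_)
      exact hG'.flatOn_el_inr hT hT.regular_boundary subset_rfl l a t hc
    · rw [h0 _ (by simpa using hl)]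
      simp
  have e₁ := fun l a => key h₂.noether (k₂ (max K₁ K₂) (le_max_right _ _)).1 hA₁
    (m₁ L (by omega)) l a
  have e₂ := fun l a => key h₁.noether (k₁ (max K₁ K₂) (le_max_left _ _)).1 hA₂
    (m₂ L (by omega)) l a
  simp only [e₁, e₂]
  congr 1
  have sw : ∀ f : (Fin N ⊕ (ℕ × Fin m)) → ℕ → Fin m → ℝ,
      ∑ l ∈ Finset.range L, ∑ a, ∑ i ∈ idx N m L, f i l a =
        ∑ i ∈ idx N m L, ∑ l ∈ Finset.range L, ∑ a, f i l a := fun f => by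
    rw [Finset.sum_comm (s := idx N m L)]
    exact Finset.sum_congr rfl fun l _ => Finset.sum_comm
  simp only [sw]

theorem BoundaryInvariant.sub {f g : ℝ → Config n M N m → Fn n M} (hf : SmoothMap f)
    (hg : SmoothMap g) (h : T.BoundaryInvariant f) (h' : T.BoundaryInvariant g) :
    T.BoundaryInvariant fun t c => f t c - g t c := fun δ hδ t c hc x hx => by
  rw [hf.lie_sub_fn hg, ContMDiffMap.coe_sub, Pi.sub_apply, h δ hδ t c hc x hx,
    h' δ hδ t c hc x hx, sub_zero]

theorem BoundaryInvariant.congr (hT : T.Admissible) {f g : ℝ → Config n M N m → Fn n M}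
    (hf : SmoothMap f) (hg : SmoothMap g) (h : T.BoundaryInvariant f)
    (hfg : ∀ t c, T.ConstraintOn ((𝓡∂ n).boundary M) c → ∀ x ∈ (𝓡∂ n).boundary M,
      g t c x = f t c x) : T.BoundaryInvariant g := fun δ hδ t c hc x hx => by
  have h1 := hT.regular_boundary.lie_eq_zero (hg.sub hf) (x := x)
    (fun t c hc => by rw [ContMDiffMap.coe_sub, Pi.sub_apply, hfg t c hc x hx, sub_self]) hc
    (hδ.tangentOn t hc) 0
  rwa [hg.lie_sub_fn hf, ContMDiffMap.coe_sub, Pi.sub_apply, h δ hδ t c hc x hx, sub_zero] at h1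

/-- On the boundary fields, the transformation of the bracket acts as the commutator. -/
theorem IsNoether.lie_chi_bracket (hT : T.Admissible) (h₁ : T.IsNoether G₁ V₁)
    (h₂ : T.IsNoether G₂ V₂) (α : Fin r) (t : ℝ) {c : Config n M N m}
    (hc : T.ConstraintOn ((𝓡∂ n).boundary M) c) {x : M} (hx : x ∈ (𝓡∂ n).boundary M) :
    lie (T.chi α) t c 0 (T.tilde (T.bracket G₁ G₂) t c) x =
      (lie (fun t c => lie (T.chi α) t c 0 (T.tilde G₂ t c)) t c 0 (T.tilde G₁ t c) -
        lie (fun t c => lie (T.chi α) t c 0 (T.tilde G₁ t c)) t c 0 (T.tilde G₂ t c)) x := by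
  have X₁ := (h₁.isLocalField hT).isVariation
  have X₂ := (h₂.isLocalField hT).isVariation
  have hχ := hT.local_chi α
  have h := hχ.smoothMap.lie_add t c 0 0 (brk 0 (T.tilde G₁) 0 (T.tilde G₂) t c)
    (T.tilde (T.bracket G₁ G₂) t c - brk 0 (T.tilde G₁) 0 (T.tilde G₂) t c)
  rw [add_zero, add_sub_cancel] at h
  rw [hχ.smoothMap.lie_lie_sub X₁ X₂, h, ContMDiffMap.coe_add, Pi.add_apply,
    (hχ.flatOn_lie t c (h₁.flatOn_tilde_bracket hT h₂ hT.regular_boundary subset_rfl t hc)).apply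
      hx, add_zero]

/-- The external symmetries are closed under the bracket. -/
theorem IsSymmetry.bracket (hT : T.Admissible) (h₁ : T.IsSymmetry G₁ V₁)
    (h₂ : T.IsSymmetry G₂ V₂) : T.IsSymmetry (T.bracket G₁ G₂) fun t c =>
      lie V₂ t c 0 (T.tilde G₁ t c) - lie V₁ t c 0 (T.tilde G₂ t c) := by
  have X₁ := h₁.noether.isLocalField hT
  have X₂ := h₂.noether.isLocalField hT
  have X₃ := (h₁.noether.isLocalCouple.bracket hT h₂.noether.isLocalCouple).isLocalField hT
  refine ⟨h₁.noether.bracket hT h₂.noether, fun α => ?_, h₁.isDifferentiable_bracket hT h₂,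
    fun δ hδ t c hc => ?_⟩
  · have s₁ := (hT.local_chi α).lie_of_isLocalField 0 X₁
    have s₂ := (hT.local_chi α).lie_of_isLocalField 0 X₂
    have s₁₂ := s₂.smoothMap.lie_of_isVariation 0 X₁.isVariation
    have s₂₁ := s₁.smoothMap.lie_of_isVariation 0 X₂.isVariation
    exact BoundaryInvariant.congr hT (s₁₂.sub s₂₁)
      ((hT.local_chi α).smoothMap.lie_of_isVariation 0 X₃.isVariation)
      ((h₁.noether.boundaryInvariant_lie hT h₁.boundary_fields s₂.smoothMap
        (h₂.boundary_fields α)).sub s₁₂ s₂₁ (h₂.noether.boundaryInvariant_lie hT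
          h₂.boundary_fields s₁.smoothMap (h₁.boundary_fields α)))
      fun t c hc x hx => h₁.noether.lie_chi_bracket hT h₂.noether α t hc hx
  · have V₁s := h₁.noether.local_term
    have V₂s := h₂.noether.local_term
    rw [(V₂s.lie_of_isLocalField 0 X₁).smoothMap.lie_sub_fn
      (V₁s.lie_of_isLocalField 0 X₂).smoothMap, map_sub,
      h₁.integ_lie_lie hT V₂s h₂.term_invariant hδ t hc,
      h₂.integ_lie_lie hT V₁s h₁.term_invariant hδ t hc, sub_zero]

variable (T) in
/-- The couple generates a proper gauge transformation, in Hamiltonian form. -/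
structure IsProper (Γ : Couple n M N m) (V : ℝ → Config n M N m → Fn n M) : Prop where
  symmetry : T.IsSymmetry Γ V
  internal : ∀ t c, T.ConstraintOn ((𝓡∂ n).boundary M) c → ∀ α, ∀ x ∈ (𝓡∂ n).boundary M,
    lie (T.chi α) t c 0 (T.tilde Γ t c) x = 0
  weaklyZero : T.WeaklyZero Γ.1

theorem isProperGauge_iff (hT : T.Admissible) :
    T.IsProperGauge Γ ↔ ∃ V, T.IsProper Γ V := by
  constructor
  · intro h
    obtain ⟨V, hV⟩ := (isExternalSymmetry_iff hT).1 h.external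
    refine ⟨V, hV, fun t c hc α x hx => ?_, h.weaklyZero⟩
    rw [← vary_eq_lie]
    exact h.internal t c hc α x hx
  · rintro ⟨V, h⟩
    refine ⟨(isExternalSymmetry_iff hT).2 ⟨V, h.symmetry⟩, fun t c hc α x hx => ?_, h.weaklyZero⟩
    rw [vary_eq_lie]
    exact h.internal t c hc α x hx

/-- Proper gauge transformations are variations that preserve the internal boundary conditions. -/
theorem IsProper.preserving (hT : T.Admissible) (h : T.IsProper Γ V) :
    T.Preserving (T.tilde Γ) := by
  have hN := h.symmetry.noether
  have hX := hN.isLocalField hT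
  refine Preserving.mk hX.isVariation (fun t c hc => h.symmetry.tangentOn hT t hc)
    fun t c hc k α x hx => ?_
  have h0 : ∀ k t (c : Config n M N m), T.ConstraintOn ((𝓡∂ n).boundary M) c →
      (T.deltaT^[k] fun t c => lie (T.chi α) t c 0 (T.tilde Γ t c)) t c x = 0 := by
    intro k
    induction k with
    | zero => exact fun t c hc => h.internal t c hc α x hx
    | succ k ih =>
      intro t c hc
      rw [Function.iterate_succ_apply', deltaT_eq_lie]
      exact hT.regular_boundary.lie_eq_zero (isLocal_deltaT_iterate hT
        ((hT.local_chi α).lie_of_isLocalField 0 hX) k).smoothMap ih hc (tangentOn_evol hT hc) 1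
  have h1 := (hN.flatOn_lie_deltaT_sub hT hT.regular_boundary subset_rfl (hT.local_chi α) k t
    hc).apply hx
  rwa [ContMDiffMap.coe_sub, Pi.sub_apply, h0 k t c hc, sub_zero] at h1

/-- A symmetry is a first-class functional: its bracket with a proper gauge transformation is a
proper gauge transformation. -/
theorem IsSymmetry.isProper_bracket (hT : T.Admissible) (hG : T.IsSymmetry G V₁)
    (hΓ : T.IsProper Γ V₂) : T.IsProper (T.bracket G Γ) fun t c =>
      lie V₂ t c 0 (T.tilde G t c) - lie V₁ t c 0 (T.tilde Γ t c) := by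
  have hμ := hT.volume
  have hν := hT.boundary_carried
  have hΓp := hΓ.preserving hT
  refine ⟨hG.bracket hT hΓ.symmetry, fun t c hc α x hx => ?_, fun t c hc => ?_⟩
  · rw [hG.noether.lie_chi_bracket hT hΓ.symmetry.noether α t hc hx, ContMDiffMap.coe_sub,
      Pi.sub_apply, hG.boundary_fields α _ hΓp t c hc x hx, sub_zero]
    exact hT.regular_boundary.lie_eq_zero
      ((hT.local_chi α).lie_of_isLocalField 0 (hΓ.symmetry.noether.isLocalField hT)).smoothMap
      (fun t c hc => hΓ.internal t c hc α x hx) hc (hG.tangentOn hT t hc) 0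
  · have hc' : T.ConstraintOn Set.univ c := fun a => flatOn_univ.2 (hc a)
    have l₁ := hG.noether.isLocalCouple
    have l₂ := hΓ.symmetry.noether.isLocalCouple
    -- The transformation of `G` is tangent to the constraint surface, on which `Γ` vanishes, and
    -- the variation of `G` cancels the Poisson bracket.
    have e₁ : lieF Γ.1 t c 0 (T.tilde G t c) = 0 :=
      hT.regular_surface.lieF_eq_zero l₂.1.smoothFnl
        (fun t c hc => hΓ.weaklyZero t c fun a => flatOn_univ.1 (hc a)) hc'
        (hG.noether.tangentOn hT hT.regular_surface (Set.subset_univ _) t hc') 0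
    obtain ⟨L, k⟩ := l₁.1.exists_el_sum hμ hν
    have e₂ := (isDifferentiable_iff (k L le_rfl).1).1 hG.differentiable _ hΓp t c
      (hc'.mono (Set.subset_univ _))
    have z : ∀ l a, el T.μ G.1 (Sum.inr (l, a)) t c = 0 := fun l a =>
      flatOn_univ.1 (hG.noether.flatOn_el_inr hT hT.regular_surface (Set.subset_univ _) l a t hc')
    rw [sum_idx] at e₂
    simp only [z, zero_mul, map_zero, Finset.sum_const_zero, add_zero, ← map_sum] at e₂
    have e₃ : lieF G.1 t c 0 (T.tilde Γ t c) = integ T.μ (T.poissonDensity G.1 Γ.1 t c) := e₂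
    rw [bracket_fst]
    beta_reduce
    rw [e₁, e₃, poissonDensity_antisymm hT, map_neg]
    ring

end Theory

/-! ### The Lie algebra of symmetries -/

namespace Theory

variable {n : ℕ} [NeZero n] {M : Type*} [TopologicalSpace M] [T2Space M] [CompactSpace M]
  [ChartedSpace (EuclideanHalfSpace n) M] [IsManifold (𝓡∂ n) ∞ M] [MeasurableSpace M]
  [BorelSpace M] {N m r : ℕ} {T : Theory n M N m r} [IsFiniteMeasure T.μ] [IsFiniteMeasure T.ν]

variable {F F' : ℝ → Config n M N m → ℝ} {G G' Γ : Couple n M N m}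
  {V V' : ℝ → Config n M N m → Fn n M}

theorem lieF_add_smul (hF : IsLocalFnl T.μ T.ν F) (hF' : IsLocalFnl T.μ T.ν F') (a t : ℝ)
    (c : Config n M N m) (α : ℝ) (v : Config n M N m) :
    lieF (F + a • F') t c α v = lieF F t c α v + a * lieF F' t c α v := by
  rw [← hF'.smoothFnl.lieF_const_mul,
    ← hF.smoothFnl.lieF_add_fnl (hF'.smoothFnl.const_smul a)]
  rfl

theorem el_add_smul (hT : T.Admissible) (hF : IsLocalFnl T.μ T.ν F)
    (hF' : IsLocalFnl T.μ T.ν F') (a : ℝ) (i) (t : ℝ) (c : Config n M N m) :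
    el T.μ (F + a • F') i t c = el T.μ F i t c + a • el T.μ F' i t c := by
  have h : IsLocalFnl T.μ T.ν (F + a • F') := hF.add (hF'.const_smul a)
  refine el_eq hT.volume h.smoothFnl fun u hu => ?_
  rw [lieF_add_smul hF hF', hF.lieF_dir hT.volume hT.boundary_carried t c i hu,
    hF'.lieF_dir hT.volume hT.boundary_carried t c i hu, add_mul, smul_mul_assoc, map_add,
    map_smul, smul_eq_mul]

theorem IsLocalCouple.add_smul (hG : T.IsLocalCouple G) (hG' : T.IsLocalCouple G') (a : ℝ) :
    T.IsLocalCouple (G + a • G') :=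
  ⟨hG.1.add (hG'.1.const_smul a), fun b => (hG.2 b).add ((hG'.2 b).const_smul a)⟩

theorem IsLocalCouple.tilde_add_smul (hT : T.Admissible) (hG : T.IsLocalCouple G)
    (hG' : T.IsLocalCouple G') (a t : ℝ) (c : Config n M N m) :
    T.tilde (G + a • G') t c = T.tilde G t c + a • T.tilde G' t c := by
  refine config_ext fun i => ?_
  rw [comp_add, comp_smul]
  rcases i with A | ⟨l, b⟩
  · refine (Z_apply (G + a • G').1 t c A).trans (Eq.trans ?_ (congrArg₂ (fun u v => u + a • v)
      (Z_apply G.1 t c A) (Z_apply G'.1 t c A)).symm)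
    rw [Finset.smul_sum, ← Finset.sum_add_distrib]
    refine Finset.sum_congr rfl fun B _ => ?_
    rw [smul_comm, ← smul_add, ← el_add_smul hT hG.1 hG'.1]
    rfl
  · exact congrFun (congrFun (deltaT_iterate_add_smul hT (hG.2 b) (hG'.2 b) a l) t) c

theorem IsSymmetry.add_smul (hT : T.Admissible) (hG : T.IsSymmetry G V)
    (hG' : T.IsSymmetry G' V') (a : ℝ) :
    T.IsSymmetry (G + a • G') fun t c => V t c + a • V' t c := by
  have hH := (isLocalFnl_H hT).smoothFnl
  have l := hG.noether.isLocalCouple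
  have l' := hG'.noether.isLocalCouple
  have ht := l.tilde_add_smul hT l' a
  have s := hG.noether.local_term.smoothMap
  have s' := hG'.noether.local_term.smoothMap
  have e1 : (G + a • G').1 = G.1 + a • G'.1 := rfl
  refine ⟨⟨(l.add_smul l' a).1, (l.add_smul l' a).2,
    hG.noether.local_term.add (hG'.noether.local_term.const_smul a), fun t c hc => ?_⟩,
    fun α δ hδ t c hc x hx => ?_, ?_, fun δ hδ t c hc => ?_⟩
  · have h1 := hG.noether.identity t c hc
    have h2 := hG'.noether.identity t c hc
    have h3 := hH.lieF_add t c 0 (a * 0) (T.tilde G t c) (a • T.tilde G' t c)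
    rw [hH.lieF_smul, mul_zero, add_zero] at h3
    rw [ht, h3, e1, lieF_add_smul l.1 l'.1, map_add, map_smul, smul_eq_mul, ← h1, ← h2]
    simp only [el_add_smul hT l.1 l'.1, add_mul, smul_mul_assoc, Finset.sum_add_distrib,
      ← Finset.smul_sum, map_add, map_smul, smul_eq_mul]
    ring
  · have hχ := hT.local_chi α
    have k := (hχ.lie_of_isLocalField 0 (l.isLocalField hT)).smoothMap
    have k' := (hχ.lie_of_isLocalField 0 (l'.isLocalField hT)).smoothMap
    have e : (fun t c => lie (T.chi α) t c 0 (T.tilde (G + a • G') t c)) = fun t c =>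
        lie (T.chi α) t c 0 (T.tilde G t c) + a • lie (T.chi α) t c 0 (T.tilde G' t c) := by
      funext t c
      have h := hχ.smoothMap.lie_add t c 0 (a * 0) (T.tilde G t c) (a • T.tilde G' t c)
      rw [hχ.smoothMap.lie_smul, mul_zero, add_zero] at h
      rw [ht, h]
    rw [e, k.lie_add_fn (k'.const_smul a), k'.lie_const_smul, ContMDiffMap.coe_add, Pi.add_apply,
      ContMDiffMap.coe_smul, Pi.smul_apply, hG.boundary_fields α δ hδ t c hc x hx,
      hG'.boundary_fields α δ hδ t c hc x hx, smul_zero, add_zero]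
  · obtain ⟨L, h⟩ := l.1.exists_el_sum hT.volume hT.boundary_carried
    obtain ⟨L', h'⟩ := l'.1.exists_el_sum hT.volume hT.boundary_carried
    have z := (h (max L L') (le_max_left _ _)).1
    have z' := (h' (max L L') (le_max_right _ _)).1
    refine (isDifferentiable_iff (L := max L L') fun i hi t c => ?_).2 fun δ hδ t c hc => ?_
    · rw [e1, el_add_smul hT l.1 l'.1, z i hi, z' i hi, smul_zero, add_zero]
    · rw [e1, lieF_add_smul l.1 l'.1, (isDifferentiable_iff z).1 hG.differentiable δ hδ t c hc,
        (isDifferentiable_iff z').1 hG'.differentiable δ hδ t c hc, Finset.mul_sum,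
        ← Finset.sum_add_distrib]
      refine Finset.sum_congr rfl fun i _ => ?_
      rw [el_add_smul hT l.1 l'.1, add_mul, smul_mul_assoc, map_add, map_smul, smul_eq_mul]
  · rw [s.lie_add_fn (s'.const_smul a), s'.lie_const_smul, map_add, map_smul,
      hG.term_invariant δ hδ t c hc, hG'.term_invariant δ hδ t c hc, smul_zero, add_zero]

theorem IsProper.add_smul (hT : T.Admissible) (hG : T.IsProper G V)
    (hG' : T.IsProper G' V') (a : ℝ) :
    T.IsProper (G + a • G') fun t c => V t c + a • V' t c := by
  refine ⟨hG.symmetry.add_smul hT hG'.symmetry a, fun t c hc α x hx => ?_, fun t c hc => ?_⟩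
  · have hχ := (hT.local_chi α).smoothMap
    have h := hχ.lie_add t c 0 (a * 0) (T.tilde G t c) (a • T.tilde G' t c)
    rw [hχ.lie_smul, mul_zero, add_zero, ← hG.symmetry.noether.isLocalCouple.tilde_add_smul hT
      hG'.symmetry.noether.isLocalCouple] at h
    rw [h, ContMDiffMap.coe_add, Pi.add_apply, ContMDiffMap.coe_smul, Pi.smul_apply,
      hG.internal t c hc α x hx, hG'.internal t c hc α x hx, smul_zero, add_zero]
  · have : (G + a • G').1 t c = G.1 t c + a * G'.1 t c := rfl
    rw [this, hG.weaklyZero t c hc, hG'.weaklyZero t c hc, mul_zero, add_zero]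

theorem lie_zero_right (f : ℝ → Config n M N m → Fn n M) (t : ℝ) (c : Config n M N m) :
    lie f t c 0 0 = 0 :=
  lie_eq_zero_of_const fun s => by simp

theorem lieF_zero_right (F : ℝ → Config n M N m → ℝ) (t : ℝ) (c : Config n M N m) :
    lieF F t c 0 0 = 0 := by
  simp [lieF]

theorem isProper_zero (hT : T.Admissible) : T.IsProper 0 fun _ _ => 0 := by
  have l : T.IsLocalCouple (0 : Couple n M N m) :=
    ⟨⟨fun _ _ => 0, fun _ _ => 0, isLocal_const 0, isLocal_const 0, fun t c => by simp⟩,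
      fun _ => isLocal_const 0⟩
  have ht : ∀ t c, T.tilde (0 : Couple n M N m) t c = 0 := fun t c => by
    have h := l.tilde_add_smul hT l 1 t c
    rw [smul_zero, add_zero, one_smul] at h
    exact left_eq_add.1 h
  have hel : ∀ i t c, el T.μ (0 : Couple n M N m).1 i t c = 0 := fun i t c => by
    have h := el_add_smul hT l.1 l.1 1 i t c
    have e : (0 : Couple n M N m).1 + (1 : ℝ) • (0 : Couple n M N m).1 =
      (0 : Couple n M N m).1 := by simp
    rw [e, one_smul] at h
    exact left_eq_add.1 h
  have hF : ∀ t c α v, lieF (0 : Couple n M N m).1 t c α v = 0 := fun t c α v =>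
    deriv_const _ _
  refine ⟨⟨⟨l.1, l.2, isLocal_const 0, fun t c _ => ?_⟩, fun α δ _ t c _ x _ => ?_, ?_,
    fun δ _ t c _ => ?_⟩, fun t c _ α x _ => ?_, fun t c _ => rfl⟩
  · simp only [ht, hel, hF, lieF_zero_right, zero_mul, Finset.sum_const_zero, map_zero, sub_zero]
  · simp only [ht, lie_zero_right, lie_const]
    rfl
  · exact (isDifferentiable_iff (L := 0) fun i _ t c => hel i t c).2 fun δ _ t c _ => by
      simp only [hF, hel, zero_mul, map_zero, Finset.sum_const_zero]
  · rw [lie_const, map_zero]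
  · rw [ht, lie_zero_right]
    rfl

theorem bracket_antisymm (hT : T.Admissible) (G Γ : Couple n M N m) :
    T.bracket Γ G = (-1 : ℝ) • T.bracket G Γ := by
  refine Prod.ext ?_ ?_
  · rw [Prod.smul_fst, bracket_fst, bracket_fst]
    funext t c
    simp only [Pi.smul_apply, smul_eq_mul, poissonDensity_antisymm hT Γ.1 G.1, map_neg]
    ring
  · funext t c a
    simp [bracket]

/-- The subspace of the couples `G` that satisfy `P G V` for some `V`, where the condition `P` is
compatible with linear combinations. -/
def coupleSubmodule (P : Couple n M N m → (ℝ → Config n M N m → Fn n M) → Prop)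
    (h0 : P 0 fun _ _ => 0)
    (h : ∀ {G G' V V'}, P G V → P G' V' → ∀ a : ℝ, P (G + a • G') fun t c => V t c + a • V' t c) :
    Submodule ℝ (Couple n M N m) where
  carrier := {G | ∃ V, P G V}
  zero_mem' := ⟨_, h0⟩
  add_mem' := by
    rintro G G' ⟨V, hG⟩ ⟨V', hG'⟩
    exact ⟨_, one_smul ℝ G' ▸ h hG hG' 1⟩
  smul_mem' := by
    rintro a G ⟨V, hG⟩
    exact ⟨_, zero_add (a • G) ▸ h h0 hG a⟩

end Theory

end GaugeBC

end

theorem mainTheorem9 {n N m r : ℕ} [NeZero n] {M : Type*} [TopologicalSpace M] [T2Space M]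
    [CompactSpace M] [ChartedSpace (EuclideanHalfSpace n) M] [IsManifold (𝓡∂ n) ∞ M]
    [MeasurableSpace M] [BorelSpace M] (T : GaugeBC.Theory n M N m r) (hT : T.Admissible) :
    (∀ G Γ : GaugeBC.Couple n M N m, T.IsExternalSymmetry G → T.IsProperGauge Γ →
      T.IsProperGauge (T.bracket G Γ)) ∧
    ∃ 𝔤 𝔦 : Submodule ℝ (GaugeBC.Couple n M N m),
      (∀ G, G ∈ 𝔤 ↔ T.IsExternalSymmetry G) ∧ (∀ Γ, Γ ∈ 𝔦 ↔ T.IsProperGauge Γ) ∧ 𝔦 ≤ 𝔤 ∧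
      (∀ G₁ ∈ 𝔤, ∀ G₂ ∈ 𝔤, T.bracket G₁ G₂ ∈ 𝔤) ∧
      (∀ G ∈ 𝔤, ∀ Γ ∈ 𝔦, T.bracket G Γ ∈ 𝔦 ∧ T.bracket Γ G ∈ 𝔦) := by
  have := hT.volume.finite
  have := hT.boundary_finite
  have hbr : ∀ G Γ : GaugeBC.Couple n M N m, T.IsExternalSymmetry G → T.IsProperGauge Γ →
      T.IsProperGauge (T.bracket G Γ) := fun G Γ hG hΓ => by
    obtain ⟨V, hG⟩ := (GaugeBC.Theory.isExternalSymmetry_iff hT).1 hG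
    obtain ⟨W, hΓ⟩ := (GaugeBC.Theory.isProperGauge_iff hT).1 hΓ
    exact (GaugeBC.Theory.isProperGauge_iff hT).2 ⟨_, hG.isProper_bracket hT hΓ⟩
  have hp := GaugeBC.Theory.isProper_zero hT
  refine ⟨hbr, GaugeBC.Theory.coupleSubmodule T.IsSymmetry hp.symmetry
      fun hG hG' a => hG.add_smul hT hG' a,
    GaugeBC.Theory.coupleSubmodule T.IsProper hp fun hG hG' a => hG.add_smul hT hG' a,
    fun G => (GaugeBC.Theory.isExternalSymmetry_iff hT).symm,
    fun Γ => (GaugeBC.Theory.isProperGauge_iff hT).symm,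
    fun Γ ⟨V, h⟩ => ⟨V, h.symmetry⟩, fun G₁ ⟨V₁, h₁⟩ G₂ ⟨V₂, h₂⟩ => ⟨_, h₁.bracket hT h₂⟩,
    fun G ⟨V, hG⟩ Γ ⟨W, hΓ⟩ => ⟨⟨_, hG.isProper_bracket hT hΓ⟩, ?_⟩⟩
  rw [GaugeBC.Theory.bracket_antisymm hT]
  exact Submodule.smul_mem _ _ ⟨_, hG.isProper_bracket hT hΓ⟩
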